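/- **Notation.** Let $n\ge 1$. Let $P=\bigoplus_{i=1}^n\mathbb Z a_i$ be the weight lattice of $\mathfrak{sp}_{2n}(\mathbb C)$, $S=\operatorname{Sym}(P)\otimes\mathbb C=\mathbb C[a_1,\dots,a_n]$, and let $Q^\vee=\operatorname{Hom}(P,\mathbb Z)=\bigoplus_i\mathbb Z\varepsilon_i$ with $\varepsilon_1,\dots,\varepsilon_n$ dual to $a_1,\dots,a_n$. The simple roots are $\alpha_k=a_k-a_{k+1}$ ($1\le k<n$) and $\alpha_n=2a_n$; $\Phi$ is the set of roots, $W$ is the Weyl group generated by the simple reflections $s_1,\dots,s_n$, $\theta=2a_1$ is the highest root with coroot $\theta^\vee=\varepsilon_1$, and $\alpha_0=-\theta$. Let $W_{\mathrm{af}}=Q^\vee\rtimes W$ with translations $t_\lambda$ ($\lambda\in Q^\vee$); it is generated by $s_0=t_{\theta^\vee}s_\theta,s_1,\dots,s_n$. It acts on $S^{\mathrm{reg}}=S[\alpha^{-1}:\alpha\in\Phi]$ through the projection $W_{\mathrm{af}}\to W$, $t_\lambda w\mapsto w$. The level zero affine nil-Hecke algebra $\mathbb A_{\mathrm{af}}$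 is the subring of the twisted group algebra $S^{\mathrm{reg}}[W_{\mathrm{af}}]$ generated by $S$ and by $A_i=\alpha_i^{-1}(1-s_i)$, $0\le i\le n$; it contains $W_{\mathrm{af}}$. For $w\in W_{\mathrm{af}}$ with reduced word $s_{i_1}\cdots s_{i_l}$ put $A_w=A_{i_1}\cdots A_{i_l}$. Let $W_{\mathrm{af}}^0$ be the set of $w\in W_{\mathrm{af}}$ of minimal length in their coset $wW$. *Symmetric functions.* Let $\hat\Lambda_S$ be the ring of formal sums $\sum_{k\ge0}f_k$, where $f_k$ is a symmetric function in $y=(y_1,y_2,\dots)$ with coefficients in $S$, homogeneous of degree $k$ in $y$. For $c\in S$ put $$\Omega(c|y)=\prod_{j\ge1}\frac{1+cy_j}{1-cy_j}=\sum_{k\ge0}c^kQ_k(y),$$ and for $i\ge0$ and $c_1,\dots,c_m\in S$ put $\hat q_i(y|c_1,\dots,c_m)=\sum_{k\ge0}h_k(c_1,\dots,c_m)\,Q_{i+k}(y)$, where $h_k$ is the complete homogeneous symmetric polynomial. The ring $\hat\Lambda_S$ is an $\mathbb A_{\mathrm{af}}$-module: $S$ acts by multiplication, $W$ acts on the coefficients,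 $t_{\varepsilon_i}$ acts by multiplication by $\Omega(a_i|y)$, and $A_if=\alpha_i^{-1}(f-s_if)$. For $w\in W_{\mathrm{af}}^0$ let $\hat P^{(n)}_w(y|a)=A_w(1)\in\hat\Lambda_S$, and let $\hat\Gamma^{(n)}\subseteq\hat\Lambda_S$ be the $S$-span of all $\hat P_w^{(n)}(y|a)$, $w\in W_{\mathrm{af}}^0$. *Centralizer family.* Let $b=(b_1,\dots,b_{2n+1})=(a_1,\dots,a_n,0,-a_n,\dots,-a_1)$, let $L_0$ be the $(2n+1)\times(2n+1)$ matrix over $S$ with diagonal entries $b_1,\dots,b_{2n+1}$, entries $-1$ on the superdiagonal and zeros elsewhere, and let $J=\sum_{i=1}^{2n+1}(-1)^{i+1}E_{i,2n+2-i}$. Realize $\mathrm{SO}_{2n+1}$ by the equations ${}^t\!gJg=J$, $\det g=1$. The ring $\mathbb C[\mathcal Z_{\mathrm{SO}_{2n+1}}]$ is the $S$-algebra generated by the entries $z_{ij}$ of a $(2n+1)\times(2n+1)$ matrix $Z$ subject to the relations $$z_{ij}=0\ (i>j),\qquad {}^t\!ZJZ=J,\qquad \det Z=1,\qquad ZL_0=L_0Z.$$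 For $1\le k\le n$ let $f_k=E_{k+1,k}+E_{2n+2-k,2n+1-k}$. The simple reflection $s_k\in W$ acts on $\mathbb C[\mathcal Z_{\mathrm{SO}_{2n+1}}]$ by the ring endomorphism that extends $s_k:S\to S$ and sends $Z$ to $\exp(-\alpha_kf_k)\,Z\,\exp(\alpha_kf_k)$. **Theorem.** 1. There is exactly one $\mathbb A_{\mathrm{af}}$-module structure on the additive group $\mathbb C[\mathcal Z_{\mathrm{SO}_{2n+1}}]$ in which $S$ acts by multiplication, $s_1,\dots,s_n$ act as just described, and $t_{\varepsilon_i}$ acts by multiplication by $z_{ii}$ for $1\le i\le n$. 2. $\hat\Gamma^{(n)}$ is an $S$-subalgebra and an $\mathbb A_{\mathrm{af}}$-submodule of $\hat\Lambda_S$. 3. There is an isomorphism of $S$-algebras, which is also an isomorphism of $\mathbb A_{\mathrm{af}}$-modules, $\beta:\mathbb C[\mathcal Z_{\mathrm{SO}_{2n+1}}]\to\hat\Gamma^{(n)}$ such that $$\beta(z_{ij})=(-1)^{j-i}\,\hat q_{j-i}(y|b_i,\dots,b_j)\qquad(1\le i\le j\le 2n+1).$$ In particular $\beta(z_{ii})=\Omega(a_i|y)$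 for $1\le i\le n$. -/

import Mathlib

namespace TypeC

open MvPolynomial

noncomputable section

/-! ### The weight lattice, the Weyl group and the ring `S` -/

/-- The weight lattice `P = ⨁ ℤ aᵢ` of `𝔰𝔭₂ₙ`, a weight being given by its coordinates in the basis
`a₁, …, aₙ` (which is indexed by `Fin n`, so that `a_{i+1}` has index `i`). -/
abbrev P (n : ℕ) := Fin n → ℤ

/-- The coroot lattice `Q^∨ = ⨁ ℤ εᵢ = Hom(P, ℤ)`. -/
abbrev QDual (n : ℕ) := Module.Dual ℤ (P n)

/-- The dual basis `ε₁, …, εₙ` of `a₁, …, aₙ`. -/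
def eps {n : ℕ} (i : Fin n) : QDual n := LinearMap.proj i

/-- Simple roots: `aₖ - aₖ₊₁` for `k < n`, and `2 aₙ`. -/
def simpleRoot {n : ℕ} (k : Fin n) : P n :=
  if h : (k : ℕ) + 1 < n then Pi.single k 1 - Pi.single ⟨k + 1, h⟩ 1 else Pi.single k 2

/-- Simple coroots: `εₖ - εₖ₊₁` for `k < n`, and `εₙ`. -/
def simpleCoroot {n : ℕ} (k : Fin n) : QDual n :=
  if h : (k : ℕ) + 1 < n then eps k - eps ⟨k + 1, h⟩ else eps k

theorem simpleCoroot_simpleRoot {n : ℕ} (k : Fin n) : simpleCoroot k (simpleRoot k) = 2 := by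
  unfold simpleCoroot simpleRoot eps
  split_ifs with h
  · have h1 : k ≠ ⟨k + 1, h⟩ := fun e => by simpa using congrArg Fin.val e
    simp [Pi.single_eq_of_ne h1, Pi.single_eq_of_ne h1.symm]
  · simp

/-- The simple reflection `sₖ(v) = v - ⟨αₖ^∨, v⟩ αₖ`. -/
def simpleReflection {n : ℕ} (k : Fin n) : P n ≃ₗ[ℤ] P n :=
  Module.reflection (simpleCoroot_simpleRoot k)

/-- The Weyl group, generated by the simple reflections. -/
def W (n : ℕ) : Subgroup (P n ≃ₗ[ℤ] P n) :=
  Subgroup.closure (Set.range simpleReflection)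

/-- The simple reflections as elements of `W`. -/
def sW {n : ℕ} (k : Fin n) : W n := ⟨simpleReflection k, Subgroup.subset_closure ⟨k, rfl⟩⟩

/-- The set of roots `Φ`: the `W`-orbits of the simple roots. -/
def roots (n : ℕ) : Set (P n) := {v | ∃ w ∈ W n, ∃ k : Fin n, v = w (simpleRoot k)}

theorem eps_single_two {n : ℕ} (i : Fin n) : eps i (Pi.single i 2 : P n) = 2 := by
  simp [eps]

/-- The reflection in the long root `2 aᵢ`, whose coroot is `εᵢ`. -/
def longReflection {n : ℕ} (i : Fin n) : P n ≃ₗ[ℤ] P n :=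
  Module.reflection (eps_single_two i)

theorem longReflection_apply {n : ℕ} (i : Fin n) (v : P n) :
    longReflection i v = Function.update v i (-v i) := by
  ext j
  by_cases h : j = i
  · subst h; simp [longReflection, Module.reflection_apply, eps]; ring
  · simp [longReflection, Module.reflection_apply, eps, h]

theorem simpleReflection_last {n : ℕ} (k : Fin n) (h : ¬ (k : ℕ) + 1 < n) :
    simpleReflection k = longReflection k := by
  ext v : 1
  simp [simpleReflection, longReflection, Module.reflection_apply, simpleRoot, simpleCoroot, h]

theorem simpleReflection_apply_swap {n : ℕ} (k : Fin n) (h : (k : ℕ) + 1 < n) (v : P n) :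
    simpleReflection k v = v ∘ Equiv.swap k ⟨k + 1, h⟩ := by
  have h1 : k ≠ ⟨k + 1, h⟩ := fun e => by simpa using congrArg Fin.val e
  ext j
  simp only [simpleReflection, Module.reflection_apply, simpleRoot, simpleCoroot, h, eps,
    dite_true, LinearMap.sub_apply, LinearMap.proj_apply, Pi.sub_apply, Pi.smul_apply,
    smul_eq_mul, Function.comp_apply]
  by_cases hj : j = k
  · subst hj; simp [Pi.single_eq_of_ne h1]
  · by_cases hj' : j = ⟨k + 1, h⟩
    · subst hj'; simp [Pi.single_eq_of_ne h1.symm]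
    · simp [Pi.single_eq_of_ne hj, Pi.single_eq_of_ne hj', Equiv.swap_apply_of_ne_of_ne hj hj']

theorem simpleReflection_conj {n : ℕ} (k : Fin n) (h : (k : ℕ) + 1 < n) :
    longReflection k = simpleReflection k * longReflection ⟨k + 1, h⟩ * simpleReflection k := by
  have h1 : k ≠ ⟨k + 1, h⟩ := fun e => by simpa using congrArg Fin.val e
  ext v : 1
  simp only [LinearEquiv.mul_apply, simpleReflection_apply_swap k h, longReflection_apply]
  funext j
  simp only [Function.comp_apply, Function.update_apply]
  by_cases hj : j = k
  · subst hj; simp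
  · by_cases hj' : j = ⟨k + 1, h⟩
    · subst hj'; simp [h1, h1.symm]
    · simp [Equiv.swap_apply_of_ne_of_ne hj hj', hj, hj']

theorem longReflection_mem_aux {n : ℕ} (m : ℕ) : ∀ i : Fin n, (i : ℕ) + 1 + m = n →
    longReflection i ∈ W n ∧ (Pi.single i 2 : P n) ∈ roots n := by
  induction m with
  | zero =>
    intro i hi
    have h : ¬ (i : ℕ) + 1 < n := by omega
    refine ⟨simpleReflection_last i h ▸ (sW i).2, 1, one_mem _, i, ?_⟩
    simp [simpleRoot, h]
  | succ m ih =>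
    intro i hi
    have h : (i : ℕ) + 1 < n := by omega
    obtain ⟨h2, w, hw, k, hk⟩ := ih ⟨i + 1, h⟩ (by simp; omega)
    refine ⟨?_, simpleReflection i * w, mul_mem (sW i).2 hw, k, ?_⟩
    · rw [simpleReflection_conj i h]
      exact mul_mem (mul_mem (sW i).2 h2) (sW i).2
    · rw [LinearEquiv.mul_apply, ← hk, simpleReflection_apply_swap i h]
      funext j
      have h1 : i ≠ ⟨i + 1, h⟩ := fun e => by simpa using congrArg Fin.val e
      simp only [Function.comp_apply, Pi.single_apply]
      by_cases hj : j = i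
      · subst hj; simp
      · by_cases hj' : j = ⟨i + 1, h⟩
        · subst hj'; simp [h1, h1.symm]
        · simp [Equiv.swap_apply_of_ne_of_ne hj hj', hj, hj']

theorem longReflection_mem {n : ℕ} (i : Fin n) : longReflection i ∈ W n :=
  (longReflection_mem_aux (n - (i + 1)) i (by omega)).1

theorem long_mem_roots {n : ℕ} (i : Fin n) : (Pi.single i 2 : P n) ∈ roots n :=
  (longReflection_mem_aux (n - (i + 1)) i (by omega)).2

/-- The highest root `θ = 2 a₁`; its coroot is `ε₁`. -/
def theta (n : ℕ) [NeZero n] : P n := Pi.single 0 2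

/-- The reflection `s_θ`, as an element of `W`. -/
def sTheta (n : ℕ) [NeZero n] : W n := ⟨longReflection 0, longReflection_mem 0⟩

/-- `S = Sym(P) ⊗ ℂ = ℂ[a₁, …, aₙ]`. -/
abbrev S (n : ℕ) := MvPolynomial (Fin n) ℂ

/-- The embedding of the weight lattice `P` into `S` as linear forms. -/
def toS {n : ℕ} : P n →+ S n where
  toFun v := ∑ j, (v j) • (X j : S n)
  map_zero' := by simp
  map_add' v w := by simp [add_smul, Finset.sum_add_distrib]

theorem toS_single {n : ℕ} (i : Fin n) (c : ℤ) : toS (Pi.single i c : P n) = c • (X i : S n) := by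
  simp [toS, Pi.single_apply]

theorem toS_one {n : ℕ} (i : Fin n) : (X i : S n) = toS (Pi.single i 1) := by simp [toS_single]

/-- The automorphism of `S` induced by an automorphism of `P`. -/
def autS {n : ℕ} (g : P n ≃ₗ[ℤ] P n) : S n →ₐ[ℂ] S n :=
  aeval fun i => toS (g (Pi.single i 1))

theorem autS_toS {n : ℕ} (g : P n ≃ₗ[ℤ] P n) (v : P n) : autS g (toS v) = toS (g v) := by
  have h : v = ∑ j, v j • (Pi.single j 1 : P n) := by
    funext i; simp [Finset.sum_apply, Pi.single_apply]
  conv_rhs => rw [h]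
  simp only [map_sum, map_zsmul]
  simp [autS, toS]

theorem autS_mul {n : ℕ} (g h : P n ≃ₗ[ℤ] P n) (p : S n) :
    autS (g * h) p = autS g (autS h p) := by
  rw [← AlgHom.comp_apply]
  congr 1
  ext i : 1
  have : (X i : S n) = toS (Pi.single i 1) := by simp [toS_single]
  rw [AlgHom.comp_apply, this, autS_toS, autS_toS, autS_toS, LinearEquiv.mul_apply]

theorem autS_one {n : ℕ} (p : S n) : autS (1 : P n ≃ₗ[ℤ] P n) p = p := by
  have : autS (1 : P n ≃ₗ[ℤ] P n) = AlgHom.id ℂ (S n) := by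
    ext i : 1
    simp [autS, toS_single]
  rw [this, AlgHom.id_apply]

/-- The natural action of `W` on `S`. -/
instance (n : ℕ) : MulSemiringAction (W n) (S n) where
  smul w p := autS w.1 p
  one_smul p := autS_one p
  mul_smul v w p := autS_mul v.1 w.1 p
  smul_zero w := map_zero (autS w.1)
  smul_add w := map_add (autS w.1)
  smul_one w := map_one (autS w.1)
  smul_mul w := map_mul (autS w.1)

theorem smul_S_def {n : ℕ} (w : W n) (p : S n) : w • p = autS w.1 p := rfl

theorem smul_toS {n : ℕ} (w : W n) (v : P n) : w • (toS v : S n) = toS (w.1 v) := autS_toS w.1 v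

/-! ### The localization `S^reg` -/

/-- The multiplicative set generated by the roots. -/
def rootMonoid (n : ℕ) : Submonoid (S n) := Submonoid.closure (toS '' roots n)

/-- `S^reg = S[α⁻¹ : α ∈ Φ]`. -/
def Sreg (n : ℕ) : Type := Localization (rootMonoid n)

instance (n : ℕ) : CommRing (Sreg n) := inferInstanceAs (CommRing (Localization (rootMonoid n)))

instance (n : ℕ) : Algebra (S n) (Sreg n) :=
  inferInstanceAs (Algebra (S n) (Localization (rootMonoid n)))

instance (n : ℕ) : IsLocalization (rootMonoid n) (Sreg n) :=
  inferInstanceAs (IsLocalization (rootMonoid n) (Localization (rootMonoid n)))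

theorem rootMonoid_smul {n : ℕ} (w : W n) :
    rootMonoid n ≤ (rootMonoid n).comap (MulSemiringAction.toRingHom (W n) (S n) w) := by
  rw [rootMonoid, Submonoid.closure_le]
  rintro _ ⟨v, ⟨u, hu, k, rfl⟩, rfl⟩
  refine Submonoid.subset_closure ⟨w.1 (u (simpleRoot k)), ⟨w.1 * u, mul_mem w.2 hu, k, rfl⟩, ?_⟩
  exact (smul_toS w _).symm

/-- The automorphism of `S^reg` induced by `w`. -/
def autSreg {n : ℕ} (w : W n) : Sreg n →+* Sreg n :=
  IsLocalization.map (Sreg n) (MulSemiringAction.toRingHom (W n) (S n) w) (rootMonoid_smul w)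

theorem autSreg_algebraMap {n : ℕ} (w : W n) (p : S n) :
    autSreg w (algebraMap (S n) (Sreg n) p) = algebraMap (S n) (Sreg n) (w • p) := by
  simp [autSreg]

/-- The natural action of `W` on `S^reg`. -/
instance (n : ℕ) : MulSemiringAction (W n) (Sreg n) where
  smul w p := autSreg w p
  one_smul p := by
    change autSreg 1 p = p
    have : autSreg (1 : W n) = RingHom.id _ := by
      apply IsLocalization.ringHom_ext (rootMonoid n)
      refine RingHom.ext fun p => ?_
      simp [autSreg_algebraMap]
    simp [this]
  mul_smul v w p := by
    change autSreg (v * w) p = autSreg v (autSreg w p)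
    have : autSreg (v * w) = (autSreg v).comp (autSreg w) := by
      apply IsLocalization.ringHom_ext (rootMonoid n)
      refine RingHom.ext fun p => ?_
      simp [autSreg_algebraMap, mul_smul]
    simp [this]
  smul_zero w := map_zero (autSreg w)
  smul_add w := map_add (autSreg w)
  smul_one w := map_one (autSreg w)
  smul_mul w := map_mul (autSreg w)

theorem smul_Sreg_def {n : ℕ} (w : W n) (p : Sreg n) : w • p = autSreg w p := rfl

/-! ### The affine Weyl group and the level zero affine nil-Hecke algebra -/

/-- The action of `W` on `Q^∨ = Hom(P, ℤ)`, written multiplicatively: `w(λ) = λ ∘ w⁻¹`. -/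
def actQDual (n : ℕ) : W n →* MulAut (Multiplicative (QDual n)) where
  toFun w := AddEquiv.toMultiplicative w.1.symm.dualMap.toAddEquiv
  map_one' := by ext; rfl
  map_mul' v w := by ext; rfl

theorem actQDual_apply {n : ℕ} (w : W n) (lam : QDual n) (v : P n) :
    (actQDual n w (Multiplicative.ofAdd lam)).toAdd v = lam (w.1.symm v) := rfl

/-- The affine Weyl group `W_af = Q^∨ ⋊ W`. -/
abbrev Waf (n : ℕ) := Multiplicative (QDual n) ⋊[actQDual n] W n

/-- The translation element `t_λ`. -/
def transl {n : ℕ} (lam : QDual n) : Waf n := SemidirectProduct.inl (Multiplicative.ofAdd lam)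

/-- The generators `s₀ = t_{θ^∨} s_θ, s₁, …, sₙ` of the affine Weyl group. -/
def sAf {n : ℕ} [NeZero n] (i : Fin (n + 1)) : Waf n :=
  Fin.cases (transl (eps 0) * SemidirectProduct.inr (sTheta n))
    (fun k => SemidirectProduct.inr (sW k)) i

/-- The level zero projections `α₀ = -θ, α₁, …, αₙ` of the affine simple roots. -/
def alphaAf {n : ℕ} [NeZero n] (i : Fin (n + 1)) : P n := Fin.cases (-theta n) simpleRoot i

theorem alphaAf_mem_roots {n : ℕ} [NeZero n] (i : Fin (n + 1)) : alphaAf i ∈ roots n := by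
  refine Fin.cases ?_ (fun k => ?_) i
  · obtain ⟨w, hw, k, hk⟩ := long_mem_roots (0 : Fin n)
    refine ⟨longReflection 0 * w, mul_mem (longReflection_mem 0) hw, k, ?_⟩
    rw [LinearEquiv.mul_apply, ← hk]
    simp [alphaAf, theta, longReflection, Module.reflection_apply_self]
  · exact ⟨1, one_mem _, k, rfl⟩

theorem isUnit_alphaAf {n : ℕ} [NeZero n] (i : Fin (n + 1)) :
    IsUnit (algebraMap (S n) (Sreg n) (toS (alphaAf i))) :=
  IsLocalization.map_units (Sreg n)
    (⟨_, Submonoid.subset_closure ⟨_, alphaAf_mem_roots i, rfl⟩⟩ : rootMonoid n)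

/-- The level zero action of `W_af` on `S^reg`, through the projection `t_λ v ↦ v` to `W`. -/
instance (n : ℕ) : MulSemiringAction (Waf n) (Sreg n) :=
  MulSemiringAction.compHom (Sreg n) (SemidirectProduct.rightHom (φ := actQDual n))

theorem smul_Sreg_eq {n : ℕ} (x : Waf n) (p : Sreg n) : x • p = x.right • p := rfl

/-- The twisted group algebra `S^reg[W_af]`, with `(f v)(g w) = f v(g) vw`. -/
abbrev TwistedGroupAlgebra (n : ℕ) := SkewMonoidAlgebra (Sreg n) (Waf n)

/-- The element `Aᵢ = αᵢ⁻¹ (1 - sᵢ)` of `S^reg[W_af]`. -/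
def demazure {n : ℕ} [NeZero n] (i : Fin (n + 1)) : TwistedGroupAlgebra n :=
  SkewMonoidAlgebra.single 1 (((isUnit_alphaAf i).unit⁻¹ : (Sreg n)ˣ) : Sreg n) *
    (1 - SkewMonoidAlgebra.of (Sreg n) (Waf n) (sAf i))

/-- The embedding of `S` in `S^reg[W_af]`. -/
def embS (n : ℕ) : S n →+* TwistedGroupAlgebra n :=
  (SkewMonoidAlgebra.singleOneRingHom (k := Sreg n) (G := Waf n)).comp (algebraMap (S n) (Sreg n))

/-- The level zero affine nil-Hecke algebra `𝔸_af`: the subring of `S^reg[W_af]` generated by `S`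
and the elements `A₀, …, Aₙ`. -/
def NilHecke (n : ℕ) [NeZero n] : Subring (TwistedGroupAlgebra n) :=
  Subring.closure (Set.range (embS n) ∪ Set.range demazure)

/-- The element `p ∈ S` of `𝔸_af`. -/
def NilHecke.ofS {n : ℕ} [NeZero n] (p : S n) : NilHecke n :=
  ⟨embS n p, Subring.subset_closure (Or.inl ⟨p, rfl⟩)⟩

/-- The element `Aᵢ` of `𝔸_af`. -/
def NilHecke.A {n : ℕ} [NeZero n] (i : Fin (n + 1)) : NilHecke n :=
  ⟨demazure i, Subring.subset_closure (Or.inr ⟨i, rfl⟩)⟩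

theorem embS_mul_demazure {n : ℕ} [NeZero n] (i : Fin (n + 1)) :
    embS n (toS (alphaAf i)) * demazure i =
      1 - SkewMonoidAlgebra.of (Sreg n) (Waf n) (sAf i) := by
  have h : embS n (toS (alphaAf i)) *
      SkewMonoidAlgebra.single 1 (((isUnit_alphaAf i).unit⁻¹ : (Sreg n)ˣ) : Sreg n) = 1 := by
    change SkewMonoidAlgebra.single 1 _ * SkewMonoidAlgebra.single 1 _ = _
    rw [SkewMonoidAlgebra.single_mul_single, one_smul, one_mul]
    exact congrArg _ ((isUnit_alphaAf i).mul_val_inv)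
  rw [demazure, ← mul_assoc, h, one_mul]

theorem sAf_mul_self {n : ℕ} [NeZero n] (i : Fin (n + 1)) : (sAf i : Waf n) * sAf i = 1 := by
  refine Fin.cases ?_ (fun k => ?_) i
  · have h1 : sTheta n * sTheta n = 1 := by
      apply Subtype.ext
      ext v : 1
      exact Module.involutive_reflection (eps_single_two (0 : Fin n)) v
    have h2 : actQDual n (sTheta n) (Multiplicative.ofAdd (eps 0)) =
        (Multiplicative.ofAdd (eps 0))⁻¹ := by
      apply Multiplicative.toAdd.injective
      refine LinearMap.ext fun v => ?_
      rw [actQDual_apply]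
      change (longReflection 0).symm v 0 = - v 0
      have : (longReflection (0 : Fin n)).symm v = longReflection 0 v := rfl
      rw [this, longReflection_apply]
      simp
    apply SemidirectProduct.ext
    · simp [sAf, transl, h2]
    · simp [sAf, transl, h1]
  · simp only [sAf, Fin.cases_succ, ← map_mul]
    have : sW k * sW k = 1 := by
      apply Subtype.ext
      ext v : 1
      exact Module.involutive_reflection (simpleCoroot_simpleRoot k) v
    rw [this, map_one]

theorem conj_transl {n : ℕ} (w : W n) (lam : QDual n) :
    (SemidirectProduct.inr w : Waf n) * transl lam * (SemidirectProduct.inr w)⁻¹ =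
      transl (lam ∘ₗ w.1.symm.toLinearMap) := by
  rw [transl, ← map_inv, ← SemidirectProduct.inl_aut]
  rfl

/-- `W_af` is generated by `s₀, …, sₙ`. -/
theorem closure_sAf (n : ℕ) [NeZero n] :
    Subgroup.closure (Set.range (sAf (n := n))) = ⊤ := by
  set H := Subgroup.closure (Set.range (sAf (n := n))) with hH
  have hs : ∀ i, sAf i ∈ H := fun i => Subgroup.subset_closure ⟨i, rfl⟩
  have hr : ∀ w : W n, (SemidirectProduct.inr w : Waf n) ∈ H := by
    rintro ⟨w, hw⟩
    induction hw using Subgroup.closure_induction with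
    | mem x hx => obtain ⟨k, rfl⟩ := hx; exact hs k.succ
    | one => exact one_mem H
    | mul x y hx hy h1 h2 => exact mul_mem h1 h2
    | inv x hx h => exact inv_mem h
  have ht : ∀ m : ℕ, ∀ h : m < n, transl (eps (⟨m, h⟩ : Fin n)) ∈ H := by
    intro m
    induction m with
    | zero =>
      intro h
      have h0 := mul_mem (hs 0) (inv_mem (hr (sTheta n)))
      simpa [sAf] using h0
    | succ m ih =>
      intro h
      have h1 := mul_mem (mul_mem (hr (sW ⟨m, by omega⟩)) (ih (by omega)))
        (inv_mem (hr (sW ⟨m, by omega⟩)))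
      rw [conj_transl] at h1
      convert h1 using 2
      refine LinearMap.ext fun v => ?_
      change v ⟨m + 1, h⟩ = simpleReflection (⟨m, by omega⟩ : Fin n) v ⟨m, by omega⟩
      rw [simpleReflection_apply_swap _ h]
      simp
  have htr : ∀ lam : QDual n, transl lam ∈ H := by
    intro lam
    have h1 : lam = ∑ i, lam (Pi.single i 1) • eps i := by
      refine LinearMap.pi_ext' fun i => LinearMap.ext_ring ?_
      simp [eps, Pi.single_apply]
    have h2 : ∀ s : Finset (Fin n), transl (∑ i ∈ s, lam (Pi.single i 1) • eps i) ∈ H := by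
      intro s
      induction s using Finset.cons_induction with
      | empty => simp [transl]
      | cons a s ha ih =>
        rw [Finset.sum_cons]
        simp only [transl, ofAdd_add, map_mul, ofAdd_zsmul, map_zpow]
        exact mul_mem (zpow_mem (ht a.1 a.2) _) ih
    rw [h1]
    exact h2 _
  rw [eq_top_iff]
  intro x _
  rw [← SemidirectProduct.inl_left_mul_inr_right x]
  exact mul_mem (htr _) (hr _)

theorem of_mem_nilHecke {n : ℕ} [NeZero n] (x : Waf n) :
    SkewMonoidAlgebra.of (Sreg n) (Waf n) x ∈ NilHecke n := by
  have hx : x ∈ Subgroup.closure (Set.range (sAf (n := n))) := by rw [closure_sAf]; trivial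
  have hg : ∀ i, SkewMonoidAlgebra.of (Sreg n) (Waf n) (sAf i) ∈ NilHecke n := by
    intro i
    have := sub_mem (one_mem (NilHecke n)) (mul_mem (NilHecke.ofS (toS (alphaAf i))).2
      (NilHecke.A i).2)
    change 1 - embS n (toS (alphaAf i)) * demazure i ∈ NilHecke n at this
    rwa [embS_mul_demazure, sub_sub_cancel] at this
  have hinv : ∀ i, (sAf i : Waf n)⁻¹ = sAf i := fun i =>
    inv_eq_of_mul_eq_one_left (sAf_mul_self i)
  induction hx using Subgroup.closure_induction'' with
  | one => rw [map_one]; exact one_mem _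
  | mem x hx => obtain ⟨i, rfl⟩ := hx; exact hg i
  | inv_mem x hx => obtain ⟨i, rfl⟩ := hx; rw [hinv]; exact hg i
  | mul x y hx hy h1 h2 => rw [map_mul]; exact mul_mem h1 h2

/-- The element `x ∈ W_af` of `𝔸_af`; note that `sᵢ = 1 - αᵢ Aᵢ`. -/
def NilHecke.ofWaf {n : ℕ} [NeZero n] (x : Waf n) : NilHecke n :=
  ⟨SkewMonoidAlgebra.of (Sreg n) (Waf n) x, of_mem_nilHecke x⟩

/-- The length of an element of `W_af` with respect to `s₀, …, sₙ`. -/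
def len {n : ℕ} [NeZero n] (x : Waf n) : ℕ :=
  sInf {m | ∃ l : List (Fin (n + 1)), l.length = m ∧ (l.map sAf).prod = x}

/-- `l` is a reduced word. -/
def IsReducedWord {n : ℕ} [NeZero n] (l : List (Fin (n + 1))) : Prop :=
  l.length = len (l.map (sAf (n := n))).prod

/-- `x` belongs to `W_af⁰`: it has minimal length in its coset `xW`. -/
def IsGrassmannian {n : ℕ} [NeZero n] (x : Waf n) : Prop :=
  ∀ v : W n, len x ≤ len (x * SemidirectProduct.inr v)

/-! ### Symmetric functions -/

/-- The completed ring `Λ̂_S` of symmetric functions in `y = (y₁, y₂, …)` with coefficients in `S`: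
its elements are the formal sums `∑ₖ fₖ` of symmetric functions `fₖ` over `S` that are homogeneous
of degree `k` in `y`, that is, the symmetric formal power series over `S`. -/
def LamHat (n : ℕ) : Subalgebra (S n) (MvPowerSeries ℕ (S n)) where
  carrier := {f | ∀ σ : Equiv.Perm ℕ, MvPowerSeries.renameEquiv (S n) σ f = f}
  mul_mem' hf hg σ := by rw [map_mul, hf σ, hg σ]
  add_mem' hf hg σ := by rw [map_add, hf σ, hg σ]
  algebraMap_mem' r σ := AlgEquiv.commutes _ r

theorem coeff_renameEquiv {R : Type*} [CommRing R] (σ : Equiv.Perm ℕ) (f : MvPowerSeries ℕ R)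
    (d : ℕ →₀ ℕ) : MvPowerSeries.coeff d (MvPowerSeries.renameEquiv R σ f) =
      MvPowerSeries.coeff (d.mapDomain σ.symm) f := by
  have h := MvPowerSeries.coeff_embDomain_rename σ.toEmbedding f (d.mapDomain σ.symm)
  rw [← h]
  have h2 : (d.mapDomain σ.symm).embDomain σ.toEmbedding = d := by
    rw [Finsupp.embDomain_eq_mapDomain, ← Finsupp.mapDomain_comp]
    have : (σ.toEmbedding : ℕ → ℕ) ∘ σ.symm = id := by ext x; simp
    rw [this, Finsupp.mapDomain_id]
  rw [h2]
  rfl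

theorem mem_LamHat_of_coeff {n : ℕ} {f : MvPowerSeries ℕ (S n)}
    (h : ∀ d e : ℕ →₀ ℕ, d.degree = e.degree → d.support.card = e.support.card →
      MvPowerSeries.coeff d f = MvPowerSeries.coeff e f) : f ∈ LamHat n := by
  intro σ
  ext1 d
  rw [coeff_renameEquiv]
  apply h
  · exact Finsupp.degree_mapDomain _ _
  · rw [Finsupp.mapDomain_support_of_injective σ.symm.injective,
      Finset.card_image_of_injective _ σ.symm.injective]

/-- The function `Q_k(y)`, i.e. the coefficient of `u^k` in `∏ⱼ (1 + u yⱼ) / (1 - u yⱼ)`. As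
`(1 + u y) / (1 - u y) = 1 + 2 ∑_{m ≥ 1} u^m y^m`, the coefficient of a monomial of degree `k` that
involves `r` distinct variables is `2^r`. -/
def schurQ (n k : ℕ) : MvPowerSeries ℕ (S n) :=
  fun d => if d.degree = k then 2 ^ d.support.card else 0

theorem coeff_schurQ (n k : ℕ) (d : ℕ →₀ ℕ) : MvPowerSeries.coeff d (schurQ n k) =
    if d.degree = k then 2 ^ d.support.card else 0 := rfl

/-- The series `Ω(c|y) = ∏ⱼ (1 + c yⱼ) / (1 - c yⱼ) = ∑ₖ c^k Q_k(y)`; see `omegaSeries_prod` for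
the product formula. -/
def omegaSeries {R : Type*} [CommRing R] (c : R) : MvPowerSeries ℕ R :=
  fun d => c ^ d.degree * 2 ^ d.support.card

/-- `Ω(c|y)` with the variables outside of the finite set `s` put equal to `0`. -/
def omegaOn {R : Type*} [CommRing R] (s : Finset ℕ) (c : R) : MvPowerSeries ℕ R :=
  fun d => if d.support ⊆ s then c ^ d.degree * 2 ^ d.support.card else 0

theorem coeff_omegaSeries {R : Type*} [CommRing R] (c : R) (d : ℕ →₀ ℕ) :
    MvPowerSeries.coeff d (omegaSeries c) = c ^ d.degree * 2 ^ d.support.card := rfl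

theorem coeff_omegaOn {R : Type*} [CommRing R] (s : Finset ℕ) (c : R) (d : ℕ →₀ ℕ) :
    MvPowerSeries.coeff d (omegaOn s c) =
      if d.support ⊆ s then c ^ d.degree * 2 ^ d.support.card else 0 := rfl

theorem coeff_mul_C_X {R : Type*} [CommRing R] (f : MvPowerSeries ℕ R) (c : R) (j : ℕ)
    (d : ℕ →₀ ℕ) : MvPowerSeries.coeff d (f * (MvPowerSeries.C c * MvPowerSeries.X j)) =
      if d j = 0 then 0 else c * MvPowerSeries.coeff (d - Finsupp.single j 1) f := by
  have : MvPowerSeries.C c * MvPowerSeries.X j =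
      (MvPowerSeries.monomial (Finsupp.single j 1) c : MvPowerSeries ℕ R) := by
    rw [MvPowerSeries.X, ← MvPowerSeries.monomial_zero_eq_C_apply,
      MvPowerSeries.monomial_mul_monomial]
    simp
  rw [this, MvPowerSeries.coeff_mul_monomial]
  by_cases h : d j = 0
  · simp [h]
  · have : Finsupp.single j 1 ≤ d := by
      rw [Finsupp.single_le_iff]; omega
    simp [h, this, mul_comm]

theorem omegaOn_insert {R : Type*} [CommRing R] (c : R) (s : Finset ℕ) (j : ℕ) (hj : j ∉ s) :
    omegaOn (insert j s) c * (1 - MvPowerSeries.C c * MvPowerSeries.X j) =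
      omegaOn s c * (1 + MvPowerSeries.C c * MvPowerSeries.X j) := by
  ext1 d
  rw [mul_sub, mul_add, map_sub, map_add, mul_one, mul_one, coeff_mul_C_X, coeff_mul_C_X]
  by_cases h0 : d j = 0
  · have : d.support ⊆ insert j s ↔ d.support ⊆ s := by
      rw [Finset.subset_insert_iff_of_notMem]; simp [h0]
    simp [h0, coeff_omegaOn, this]
  · rw [if_neg h0, if_neg h0]
    set e := d - Finsupp.single j 1 with he
    have hde : d = e + Finsupp.single j 1 := by
      ext i
      by_cases hi : i = j
      · subst hi; simp [he]; omega
      · simp [he, Finsupp.single_eq_of_ne hi]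
    have hns : ¬ d.support ⊆ s := fun h => hj (h (by simpa using h0))
    have hdeg : d.degree = e.degree + 1 := by rw [hde]; simp
    have hsupp : d.support = insert j e.support := by
      ext i
      by_cases hi : i = j
      · subst hi; simp [h0]
      · simp [he, hi, Finsupp.single_eq_of_ne hi]
    have hins : d.support ⊆ insert j s ↔ e.support ⊆ insert j s := by
      rw [hsupp]
      simp [Finset.insert_subset_iff]
    rw [coeff_omegaOn, coeff_omegaOn, coeff_omegaOn, coeff_omegaOn, if_neg hns, zero_add, hdeg]
    by_cases h1 : e j = 0
    · have hje : j ∉ e.support := by simp [h1]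
      have hins' : e.support ⊆ insert j s ↔ e.support ⊆ s :=
        Finset.subset_insert_iff_of_notMem hje
      have hcard : d.support.card = e.support.card + 1 := by
        rw [hsupp, Finset.card_insert_of_notMem hje]
      simp only [hins, hins', hcard]
      split_ifs
      · ring
      · ring
    · have hje : j ∈ e.support := by simpa using h1
      have hes : ¬ e.support ⊆ s := fun h => hj (h hje)
      have hcard : d.support.card = e.support.card := by
        rw [hsupp, Finset.insert_eq_of_mem hje]
      simp only [hins, hcard, if_neg hes]
      split_ifs
      · ring
      · ring

/-- The product formula for `Ω(c|y)` in the variables `yⱼ`, `j ∈ s`. -/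
theorem omegaSeries_prod {R : Type*} [CommRing R] (c : R) (s : Finset ℕ) :
    omegaOn s c * ∏ j ∈ s, (1 - MvPowerSeries.C c * MvPowerSeries.X j) =
      ∏ j ∈ s, (1 + MvPowerSeries.C c * MvPowerSeries.X j) := by
  induction s using Finset.induction_on with
  | empty =>
    ext1 d
    simp only [Finset.prod_empty, mul_one, coeff_omegaOn, Finset.subset_empty,
      Finsupp.support_eq_empty]
    classical
    rw [MvPowerSeries.coeff_one]
    split_ifs with h
    · simp [h]
    · rfl
  | insert j s hj ih =>
    rw [Finset.prod_insert hj, Finset.prod_insert hj, ← mul_assoc, omegaOn_insert c s j hj,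
      mul_right_comm, ih, mul_comm]

theorem omegaOn_mul_neg {R : Type*} [CommRing R] (c : R) (s : Finset ℕ) :
    omegaOn s c * omegaOn s (-c) = 1 := by
  have h1 := omegaSeries_prod c s
  have h2 := omegaSeries_prod (-c) s
  simp only [map_neg, neg_mul, sub_neg_eq_add, ← sub_eq_add_neg] at h2
  have hu : ∀ c : R, IsUnit
      (∏ j ∈ s, (1 - MvPowerSeries.C c * MvPowerSeries.X j : MvPowerSeries ℕ R)) := by
    intro c
    rw [MvPowerSeries.isUnit_iff_constantCoeff, map_prod]
    simp
  have hu2 := hu (-c)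
  simp only [map_neg, neg_mul, sub_neg_eq_add] at hu2
  apply ((hu c).mul hu2).mul_right_cancel
  calc _ = (omegaOn s c * ∏ j ∈ s, (1 - MvPowerSeries.C c * MvPowerSeries.X j)) *
        (omegaOn s (-c) * ∏ j ∈ s, (1 + MvPowerSeries.C c * MvPowerSeries.X j)) := by ring
    _ = _ := by rw [h1, h2]; ring

theorem omegaSeries_mul_neg {R : Type*} [CommRing R] (c : R) :
    omegaSeries c * omegaSeries (-c) = 1 := by
  classical
  ext1 d
  rw [← omegaOn_mul_neg c d.support, MvPowerSeries.coeff_mul, MvPowerSeries.coeff_mul]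
  refine Finset.sum_congr rfl fun p hp => ?_
  have hp' : p.1 + p.2 = d := Finset.HasAntidiagonal.mem_antidiagonal.mp hp
  have h1 : p.1.support ⊆ d.support :=
    Finsupp.support_mono (by rw [← hp']; exact le_self_add)
  have h2 : p.2.support ⊆ d.support :=
    Finsupp.support_mono (by rw [← hp']; exact le_add_self)
  rw [coeff_omegaOn, coeff_omegaOn, if_pos h1, if_pos h2]
  rfl

/-- `Ω(c|y)` as a unit, with inverse `Ω(-c|y)`. -/
def omegaUnit {R : Type*} [CommRing R] (c : R) : (MvPowerSeries ℕ R)ˣ where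
  val := omegaSeries c
  inv := omegaSeries (-c)
  val_inv := omegaSeries_mul_neg c
  inv_val := by rw [mul_comm]; exact omegaSeries_mul_neg c

theorem omegaUnit_neg {R : Type*} [CommRing R] (c : R) : omegaUnit (-c) = (omegaUnit c)⁻¹ :=
  Units.ext rfl

theorem map_omegaSeries {R R' : Type*} [CommRing R] [CommRing R'] (f : R →+* R') (c : R) :
    MvPowerSeries.map f (omegaSeries c) = omegaSeries (f c) := by
  ext1 d
  rw [MvPowerSeries.coeff_map, coeff_omegaSeries, coeff_omegaSeries, map_mul, map_pow, map_pow,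
    map_ofNat]

theorem omegaSeries_mem {n : ℕ} (c : S n) : omegaSeries c ∈ LamHat n := by
  refine mem_LamHat_of_coeff fun d e h1 h2 => ?_
  rw [coeff_omegaSeries, coeff_omegaSeries, h1, h2]

/-- `Ω(c|y)` as an element of `Λ̂_S`, for `c ∈ S`. -/
def Omega {n : ℕ} (c : S n) : LamHat n := ⟨omegaSeries c, omegaSeries_mem c⟩

/-- The series `q̂ᵢ(y|c₁, …, c_m) = ∑_{k ≥ 0} h_k(c₁, …, c_m) Q_{i+k}(y)`, for a finite family `c`
of elements of `S`. In each degree the sum is finite: a monomial `y^d` occurs in `Q_{i+k}` only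
if `i + k = deg d`. -/
def qHatSeries {n : ℕ} {τ : Type*} [Fintype τ] [DecidableEq τ] (i : ℕ) (c : τ → S n) :
    MvPowerSeries ℕ (S n) :=
  fun d => ∑ k ∈ Finset.range (d.degree + 1),
    aeval c (hsymm τ ℂ k) * MvPowerSeries.coeff d (schurQ n (i + k))

theorem coeff_qHatSeries {n : ℕ} {τ : Type*} [Fintype τ] [DecidableEq τ] (i : ℕ) (c : τ → S n)
    (d : ℕ →₀ ℕ) : MvPowerSeries.coeff d (qHatSeries i c) =
      ∑ k ∈ Finset.range (d.degree + 1),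
        aeval c (hsymm τ ℂ k) * MvPowerSeries.coeff d (schurQ n (i + k)) := rfl

theorem qHatSeries_mem {n : ℕ} {τ : Type*} [Fintype τ] [DecidableEq τ] (i : ℕ) (c : τ → S n) :
    qHatSeries i c ∈ LamHat n := by
  refine mem_LamHat_of_coeff fun d e h1 h2 => ?_
  have h3 : ∀ m, MvPowerSeries.coeff d (schurQ n m) = MvPowerSeries.coeff e (schurQ n m) := by
    intro m
    rw [coeff_schurQ, coeff_schurQ, h1, h2]
  rw [coeff_qHatSeries, coeff_qHatSeries, h1]
  simp only [h3]

/-- `q̂ᵢ(y|c₁, …, c_m)` as an element of `Λ̂_S`. -/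
def qHat {n : ℕ} {τ : Type*} [Fintype τ] [DecidableEq τ] (i : ℕ) (c : τ → S n) : LamHat n :=
  ⟨qHatSeries i c, qHatSeries_mem i c⟩

/-! ### The action of `𝔸_af` on `Λ̂_S` -/

/-- Power series over `S^reg`. -/
abbrev PSreg (n : ℕ) := MvPowerSeries ℕ (Sreg n)

/-- The inclusion of power series over `S` into those over `S^reg`. -/
def toReg (n : ℕ) : MvPowerSeries ℕ (S n) →+* PSreg n :=
  MvPowerSeries.map (algebraMap (S n) (Sreg n))

/-- The element `∏ᵢ Ω(aᵢ|y)^{⟨λ, aᵢ⟩}` by which the translation `t_λ` acts. -/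
def tau (n : ℕ) : Multiplicative (QDual n) →* (PSreg n)ˣ where
  toFun lam := ∏ i, omegaUnit (algebraMap (S n) (Sreg n) (X i)) ^ lam.toAdd (Pi.single i 1)
  map_one' := by simp
  map_mul' lam mu := by simp [zpow_add, Finset.prod_mul_distrib]

/-- The action of `w ∈ W` on the coefficients of a power series over `S^reg`. -/
def coeffAut {n : ℕ} (w : W n) : PSreg n →+* PSreg n :=
  MvPowerSeries.map (MulSemiringAction.toRingHom (W n) (Sreg n) w)

theorem coeffAut_one {n : ℕ} (f : PSreg n) : coeffAut 1 f = f := by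
  ext1 d; simp [coeffAut]

theorem coeffAut_mul {n : ℕ} (v w : W n) (f : PSreg n) :
    coeffAut (v * w) f = coeffAut v (coeffAut w f) := by
  ext1 d; simp [coeffAut, mul_smul]

theorem coeffAut_omegaUnit {n : ℕ} (w : W n) (p : S n) :
    Units.map (coeffAut w : PSreg n →* PSreg n) (omegaUnit (algebraMap (S n) (Sreg n) p)) =
      omegaUnit (algebraMap (S n) (Sreg n) (w • p)) := by
  apply Units.ext
  change coeffAut w (omegaSeries _) = omegaSeries _
  rw [coeffAut, map_omegaSeries]
  exact congrArg _ (autSreg_algebraMap w p)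

theorem coeffAut_tau_simple {n : ℕ} (k : Fin n) (lam : QDual n) :
    Units.map (coeffAut (sW k) : PSreg n →* PSreg n) (tau n (Multiplicative.ofAdd lam)) =
      tau n (actQDual n (sW k) (Multiplicative.ofAdd lam)) := by
  simp only [tau, MonoidHom.coe_mk, OneHom.coe_mk, map_prod, map_zpow, coeffAut_omegaUnit,
    actQDual_apply, toAdd_ofAdd]
  have hsymm : ∀ v, (sW k).1.symm v = simpleReflection k v := fun v => rfl
  by_cases h : (k : ℕ) + 1 < n
  · have hs : ∀ i : Fin n, simpleReflection k (Pi.single i (1 : ℤ)) =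
        Pi.single (Equiv.swap k ⟨k + 1, h⟩ i) 1 := by
      intro i
      rw [simpleReflection_apply_swap k h]
      ext j
      simp only [Function.comp_apply, Pi.single_apply]
      congr 1
      rw [eq_iff_iff]
      constructor
      · intro e; rw [← e, Equiv.swap_apply_self]
      · intro e; rw [e, Equiv.swap_apply_self]
    rw [← Equiv.prod_comp (Equiv.swap k ⟨k + 1, h⟩)]
    refine Finset.prod_congr rfl fun i _ => ?_
    rw [hsymm, hs, toS_one, smul_toS]
    change omegaUnit (algebraMap _ _ (toS (simpleReflection k _))) ^ _ = _
    rw [hs, Equiv.swap_apply_self, ← toS_one]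
  · refine Finset.prod_congr rfl fun i _ => ?_
    rw [hsymm, toS_one, smul_toS]
    change omegaUnit (algebraMap _ _ (toS (simpleReflection k _))) ^ _ = _
    rw [simpleReflection_last k h, longReflection_apply]
    by_cases hi : i = k
    · subst hi
      have : Function.update (Pi.single i (1 : ℤ)) i (-(Pi.single i 1 : P n) i) =
          -(Pi.single i 1 : P n) := by
        ext j
        by_cases hj : j = i
        · subst hj; simp
        · simp [hj]
      rw [this, map_neg, map_neg, map_neg, omegaUnit_neg, inv_zpow, zpow_neg]
    · have : Function.update (Pi.single i (1 : ℤ)) k (-(Pi.single i 1 : P n) k) =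
          (Pi.single i 1 : P n) := by
        ext j
        by_cases hj : j = k
        · subst hj; simp [Pi.single_eq_of_ne (Ne.symm hi)]
        · simp [hj]
      rw [this]

theorem coeffAut_tau {n : ℕ} (w : W n) (lam : Multiplicative (QDual n)) :
    Units.map (coeffAut w : PSreg n →* PSreg n) (tau n lam) = tau n (actQDual n w lam) := by
  obtain ⟨w, hw⟩ := w
  induction hw using Subgroup.closure_induction generalizing lam with
  | mem x hx => obtain ⟨k, rfl⟩ := hx; exact coeffAut_tau_simple k lam.toAdd
  | one =>
    apply Units.ext
    change coeffAut 1 _ = _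
    rw [coeffAut_one]
    exact congrArg _ (congrArg _ (by rw [show (⟨1, _⟩ : W n) = 1 from rfl, map_one]; rfl))
  | mul x y hx hy h1 h2 =>
    have e : (⟨x * y, mul_mem hx hy⟩ : W n) = ⟨x, hx⟩ * ⟨y, hy⟩ := rfl
    rw [e, map_mul, MulAut.mul_apply, ← h1, ← h2]
    apply Units.ext
    exact coeffAut_mul _ _ _
  | inv x hx h =>
    have e : (⟨x⁻¹, inv_mem hx⟩ : W n) = ⟨x, hx⟩⁻¹ := rfl
    set w : W n := ⟨x, hx⟩
    have h1 := h (actQDual n w⁻¹ lam)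
    rw [← MulAut.mul_apply, ← map_mul, mul_inv_cancel, map_one, MulAut.one_apply] at h1
    rw [e, ← h1]
    apply Units.ext
    change coeffAut w⁻¹ (coeffAut w _) = _
    rw [← coeffAut_mul, inv_mul_cancel, coeffAut_one]

/-- The action of `W_af` on power series over `S^reg`: the element `t_λ w` acts by `w` on the
coefficients, followed by multiplication by `∏ᵢ Ω(aᵢ|y)^{⟨λ, aᵢ⟩}`. -/
def actWaf (n : ℕ) : Waf n →* AddMonoid.End (PSreg n) where
  toFun x := (AddMonoidHom.mulLeft ((tau n x.left : (PSreg n)ˣ) : PSreg n)).comp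
    (coeffAut x.right).toAddMonoidHom
  map_one' := by
    ext f : 1
    change ((tau n 1 : (PSreg n)ˣ) : PSreg n) * coeffAut 1 f = f
    rw [map_one, Units.val_one, one_mul, coeffAut_one]
  map_mul' x y := by
    ext f : 1
    change (tau n (x * y).left : PSreg n) * coeffAut (x * y).right f =
      (tau n x.left : PSreg n) * coeffAut x.right ((tau n y.left : PSreg n) * coeffAut y.right f)
    have h := congrArg Units.val (coeffAut_tau x.right y.left)
    change coeffAut x.right (tau n y.left : PSreg n) = _ at h
    rw [map_mul (coeffAut x.right), h, SemidirectProduct.mul_left, SemidirectProduct.mul_right,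
      map_mul, Units.val_mul, coeffAut_mul, mul_assoc]

theorem actWaf_apply {n : ℕ} (x : Waf n) (f : PSreg n) :
    actWaf n x f = (tau n x.left : PSreg n) * coeffAut x.right f := rfl

theorem actWaf_smul {n : ℕ} (x : Waf n) (p : Sreg n) (f : PSreg n) :
    (x • p) • actWaf n x f = actWaf n x (p • f) := by
  have h : coeffAut x.right (MvPowerSeries.C p) = MvPowerSeries.C (x • p) := by
    rw [coeffAut, MvPowerSeries.map_C]; rfl
  rw [actWaf_apply, actWaf_apply, MvPowerSeries.smul_eq_C_mul, MvPowerSeries.smul_eq_C_mul,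
    map_mul, h, mul_left_comm]

/-- The action of `S^reg[W_af]` on power series over `S^reg`. -/
def actTwisted (n : ℕ) : TwistedGroupAlgebra n →+* AddMonoid.End (PSreg n) :=
  SkewMonoidAlgebra.liftNCRingHom (Module.toAddMonoidEnd (Sreg n) (PSreg n)) (actWaf n)
    fun {p x} => AddMonoidHom.ext fun f => actWaf_smul x p f

theorem actTwisted_single {n : ℕ} (x : Waf n) (p : Sreg n) (f : PSreg n) :
    actTwisted n (SkewMonoidAlgebra.single x p) f = p • actWaf n x f := by
  have : actTwisted n (SkewMonoidAlgebra.single x p) =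
      Module.toAddMonoidEnd (Sreg n) (PSreg n) p * actWaf n x := by
    simp [actTwisted, SkewMonoidAlgebra.liftNCRingHom]
  rw [this]
  rfl

theorem actTwisted_mul {n : ℕ} (a b : TwistedGroupAlgebra n) (f : PSreg n) :
    actTwisted n (a * b) f = actTwisted n a (actTwisted n b f) := by
  rw [map_mul]; rfl

theorem actTwisted_add {n : ℕ} (a b : TwistedGroupAlgebra n) (f : PSreg n) :
    actTwisted n (a + b) f = actTwisted n a f + actTwisted n b f := by
  rw [map_add]; rfl

theorem actTwisted_neg {n : ℕ} (a : TwistedGroupAlgebra n) (f : PSreg n) :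
    actTwisted n (-a) f = -actTwisted n a f := by
  rw [map_neg]; rfl

theorem simpleRoot_ne_zero {n : ℕ} (k : Fin n) : simpleRoot k ≠ 0 := by
  intro h
  have := simpleCoroot_simpleRoot k
  rw [h, map_zero] at this
  norm_num at this

theorem toS_injective (n : ℕ) : Function.Injective (toS (n := n)) := by
  rw [injective_iff_map_eq_zero]
  intro v hv
  funext i
  have h := congrArg (coeff (Finsupp.single i 1)) hv
  simp only [toS, AddMonoidHom.coe_mk, ZeroHom.coe_mk, coeff_sum, zsmul_eq_mul,
    coeff_zero] at h
  have h2 : ∀ j, coeff (Finsupp.single i 1) (((v j : ℤ) : S n) * X j) =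
      if j = i then (v j : ℂ) else 0 := by
    intro j
    rw [← map_intCast (C : ℂ →+* S n), coeff_C_mul, coeff_X]
    simp [Finsupp.single_left_inj]
  simp only [h2, Finset.sum_ite_eq', Finset.mem_univ, if_true] at h
  exact_mod_cast h

theorem rootMonoid_le (n : ℕ) : rootMonoid n ≤ nonZeroDivisors (S n) := by
  rw [rootMonoid, Submonoid.closure_le]
  rintro _ ⟨v, ⟨w, hw, k, rfl⟩, rfl⟩
  refine mem_nonZeroDivisors_of_ne_zero fun h => simpleRoot_ne_zero k ?_
  rw [← map_zero toS] at h
  have := toS_injective n h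
  exact (LinearEquiv.map_eq_zero_iff w).mp this

theorem algebraMap_Sreg_injective (n : ℕ) :
    Function.Injective (algebraMap (S n) (Sreg n)) :=
  IsLocalization.injective (Sreg n) (rootMonoid_le n)

theorem toReg_injective (n : ℕ) : Function.Injective (toReg n) := by
  intro f g h
  ext1 d
  apply algebraMap_Sreg_injective n
  exact congrArg (MvPowerSeries.coeff d) h

/-- The action of `sᵢ` on power series over `S`: `s₀ f = Ω(a₁|y) s_θ(f)`, and `sᵢ` for `i ≥ 1` acts
on the coefficients. -/
def actS {n : ℕ} [NeZero n] (i : Fin (n + 1)) (f : MvPowerSeries ℕ (S n)) :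
    MvPowerSeries ℕ (S n) :=
  Fin.cases (omegaSeries (X 0) *
      MvPowerSeries.map (MulSemiringAction.toRingHom (W n) (S n) (sTheta n)) f)
    (fun k => MvPowerSeries.map (MulSemiringAction.toRingHom (W n) (S n) (sW k)) f) i

theorem coeffAut_toReg {n : ℕ} (w : W n) (f : MvPowerSeries ℕ (S n)) :
    coeffAut w (toReg n f) =
      toReg n (MvPowerSeries.map (MulSemiringAction.toRingHom (W n) (S n) w) f) := by
  ext1 d
  exact autSreg_algebraMap w _

theorem actWaf_transl {n : ℕ} (i : Fin n) :
    ((tau n (Multiplicative.ofAdd (eps i)) : (PSreg n)ˣ) : PSreg n) =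
      toReg n (omegaSeries (X i)) := by
  have : tau n (Multiplicative.ofAdd (eps i)) = omegaUnit (algebraMap (S n) (Sreg n) (X i)) := by
    change ∏ j, omegaUnit (algebraMap (S n) (Sreg n) (X j)) ^ (Pi.single j (1 : ℤ) : P n) i = _
    rw [Finset.prod_eq_single i]
    · simp
    · intro j _ hj
      simp [Pi.single_eq_of_ne hj.symm]
    · simp
  rw [this, toReg, map_omegaSeries]
  rfl

theorem actWaf_toReg {n : ℕ} [NeZero n] (i : Fin (n + 1)) (f : MvPowerSeries ℕ (S n)) :
    actWaf n (sAf i) (toReg n f) = toReg n (actS i f) := by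
  refine Fin.cases ?_ (fun k => ?_) i
  · have h1 : (sAf 0 : Waf n).left = Multiplicative.ofAdd (eps 0) := by simp [sAf, transl]
    have h2 : (sAf 0 : Waf n).right = sTheta n := by simp [sAf, transl]
    rw [actWaf_apply, h1, h2, actWaf_transl, coeffAut_toReg, ← map_mul]
    rfl
  · have h1 : (sAf k.succ : Waf n).left = 1 := by simp [sAf]
    have h2 : (sAf k.succ : Waf n).right = sW k := by simp [sAf]
    rw [actWaf_apply, h1, h2, map_one, Units.val_one, one_mul, coeffAut_toReg]
    rfl

/-- If `w` is the reflection `v ↦ v - ⟨γ, v⟩ α`, then `p - w(p)` is divisible by `α`. -/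
theorem dvd_sub_reflection {n : ℕ} (w : W n) (al : P n) (ga : QDual n)
    (hw : ∀ v, w.1 v = v - ga v • al) (p : S n) : toS al ∣ p - w • p := by
  rw [← Ideal.mem_span_singleton, ← Ideal.Quotient.eq]
  have : (Ideal.Quotient.mkₐ ℂ (Ideal.span {(toS al : S n)})) =
      (Ideal.Quotient.mkₐ ℂ (Ideal.span {(toS al : S n)})).comp (autS w.1) := by
    ext i : 1
    rw [AlgHom.comp_apply, toS_one, autS_toS, hw, map_sub, map_sub, map_zsmul, map_zsmul]
    have : (Ideal.Quotient.mkₐ ℂ (Ideal.span {(toS al : S n)})) (toS al) = 0 :=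
      Ideal.Quotient.eq_zero_iff_mem.mpr (Ideal.mem_span_singleton_self _)
    rw [this, smul_zero, sub_zero]
  exact DFunLike.congr_fun this p

theorem sTheta_apply {n : ℕ} [NeZero n] (v : P n) :
    (sTheta n).1 v = v - eps 0 v • theta n := Module.reflection_apply _ (eps_single_two (0 : Fin n))

theorem omegaSeries_sub_one {n : ℕ} [NeZero n] (d : ℕ →₀ ℕ) :
    toS (theta n) ∣ MvPowerSeries.coeff d (1 - omegaSeries (X 0 : S n)) := by
  classical
  have h : (toS (theta n) : S n) = 2 * X 0 := by
    rw [theta, toS_single]; simp [zsmul_eq_mul]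
  have h2 : (2 : S n) ∣ 1 := by
    refine ⟨C 2⁻¹, ?_⟩
    have : (2 : S n) = C 2 := (map_ofNat C 2).symm
    rw [this, ← C_mul]
    norm_num
  rw [h, map_sub, coeff_omegaSeries, MvPowerSeries.coeff_one]
  split_ifs with hd
  · simp [hd]
  · have hdeg : d.degree ≠ 0 := by rwa [ne_eq, Finsupp.degree_eq_zero_iff]
    rw [zero_sub, dvd_neg]
    refine Dvd.dvd.mul_right ?_ _
    have : (X 0 : S n) ∣ X 0 ^ d.degree := dvd_pow_self _ hdeg
    simpa using mul_dvd_mul h2 this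

theorem dvd_sub_actS {n : ℕ} [NeZero n] (i : Fin (n + 1)) (f : MvPowerSeries ℕ (S n))
    (d : ℕ →₀ ℕ) : toS (alphaAf i) ∣ MvPowerSeries.coeff d (f - actS i f) := by
  classical
  refine Fin.cases ?_ (fun k => ?_) i
  · set g := MvPowerSeries.map (MulSemiringAction.toRingHom (W n) (S n) (sTheta n)) f with hg
    have h1 : f - actS 0 f = (f - g) + (1 - omegaSeries (X 0)) * g := by
      change f - omegaSeries (X 0) * g = _
      ring
    have h2 : (toS (alphaAf (0 : Fin (n + 1))) : S n) = -toS (theta n) := by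
      simp [alphaAf]
    rw [h1, h2, neg_dvd, map_add]
    refine dvd_add ?_ ?_
    · exact dvd_sub_reflection (sTheta n) (theta n) (eps 0) sTheta_apply _
    · rw [MvPowerSeries.coeff_mul]
      exact Finset.dvd_sum fun p _ => Dvd.dvd.mul_right (omegaSeries_sub_one _) _
  · exact dvd_sub_reflection (sW k) (simpleRoot k) (simpleCoroot k)
      (fun v => Module.reflection_apply _ (simpleCoroot_simpleRoot k)) _

theorem map_mem_LamHat {n : ℕ} (w : W n) {f : MvPowerSeries ℕ (S n)} (hf : f ∈ LamHat n) :
    MvPowerSeries.map (MulSemiringAction.toRingHom (W n) (S n) w) f ∈ LamHat n := by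
  intro σ
  ext1 d
  have h := congrArg (MvPowerSeries.coeff d) (hf σ)
  rw [coeff_renameEquiv] at h ⊢
  rw [MvPowerSeries.coeff_map, MvPowerSeries.coeff_map, h]

theorem actS_mem {n : ℕ} [NeZero n] (i : Fin (n + 1)) {f : MvPowerSeries ℕ (S n)}
    (hf : f ∈ LamHat n) : actS i f ∈ LamHat n := by
  refine Fin.cases ?_ (fun k => ?_) i
  · exact mul_mem (omegaSeries_mem _) (map_mem_LamHat _ hf)
  · exact map_mem_LamHat _ hf

theorem Sreg_nontrivial (n : ℕ) : Nontrivial (Sreg n) :=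
  (algebraMap_Sreg_injective n).nontrivial

theorem exists_demazure {n : ℕ} [NeZero n] (i : Fin (n + 1)) {f : MvPowerSeries ℕ (S n)}
    (hf : f ∈ LamHat n) : ∃ g ∈ LamHat n, actTwisted n (demazure i) (toReg n f) = toReg n g := by
  choose c' hc using dvd_sub_actS i f
  obtain ⟨c, rfl⟩ : ∃ c : MvPowerSeries ℕ (S n), c' = fun d => MvPowerSeries.coeff d c :=
    ⟨c', rfl⟩
  have hc' : f - actS i f = (toS (alphaAf i) : S n) • c := by
    ext1 d
    exact hc d
  have hne : (toS (alphaAf i) : S n) ≠ 0 := by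
    intro h
    have h2 := isUnit_alphaAf i
    have := Sreg_nontrivial n
    rw [h, map_zero] at h2
    exact not_isUnit_zero h2
  refine ⟨c, fun σ => ?_, ?_⟩
  · have h1 : f - actS i f ∈ LamHat n := sub_mem hf (actS_mem i hf)
    have h2 := h1 σ
    rw [hc', map_smul] at h2
    ext1 d
    have h3 := congrArg (MvPowerSeries.coeff d) h2
    rw [MvPowerSeries.coeff_smul, MvPowerSeries.coeff_smul] at h3
    exact mul_left_cancel₀ hne h3
  · have h1 : actTwisted n (1 - SkewMonoidAlgebra.of (Sreg n) (Waf n) (sAf i)) (toReg n f) =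
        toReg n (f - actS i f) := by
      rw [map_sub, map_one, SkewMonoidAlgebra.of_apply, map_sub, ← actWaf_toReg]
      change toReg n f - actTwisted n _ _ = _
      rw [actTwisted_single, one_smul]
    have h2 : actTwisted n (demazure i) (toReg n f) =
        (((isUnit_alphaAf i).unit⁻¹ : (Sreg n)ˣ) : Sreg n) • toReg n (f - actS i f) := by
      rw [← h1]
      unfold demazure
      rw [actTwisted_mul, actTwisted_single, map_one]
      rfl
    rw [h2, hc']
    ext1 d
    rw [MvPowerSeries.coeff_smul, toReg, MvPowerSeries.coeff_map, MvPowerSeries.coeff_map,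
      MvPowerSeries.coeff_smul, map_mul, ← mul_assoc, IsUnit.val_inv_mul, one_mul]

theorem exists_act {n : ℕ} [NeZero n] (a : TwistedGroupAlgebra n) (ha : a ∈ NilHecke n) :
    ∀ f ∈ LamHat n, ∃ g ∈ LamHat n, actTwisted n a (toReg n f) = toReg n g := by
  induction ha using Subring.closure_induction with
  | mem x hx =>
    intro f hf
    rcases hx with ⟨p, rfl⟩ | ⟨i, rfl⟩
    · refine ⟨p • f, (LamHat n).smul_mem hf p, ?_⟩
      change actTwisted n (SkewMonoidAlgebra.single 1 (algebraMap (S n) (Sreg n) p)) _ = _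
      rw [actTwisted_single, map_one]
      ext1 d
      exact (map_mul (algebraMap (S n) (Sreg n)) _ _).symm
    · exact exists_demazure i hf
  | zero => intro f hf; exact ⟨0, zero_mem _, by simp⟩
  | one => intro f hf; exact ⟨f, hf, by simp⟩
  | add x y _ _ hx hy =>
    intro f hf
    obtain ⟨g, hg, h1⟩ := hx f hf
    obtain ⟨g', hg', h2⟩ := hy f hf
    exact ⟨g + g', add_mem hg hg', by rw [actTwisted_add, h1, h2, map_add]⟩
  | neg x _ hx =>
    intro f hf
    obtain ⟨g, hg, h1⟩ := hx f hf
    exact ⟨-g, neg_mem hg, by rw [actTwisted_neg, h1, map_neg]⟩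
  | mul x y _ _ hx hy =>
    intro f hf
    obtain ⟨g, hg, h1⟩ := hy f hf
    obtain ⟨g', hg', h2⟩ := hx g hg
    exact ⟨g', hg', by rw [actTwisted_mul, h1, h2]⟩

theorem exists_smul {n : ℕ} [NeZero n] (a : NilHecke n) (f : LamHat n) :
    ∃ g : LamHat n, toReg n g = actTwisted n a.1 (toReg n f) := by
  obtain ⟨g, hg, h⟩ := exists_act a.1 a.2 f.1 f.2
  exact ⟨⟨g, hg⟩, h.symm⟩

/-- The action of `a ∈ 𝔸_af` on `f ∈ Λ̂_S`, obtained by restriction of the action of `S^reg[W_af]` on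
power series over `S^reg`. -/
def NilHecke.act {n : ℕ} [NeZero n] (a : NilHecke n) (f : LamHat n) : LamHat n :=
  (exists_smul a f).choose

theorem NilHecke.act_spec {n : ℕ} [NeZero n] (a : NilHecke n) (f : LamHat n) :
    toReg n (NilHecke.act a f) = actTwisted n a.1 (toReg n f) :=
  (exists_smul a f).choose_spec

theorem LamHat.toReg_inj {n : ℕ} {f g : LamHat n} (h : toReg n f = toReg n g) : f = g :=
  Subtype.ext (toReg_injective n h)

/-- The `𝔸_af`-module structure of `Λ̂_S`. -/
instance (n : ℕ) [NeZero n] : Module (NilHecke n) (LamHat n) where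
  smul := NilHecke.act
  one_smul f := LamHat.toReg_inj (by
    change toReg n (NilHecke.act 1 f) = _
    rw [NilHecke.act_spec]; simp)
  mul_smul a b f := LamHat.toReg_inj (by
    change toReg n (NilHecke.act (a * b) f) = toReg n (NilHecke.act a (NilHecke.act b f))
    simp [NilHecke.act_spec])
  smul_zero a := LamHat.toReg_inj (by
    change toReg n (NilHecke.act a 0) = _
    simp [NilHecke.act_spec])
  smul_add a f g := LamHat.toReg_inj (by
    change toReg n (NilHecke.act a (f + g)) =
      toReg n ((NilHecke.act a f : MvPowerSeries ℕ (S n)) + NilHecke.act a g)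
    simp [NilHecke.act_spec])
  add_smul a b f := LamHat.toReg_inj (by
    change toReg n (NilHecke.act (a + b) f) =
      toReg n ((NilHecke.act a f : MvPowerSeries ℕ (S n)) + NilHecke.act b f)
    rw [map_add, NilHecke.act_spec, NilHecke.act_spec, NilHecke.act_spec]
    exact actTwisted_add _ _ _)
  zero_smul f := LamHat.toReg_inj (by
    change toReg n (NilHecke.act 0 f) = _
    simp [NilHecke.act_spec])

/-- The characterization of the action: `S` acts by multiplication, `sₖ ∈ W` acts on the
coefficients, and `t_{εᵢ}` acts by multiplication by `Ω(aᵢ|y)`. -/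
theorem NilHecke.ofS_smul {n : ℕ} [NeZero n] (p : S n) (f : LamHat n) :
    NilHecke.ofS p • f = p • f := by
  refine LamHat.toReg_inj ((NilHecke.act_spec _ f).trans ?_)
  change actTwisted n (SkewMonoidAlgebra.single 1 (algebraMap (S n) (Sreg n) p)) _ = _
  rw [actTwisted_single, map_one]
  ext1 d
  exact (map_mul (algebraMap (S n) (Sreg n)) _ _).symm

theorem NilHecke.sW_smul {n : ℕ} [NeZero n] (k : Fin n) (f : LamHat n) :
    ((NilHecke.ofWaf (SemidirectProduct.inr (sW k)) • f : LamHat n) : MvPowerSeries ℕ (S n)) =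
      MvPowerSeries.map (MulSemiringAction.toRingHom (W n) (S n) (sW k)) f := by
  apply toReg_injective n
  refine (NilHecke.act_spec _ f).trans ?_
  change actTwisted n (SkewMonoidAlgebra.single _ 1) _ = _
  rw [actTwisted_single, one_smul]
  exact actWaf_toReg k.succ f.1

theorem NilHecke.transl_smul {n : ℕ} [NeZero n] (i : Fin n) (f : LamHat n) :
    NilHecke.ofWaf (transl (eps i)) • f = Omega (X i) * f := by
  refine LamHat.toReg_inj ((NilHecke.act_spec _ f).trans ?_)
  change actTwisted n (SkewMonoidAlgebra.single _ 1) _ = _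
  rw [actTwisted_single, one_smul, actWaf_apply]
  have h2 : (transl (eps i) : Waf n).right = 1 := rfl
  rw [h2, coeffAut_one]
  change ((tau n (Multiplicative.ofAdd (eps i)) : (PSreg n)ˣ) : PSreg n) * _ = _
  rw [actWaf_transl, ← map_mul]
  rfl

/-- The function attached to a word `i₁ … i_l`: the element `A_{i₁} ⋯ A_{i_l}(1)` of `Λ̂_S`. If the
word is a reduced word of `w ∈ W_af⁰`, this is the dual affine Schur `P`-function
`P̂_w^{(n)}(y|a) = A_w(1)`. -/
def dualSchurP {n : ℕ} [NeZero n] (l : List (Fin (n + 1))) : LamHat n :=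
  (l.map (NilHecke.A (n := n))).prod • (1 : LamHat n)

/-- `Γ̂^{(n)}`: the `S`-span of the functions `P̂_w^{(n)}(y|a)`, `w ∈ W_af⁰`. -/
def GammaHat (n : ℕ) [NeZero n] : Submodule (S n) (LamHat n) :=
  Submodule.span (S n)
    {f | ∃ l : List (Fin (n + 1)), IsReducedWord (n := n) l ∧
      IsGrassmannian (n := n) (l.map sAf).prod ∧ f = dualSchurP l}

/-! ### The centralizer family of `SO_{2n+1}` -/

/-- The index set of `(2n+1) × (2n+1)` matrices; the index `i` of the text is `i - 1` here. -/
abbrev Idx (n : ℕ) := Fin (2 * n + 1)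

/-- The index in `Idx n` of the `i`-th coordinate, `1 ≤ i ≤ n`. -/
def Idx.ofFin {n : ℕ} (i : Fin n) : Idx n := ⟨i, by omega⟩

/-- The sequence `b = (a₁, …, aₙ, 0, -aₙ, …, -a₁)` in `S`. -/
def bSeq {n : ℕ} (l : Idx n) : S n :=
  if h : (l : ℕ) < n then X ⟨l, h⟩
  else if h : n < (l : ℕ) then -X ⟨2 * n - l, by omega⟩
  else 0

/-- The matrix with diagonal entries `c` and entries `-1` on the superdiagonal. -/
def bidiag {n : ℕ} {R : Type*} [CommRing R] (c : Idx n → R) : Matrix (Idx n) (Idx n) R :=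
  Matrix.of fun i j => if j = i then c i else if (j : ℕ) = i + 1 then -1 else 0

/-- The matrix of the form: its entry at the position `(i, 2n+2-i)`, where `1 ≤ i ≤ 2n+1`, is
`(-1)^{i+1}`, and the other entries are zero. -/
def Jmat (n : ℕ) (R : Type*) [CommRing R] : Matrix (Idx n) (Idx n) R :=
  Matrix.of fun i j => if (i : ℕ) + j = 2 * n then (-1) ^ (i : ℕ) else 0

/-- The Chevalley generator `f_k = E_{k+1,k} + E_{2n+2-k,2n+1-k}` of `𝔰𝔬_{2n+1}`, `1 ≤ k ≤ n`. -/
def fMat {n : ℕ} (R : Type*) [CommRing R] (k : Fin n) : Matrix (Idx n) (Idx n) R :=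
  Matrix.of fun i j => if ((i : ℕ) = k + 1 ∧ (j : ℕ) = k) ∨
    ((i : ℕ) + k = 2 * n ∧ (j : ℕ) + k + 1 = 2 * n) then 1 else 0

/-- The matrix `exp(x f_k)`; note that `f_k³ = 0`. -/
def uMat {n : ℕ} {R : Type*} [CommRing R] [Algebra ℂ R] (k : Fin n) (x : R) :
    Matrix (Idx n) (Idx n) R :=
  1 + x • fMat R k + ((algebraMap ℂ R 2⁻¹) * x ^ 2) • (fMat R k * fMat R k)

/-- The polynomial ring over `S` in the entries of a `(2n+1) × (2n+1)` matrix. -/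
abbrev Gen (n : ℕ) := MvPolynomial (Idx n × Idx n) (S n)

/-- The generic matrix. -/
def genMat (n : ℕ) : Matrix (Idx n) (Idx n) (Gen n) :=
  Matrix.of fun i j => X (i, j)

/-- The equations for an upper triangular matrix `Z` over an `S`-algebra to lie in `SO_{2n+1}` and
to commute with `L₀`. -/
structure IsCentralizerPoint {n : ℕ} {R : Type*} [CommRing R] [Algebra (S n) R]
    (Z : Matrix (Idx n) (Idx n) R) : Prop where
  upper : ∀ i j, j < i → Z i j = 0
  orth : Z.transpose * Jmat n R * Z = Jmat n R
  det : Z.det = 1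
  comm : Z * bidiag (fun i => algebraMap (S n) R (bSeq i)) =
    bidiag (fun i => algebraMap (S n) R (bSeq i)) * Z

/-- The ideal of `S[x_{ij}]` generated by the equations of the centralizer family. -/
def centralizerIdeal (n : ℕ) : Ideal (Gen n) :=
  Ideal.span
    ({p | ∃ i j : Idx n, j < i ∧ p = genMat n i j} ∪
      {p | ∃ i j : Idx n, p = ((genMat n).transpose * Jmat n (Gen n) * genMat n) i j - Jmat n (Gen n) i j} ∪
      {(genMat n).det - 1} ∪
      {p | ∃ i j : Idx n, p = (genMat n * bidiag (fun l => (C (bSeq l) : Gen n))) i j -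
        (bidiag (fun l => (C (bSeq l) : Gen n)) * genMat n) i j})

/-- The coordinate ring `ℂ[𝒵]` of the centralizer family
`𝒵 = {(g, h) ∈ B^∨ × 𝔥 : g L₀(h) = L₀(h) g}` of `SO_{2n+1}`, where `B^∨` is the group of upper
triangular matrices in `SO_{2n+1}`. -/
def CZ (n : ℕ) : Type := Gen n ⧸ centralizerIdeal n

instance (n : ℕ) : CommRing (CZ n) :=
  inferInstanceAs (CommRing (Gen n ⧸ centralizerIdeal n))

instance (n : ℕ) : Algebra (S n) (CZ n) :=
  inferInstanceAs (Algebra (S n) (Gen n ⧸ centralizerIdeal n))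

instance (n : ℕ) : Algebra ℂ (CZ n) :=
  inferInstanceAs (Algebra ℂ (Gen n ⧸ centralizerIdeal n))

instance (n : ℕ) : IsScalarTower ℂ (S n) (CZ n) :=
  inferInstanceAs
    (IsScalarTower ℂ (S n) (Gen n ⧸ centralizerIdeal n))

/-- The quotient map. -/
def CZ.mk (n : ℕ) : Gen n →ₐ[S n] CZ n :=
  Ideal.Quotient.mkₐ (S n) (centralizerIdeal n)

/-- The coordinate functions `z_{ij}`. -/
def z {n : ℕ} (i j : Idx n) : CZ n := CZ.mk n (X (i, j))

/-- The matrix with entries `z_{ij}`. -/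
def zMat (n : ℕ) : Matrix (Idx n) (Idx n) (CZ n) := Matrix.of fun i j => z i j

theorem map_bidiag {n : ℕ} {R R' : Type*} [CommRing R] [CommRing R'] (f : R →+* R')
    (c : Idx n → R) : (bidiag c).map f = bidiag (fun i => f (c i)) := by
  ext i j
  simp only [bidiag, Matrix.map_apply, Matrix.of_apply]
  split_ifs <;> simp

theorem map_Jmat {n : ℕ} {R R' : Type*} [CommRing R] [CommRing R'] (f : R →+* R') :
    (Jmat n R).map f = Jmat n R' := by
  ext i j
  simp only [Jmat, Matrix.map_apply, Matrix.of_apply]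
  split_ifs <;> simp

theorem zMat_eq (n : ℕ) : zMat n = (genMat n).map (CZ.mk n) := rfl

theorem isCentralizerPoint_zMat (n : ℕ) : IsCentralizerPoint (zMat n) := by
  have h0 : ∀ p ∈ centralizerIdeal n, (CZ.mk n : Gen n →+* CZ n) p = 0 := fun p hp =>
    Ideal.Quotient.eq_zero_iff_mem.mpr hp
  have e : zMat n = (genMat n).map (CZ.mk n : Gen n →+* CZ n) := rfl
  have hC : ∀ i : Idx n, algebraMap (S n) (CZ n) (bSeq i) =
      (CZ.mk n : Gen n →+* CZ n) (C (bSeq i)) := fun i => ((CZ.mk n).commutes _).symm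
  refine ⟨fun i j hij => ?_, ?_, ?_, ?_⟩
  · exact h0 _ (Ideal.subset_span (Or.inl (Or.inl (Or.inl ⟨i, j, hij, rfl⟩))))
  · rw [← sub_eq_zero, e, ← map_Jmat (CZ.mk n : Gen n →+* CZ n), ← Matrix.transpose_map,
      ← Matrix.map_mul, ← Matrix.map_mul]
    ext i j
    have := h0 _ (Ideal.subset_span (Or.inl (Or.inl (Or.inr ⟨i, j, rfl⟩))))
    rwa [map_sub] at this
  · have := h0 _ (Ideal.subset_span (Or.inl (Or.inr rfl)))
    rw [map_sub, RingHom.map_det, map_one] at this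
    exact sub_eq_zero.mp this
  · rw [← sub_eq_zero, e]
    simp only [hC]
    rw [← map_bidiag (CZ.mk n : Gen n →+* CZ n), ← Matrix.map_mul, ← Matrix.map_mul]
    ext i j
    have := h0 _ (Ideal.subset_span (Or.inr ⟨i, j, rfl⟩))
    rwa [map_sub] at this

theorem eval_mem {n : ℕ} {R : Type*} [CommRing R] (φ : S n →+* R)
    (M : Matrix (Idx n) (Idx n) R) (hM : @IsCentralizerPoint n R _ φ.toAlgebra M)
    (p : Gen n) (hp : p ∈ centralizerIdeal n) :
    eval₂Hom φ (fun ij => M ij.1 ij.2) p = 0 := by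
  let _ := φ.toAlgebra
  set E := eval₂Hom φ (fun ij : Idx n × Idx n => M ij.1 ij.2)
  have e : (genMat n).map E = M := by
    ext i j
    simp [genMat, E]
  have hC : ∀ i : Idx n, E (C (bSeq i)) = algebraMap (S n) R (bSeq i) := fun i => by
    simp only [E, coe_eval₂Hom, eval₂_C]; rfl
  have key : centralizerIdeal n ≤ RingHom.ker E := by
    rw [centralizerIdeal, Ideal.span_le]
    rintro p (((⟨i, j, hij, rfl⟩ | ⟨i, j, rfl⟩) | rfl) | ⟨i, j, rfl⟩)
    · change E (genMat n i j) = 0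
      rw [← hM.upper i j hij, ← e]; rfl
    · change E _ = 0
      rw [map_sub, sub_eq_zero]
      have h := hM.orth
      rw [← e, ← map_Jmat E, ← Matrix.transpose_map, ← Matrix.map_mul, ← Matrix.map_mul] at h
      exact congrFun (congrFun h i) j
    · change E _ = 0
      rw [map_sub, map_one, RingHom.map_det, sub_eq_zero]
      have h := hM.det
      rw [← e] at h
      exact h
    · change E _ = 0
      rw [map_sub, sub_eq_zero]
      have h := hM.comm
      simp only [← hC] at h
      rw [← e, ← map_bidiag E, ← Matrix.map_mul, ← Matrix.map_mul] at h
      exact congrFun (congrFun h i) j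
  exact key hp

/-- The ring homomorphism out of `ℂ[𝒵]` attached to a point of the centralizer family. -/
def CZ.lift {n : ℕ} {R : Type*} [CommRing R] (φ : S n →+* R)
    (M : Matrix (Idx n) (Idx n) R) (hM : @IsCentralizerPoint n R _ φ.toAlgebra M) : CZ n →+* R :=
  Ideal.Quotient.lift (centralizerIdeal n) (eval₂Hom φ (fun ij => M ij.1 ij.2)) (eval_mem φ M hM)

theorem CZ.lift_algebraMap {n : ℕ} {R : Type*} [CommRing R] (φ : S n →+* R)
    (M : Matrix (Idx n) (Idx n) R) (hM : @IsCentralizerPoint n R _ φ.toAlgebra M) (p : S n) :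
    CZ.lift φ M hM (algebraMap (S n) (CZ n) p) = φ p :=
  eval₂Hom_C φ _ p

theorem CZ.lift_z {n : ℕ} {R : Type*} [CommRing R] (φ : S n →+* R)
    (M : Matrix (Idx n) (Idx n) R) (hM : @IsCentralizerPoint n R _ φ.toAlgebra M) (i j : Idx n) :
    CZ.lift φ M hM (z i j) = M i j :=
  eval₂Hom_X' φ _ (i, j)

/-! #### Computations with `f_k` -/

theorem fMat_eq {n : ℕ} (R : Type*) [CommRing R] (k : Fin n) :
    fMat R k = Matrix.single (⟨k + 1, by omega⟩ : Idx n) (⟨k, by omega⟩ : Idx n) 1 +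
      Matrix.single (⟨2 * n - k, by omega⟩ : Idx n) (⟨2 * n - k - 1, by omega⟩ : Idx n) 1 := by
  ext i j
  simp only [fMat, Matrix.of_apply, Matrix.add_apply, Matrix.single_apply, Fin.ext_iff]
  have := k.2
  have := i.2
  have := j.2
  by_cases h1 : (i : ℕ) = k + 1 ∧ (j : ℕ) = k
  · rw [if_pos (Or.inl h1), if_pos ⟨h1.1.symm, h1.2.symm⟩, if_neg (by omega), add_zero]
  · by_cases h2 : (i : ℕ) + k = 2 * n ∧ (j : ℕ) + k + 1 = 2 * n
    · rw [if_pos (Or.inr h2), if_neg (by omega), if_pos (by omega), zero_add]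
    · rw [if_neg (by tauto), if_neg (by omega), if_neg (by omega), add_zero]

theorem fMat_mul {n : ℕ} {R : Type*} [CommRing R] (k : Fin n) (M : Matrix (Idx n) (Idx n) R)
    (i j : Idx n) : (fMat R k * M) i j =
      (if (i : ℕ) = k + 1 then M ⟨k, by omega⟩ j else 0) +
        (if (i : ℕ) = 2 * n - k then M ⟨2 * n - k - 1, by omega⟩ j else 0) := by
  rw [fMat_eq, add_mul, Matrix.add_apply, Matrix.single_mul_eq_updateRow_zero,
    Matrix.single_mul_eq_updateRow_zero]
  simp [Matrix.updateRow_apply, Fin.ext_iff]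

theorem mul_fMat {n : ℕ} {R : Type*} [CommRing R] (k : Fin n) (M : Matrix (Idx n) (Idx n) R)
    (i j : Idx n) : (M * fMat R k) i j =
      (if (j : ℕ) = k then M i ⟨k + 1, by omega⟩ else 0) +
        (if (j : ℕ) = 2 * n - k - 1 then M i ⟨2 * n - k, by omega⟩ else 0) := by
  rw [← Matrix.transpose_apply (M * fMat R k), Matrix.transpose_mul, fMat_eq, Matrix.transpose_add,
    Matrix.transpose_single, Matrix.transpose_single, add_mul, Matrix.add_apply,
    Matrix.single_mul_eq_updateRow_zero, Matrix.single_mul_eq_updateRow_zero]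
  simp [Matrix.updateRow_apply, Fin.ext_iff]

theorem fMat_cube {n : ℕ} (R : Type*) [CommRing R] (k : Fin n) :
    fMat R k * fMat R k * fMat R k = 0 := by
  ext i j
  simp only [mul_fMat, Matrix.zero_apply]
  simp only [fMat, Matrix.of_apply]
  have := k.2
  have := i.2
  have := j.2
  grind

theorem fMat_J {n : ℕ} (R : Type*) [CommRing R] (k : Fin n) :
    (fMat R k).transpose * Jmat n R = -(Jmat n R * fMat R k) := by
  have h1 : (Jmat n R).transpose = Jmat n R := by
    ext i j
    simp only [Matrix.transpose_apply, Jmat, Matrix.of_apply]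
    by_cases h : (i : ℕ) + j = 2 * n
    · rw [if_pos h, if_pos (by omega)]
      apply neg_one_pow_congr
      grind
    · rw [if_neg h, if_neg (by omega)]
  have h2 := k.2
  have key : ∀ i j : Idx n, (Jmat n R * fMat R k) j i = -(Jmat n R * fMat R k) i j := by
    intro i j
    rw [mul_fMat, mul_fMat]
    simp only [Jmat, Matrix.of_apply]
    have := i.2
    have := j.2
    by_cases h3 : (i : ℕ) = k ∧ (j : ℕ) = 2 * n - k - 1
    · rw [if_pos h3.1, if_pos (by omega), if_neg (by omega), if_neg (by omega), if_pos h3.2,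
        if_pos (by omega), h3.1, h3.2, zero_add, add_zero]
      have : 2 * n - (k : ℕ) - 1 = 2 * (n - k - 1) + k + 1 := by omega
      rw [this, pow_succ, pow_add, pow_mul]
      simp
    · by_cases h4 : (j : ℕ) = k ∧ (i : ℕ) = 2 * n - k - 1
      · rw [if_neg (by omega), if_pos h4.2, if_pos (by omega), if_pos h4.1, if_pos (by omega),
          if_neg (by omega), h4.1, h4.2, zero_add, add_zero]
        have : 2 * n - (k : ℕ) - 1 = 2 * (n - k - 1) + k + 1 := by omega
        rw [this, pow_succ, pow_add, pow_mul]
        simp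
      · grind
  ext i j
  rw [Matrix.neg_apply, ← key]
  rw [← h1, ← Matrix.transpose_mul, h1, Matrix.transpose_apply]

theorem uMat_neg_mul {n : ℕ} {R : Type*} [CommRing R] [Algebra ℂ R] (k : Fin n) (x : R) :
    uMat k (-x) * uMat k x = 1 := by
  have h : fMat R k * (fMat R k * fMat R k) = 0 := by rw [← mul_assoc]; exact fMat_cube R k
  have h2 : (algebraMap ℂ R) 2⁻¹ * 2 = 1 := by
    rw [← map_ofNat (algebraMap ℂ R) 2, ← map_mul]; norm_num
  simp only [uMat, mul_add, add_mul, smul_mul_assoc, mul_smul_comm, one_mul, mul_one,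
    mul_assoc, h, mul_zero, smul_zero, add_zero]
  have e : ∀ F G : Matrix (Idx n) (Idx n) R, 1 + -x • F + ((algebraMap ℂ R) 2⁻¹ * (-x) ^ 2) • G +
      x • (F + -x • G) + ((algebraMap ℂ R) 2⁻¹ * x ^ 2) • G = 1 := by
    intro F G
    have : 1 + -x • F + ((algebraMap ℂ R) 2⁻¹ * (-x) ^ 2) • G +
      x • (F + -x • G) + ((algebraMap ℂ R) 2⁻¹ * x ^ 2) • G =
        1 + (((algebraMap ℂ R) 2⁻¹ * 2 - 1) * x ^ 2) • G := by module
    rw [this, h2]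
    simp
  exact e _ _

theorem uMat_J {n : ℕ} {R : Type*} [CommRing R] [Algebra ℂ R] (k : Fin n) (x : R) :
    (uMat k x).transpose * Jmat n R * uMat k x = Jmat n R := by
  have h : (uMat k x).transpose * Jmat n R = Jmat n R * uMat k (-x) := by
    have h1 := fMat_J R k
    simp only [uMat, Matrix.transpose_add, Matrix.transpose_smul, Matrix.transpose_mul,
      Matrix.transpose_one, add_mul, mul_add, smul_mul_assoc, mul_smul_comm, one_mul, mul_one,
      mul_assoc, h1, mul_neg]
    rw [← mul_assoc _ (Jmat n R), h1]
    simp [mul_assoc]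
  have h3 := uMat_neg_mul k x
  rw [h, mul_assoc, h3, mul_one]

theorem mul_bidiag {n : ℕ} {R : Type*} [CommRing R] (c : Idx n → R)
    (M : Matrix (Idx n) (Idx n) R) (i j : Idx n) : (M * bidiag c) i j =
      M i j * c j - (if h : (j : ℕ) = 0 then 0 else M i ⟨j - 1, by omega⟩) := by
  rw [Matrix.mul_apply]
  have : ∀ l, M i l * bidiag c l j = (if l = j then M i j * c j else 0) -
      (if (l : ℕ) + 1 = j then M i l else 0) := by
    intro l
    simp only [bidiag, Matrix.of_apply]
    by_cases h : l = j
    · subst h; simp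
    · rw [if_neg (Ne.symm h), if_neg h]
      by_cases h2 : (l : ℕ) + 1 = j
      · rw [if_pos h2, if_pos h2.symm]; simp
      · rw [if_neg h2, if_neg (Ne.symm h2)]; simp
  simp only [this, Finset.sum_sub_distrib, Finset.sum_ite_eq', Finset.mem_univ, if_true]
  congr 1
  split_ifs with h
  · exact Finset.sum_eq_zero fun l _ => if_neg (by omega)
  · rw [Finset.sum_eq_single ⟨j - 1, by omega⟩]
    · rw [if_pos (by simp; omega)]
    · intro l _ hl
      rw [if_neg]
      intro e
      exact hl (Fin.ext (by simp; omega))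
    · simp

theorem bidiag_mul {n : ℕ} {R : Type*} [CommRing R] (c : Idx n → R)
    (M : Matrix (Idx n) (Idx n) R) (i j : Idx n) : (bidiag c * M) i j =
      c i * M i j - (if h : (i : ℕ) + 1 < 2 * n + 1 then M ⟨i + 1, h⟩ j else 0) := by
  rw [Matrix.mul_apply]
  have : ∀ l, bidiag c i l * M l j = (if l = i then c i * M i j else 0) -
      (if (l : ℕ) = i + 1 then M l j else 0) := by
    intro l
    simp only [bidiag, Matrix.of_apply]
    by_cases h : l = i
    · subst h; simp
    · rw [if_neg h, if_neg h]
      by_cases h2 : (l : ℕ) = i + 1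
      · rw [if_pos h2, if_pos h2]; simp
      · rw [if_neg h2, if_neg h2]; simp
  simp only [this, Finset.sum_sub_distrib, Finset.sum_ite_eq', Finset.mem_univ, if_true]
  congr 1
  split_ifs with h
  · rw [Finset.sum_eq_single ⟨i + 1, h⟩]
    · rw [if_pos rfl]
    · intro l _ hl
      rw [if_neg]
      intro e
      exact hl (Fin.ext e)
    · simp
  · exact Finset.sum_eq_zero fun l _ => if_neg (by omega)

/-- A matrix that commutes with an upper bidiagonal matrix as above is upper triangular. -/
theorem upper_of_comm {n : ℕ} {R : Type*} [CommRing R] (c : Idx n → R)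
    (M : Matrix (Idx n) (Idx n) R) (h : M * bidiag c = bidiag c * M) (i j : Idx n)
    (hij : j < i) : M i j = 0 := by
  have key : ∀ (b : ℕ) (hb : b < 2 * n + 1) (a : ℕ) (ha : a < 2 * n + 1), b < a →
      M ⟨a, ha⟩ ⟨b, hb⟩ = 0 := by
    intro b
    induction b with
    | zero =>
      intro hb a ha hab
      induction a with
      | zero => omega
      | succ a ih =>
        have e := congrFun (congrFun h ⟨a, by omega⟩) ⟨0, hb⟩
        rw [mul_bidiag, bidiag_mul, dif_pos rfl, dif_pos ha, sub_zero] at e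
        by_cases h0 : a = 0
        · subst h0
          rw [eq_sub_iff_add_eq] at e
          have : M ⟨0, hb⟩ ⟨0, hb⟩ * c ⟨0, hb⟩ = c ⟨0, hb⟩ * M ⟨0, hb⟩ ⟨0, hb⟩ := mul_comm _ _
          rw [this] at e
          simpa using e
        · rw [ih (by omega) (by omega)] at e
          simpa using e.symm
    | succ b ihb =>
      intro hb a ha hab
      induction a with
      | zero => omega
      | succ a ih =>
        have e := congrFun (congrFun h ⟨a, by omega⟩) ⟨b + 1, hb⟩
        rw [mul_bidiag, bidiag_mul, dif_neg (by simp), dif_pos ha] at e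
        have h1 := ihb (by omega) a (by omega) (by omega)
        simp only [Nat.add_sub_cancel, h1, sub_zero] at e
        by_cases h0 : a = b + 1
        · subst h0
          rw [mul_comm, eq_sub_iff_add_eq] at e
          simpa using e
        · rw [ih (by omega) (by omega)] at e
          simpa using e.symm
  exact key j j.2 i i.2 hij
theorem uMat_bidiag_short {n : ℕ} {R : Type*} [CommRing R] [Algebra ℂ R] (k : Fin n)
    (hk : (k : ℕ) + 1 < n) (x : R) (c c' : Idx n → R)
    (h1 : c' ⟨k, by omega⟩ = c ⟨k + 1, by omega⟩) (h2 : c' ⟨k + 1, by omega⟩ = c ⟨k, by omega⟩)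
    (h3 : c' ⟨2 * n - k - 1, by omega⟩ = c ⟨2 * n - k, by omega⟩)
    (h4 : c' ⟨2 * n - k, by omega⟩ = c ⟨2 * n - k - 1, by omega⟩)
    (h5 : ∀ l : Idx n, (l : ℕ) ≠ k → (l : ℕ) ≠ k + 1 → (l : ℕ) ≠ 2 * n - k - 1 →
      (l : ℕ) ≠ 2 * n - k → c' l = c l)
    (hx : x = c ⟨k + 1, by omega⟩ - c ⟨k, by omega⟩)
    (hx2 : x = c ⟨2 * n - k, by omega⟩ - c ⟨2 * n - k - 1, by omega⟩) :
    uMat k x * bidiag c = bidiag c' * uMat k x := by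
  have hF : fMat R k * fMat R k = 0 := by
    ext i j
    rw [fMat_mul]
    simp only [fMat, Matrix.of_apply, Matrix.zero_apply]
    grind
  simp only [uMat, hF, smul_zero, add_zero, add_mul, mul_add, one_mul, mul_one, smul_mul_assoc,
    mul_smul_comm]
  ext i j
  simp only [Matrix.add_apply, Matrix.smul_apply, fMat_mul, mul_fMat, smul_eq_mul]
  simp only [bidiag, Matrix.of_apply, Fin.ext_iff]
  obtain ⟨i, hi⟩ := i
  have := j.2
  by_cases a1 : i = k
  · subst a1
    grind
  by_cases a2 : i = k + 1
  · subst a2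
    grind
  by_cases a3 : i = 2 * n - k - 1
  · subst a3
    grind
  by_cases a4 : i = 2 * n - k
  · subst a4
    grind
  have := h5 ⟨i, hi⟩ a1 a2 a3 a4
  grind

theorem uMat_bidiag_long {n : ℕ} {R : Type*} [CommRing R] [Algebra ℂ R] (k : Fin n)
    (hk : (k : ℕ) + 1 = n) (x : R) (c c' : Idx n → R)
    (h1 : c' ⟨k, by omega⟩ = c ⟨k + 2, by omega⟩) (h2 : c' ⟨k + 2, by omega⟩ = c ⟨k, by omega⟩)
    (h3 : c' ⟨k + 1, by omega⟩ = 0) (h4 : c ⟨k + 1, by omega⟩ = 0)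
    (h5 : ∀ l : Idx n, (l : ℕ) ≠ k → (l : ℕ) ≠ k + 1 → (l : ℕ) ≠ k + 2 → c' l = c l)
    (hx : x = - 2 * c ⟨k, by omega⟩) (hx2 : x = 2 * c ⟨k + 2, by omega⟩) :
    uMat k x * bidiag c = bidiag c' * uMat k x := by
  have e2 : (algebraMap ℂ R) 2⁻¹ * 2 = 1 := by
    rw [← map_ofNat (algebraMap ℂ R) 2, ← map_mul]; norm_num
  set r := (algebraMap ℂ R) 2⁻¹ with hr
  have e3 : r * x ^ 2 = -(x * c ⟨k, by omega⟩) := by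
    have : r * x ^ 2 = r * x * x := by ring
    rw [this]
    nth_rewrite 2 [hx]
    have : r * x * (-2 * c ⟨k, by omega⟩) = -((r * 2) * (x * c ⟨k, by omega⟩)) := by ring
    rw [this, e2, one_mul]
  have e4 : c ⟨k + 2, by omega⟩ = - c ⟨k, by omega⟩ := by
    have : c ⟨k + 2, by omega⟩ = (r * 2) * c ⟨k + 2, by omega⟩ := by rw [e2, one_mul]
    rw [this, mul_assoc, ← hx2, hx]
    have : r * (-2 * c ⟨k, by omega⟩) = - ((r * 2) * c ⟨k, by omega⟩) := by ring
    rw [this, e2, one_mul]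
  simp only [uMat, add_mul, mul_add, one_mul, mul_one, smul_mul_assoc, mul_smul_comm]
  rw [← hr, mul_assoc, ← mul_assoc (bidiag c'), e3]
  ext i j
  simp only [Matrix.add_apply, Matrix.smul_apply, fMat_mul, mul_fMat, smul_eq_mul]
  simp only [bidiag, Matrix.of_apply, Fin.ext_iff]
  obtain ⟨i, hi⟩ := i
  have := j.2
  have d2 : 2 * n - (k : ℕ) = k + 2 := by omega
  simp only [d2]
  by_cases a1 : i = k
  · subst a1
    grind
  by_cases a2 : i = k + 1
  · subst a2
    grind
  by_cases a4 : i = k + 2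
  · subst a4
    grind
  have := h5 ⟨i, hi⟩ a1 a2 a4
  grind
theorem sW_smul_toS {n : ℕ} (k : Fin n) (v : P n) :
    sW k • (toS v : S n) = toS (simpleReflection k v) := smul_toS _ _

theorem uMat_bidiag {n : ℕ} (k : Fin n) :
    uMat k (-toS (simpleRoot k) : S n) * bidiag bSeq =
      bidiag (fun l => sW k • bSeq l) * uMat k (-toS (simpleRoot k) : S n) := by
  by_cases hk : (k : ℕ) + 1 < n
  · have hsw : ∀ i : Fin n, simpleReflection k (Pi.single i 1) =
        (Pi.single (Equiv.swap k ⟨k + 1, hk⟩ i) 1 : P n) := by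
      intro i
      rw [simpleReflection_apply_swap k hk]
      ext j
      simp only [Function.comp_apply, Pi.single_apply]
      congr 1
      rw [eq_iff_iff]
      constructor
      · intro e; rw [← e, Equiv.swap_apply_self]
      · intro e; rw [e, Equiv.swap_apply_self]
    have hX : ∀ i : Fin n, sW k • (X i : S n) = X (Equiv.swap k ⟨k + 1, hk⟩ i) := by
      intro i
      rw [toS_one, sW_smul_toS, hsw, ← toS_one]
    have hal : (toS (simpleRoot k) : S n) = X k - X ⟨k + 1, hk⟩ := by
      rw [simpleRoot, dif_pos hk, map_sub, ← toS_one, ← toS_one]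
    have b1 : bSeq (⟨k, by omega⟩ : Idx n) = (X k : S n) := by
      rw [bSeq, dif_pos (show (k : ℕ) < n by omega)]
    have b2 : bSeq (⟨k + 1, by omega⟩ : Idx n) = (X ⟨k + 1, hk⟩ : S n) := by
      rw [bSeq, dif_pos hk]
    have b3 : bSeq (⟨2 * n - k - 1, by omega⟩ : Idx n) = (-X ⟨k + 1, hk⟩ : S n) := by
      rw [bSeq, dif_neg (by simp only []; omega), dif_pos (by simp only []; omega)]
      congr 2
      apply Fin.ext
      simp only []
      omega
    have b4 : bSeq (⟨2 * n - k, by omega⟩ : Idx n) = (-X k : S n) := by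
      rw [bSeq, dif_neg (by simp only []; omega), dif_pos (by simp only []; omega)]
      congr 2
      apply Fin.ext
      simp only []
      omega
    refine uMat_bidiag_short k hk _ _ _ ?_ ?_ ?_ ?_ ?_ ?_ ?_
    · rw [b1, b2, hX, Equiv.swap_apply_left]
    · rw [b1, b2, hX, Equiv.swap_apply_right]
    · rw [b3, b4, smul_neg, hX, Equiv.swap_apply_right]
    · rw [b3, b4, smul_neg, hX, Equiv.swap_apply_left]
    · intro l h1 h2 h3 h4
      have hl := l.2
      unfold bSeq
      split_ifs with h5 h6
      · rw [hX, Equiv.swap_apply_of_ne_of_ne]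
        · intro e; exact h1 (congrArg Fin.val e)
        · intro e; exact h2 (congrArg Fin.val e)
      · rw [smul_neg, hX, Equiv.swap_apply_of_ne_of_ne]
        · intro e; have := congrArg Fin.val e; simp only [] at this; omega
        · intro e; have := congrArg Fin.val e; simp only [] at this; omega
      · exact smul_zero _
    · rw [hal, b1, b2]; ring
    · rw [hal, b3, b4]; ring
  · have hk' : (k : ℕ) + 1 = n := by omega
    have hX : sW k • (X k : S n) = -X k := by
      rw [toS_one, sW_smul_toS, simpleReflection_last k hk, longReflection_apply, ← map_neg]
      congr 1
      ext j
      by_cases hj : j = k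
      · subst hj; simp
      · simp [hj]
    have hX2 : ∀ i, i ≠ k → sW k • (X i : S n) = X i := by
      intro i hi
      rw [toS_one, sW_smul_toS, simpleReflection_last k hk, longReflection_apply]
      congr 1
      ext j
      by_cases hj : j = k
      · subst hj; simp [Pi.single_eq_of_ne hi.symm]
      · simp [hj]
    have hal : (toS (simpleRoot k) : S n) = 2 * X k := by
      rw [simpleRoot, dif_neg hk, toS_single]; simp [zsmul_eq_mul]
    have b1 : bSeq (⟨k, by omega⟩ : Idx n) = (X k : S n) := by
      rw [bSeq, dif_pos (show (k : ℕ) < n by omega)]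
    have b2 : bSeq (⟨k + 1, by omega⟩ : Idx n) = (0 : S n) := by
      rw [bSeq, dif_neg hk, dif_neg (by simp only []; omega)]
    have b3 : bSeq (⟨k + 2, by omega⟩ : Idx n) = (-X k : S n) := by
      rw [bSeq, dif_neg (by simp only []; omega), dif_pos (by simp only []; omega)]
      congr 2
      apply Fin.ext
      simp only []
      omega
    refine uMat_bidiag_long k hk' _ _ _ ?_ ?_ ?_ ?_ ?_ ?_ ?_
    · rw [b1, b3, hX]
    · rw [b1, b3, smul_neg, hX, neg_neg]
    · rw [b2, smul_zero]
    · exact b2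
    · intro l h1 h2 h3
      have hl := l.2
      unfold bSeq
      split_ifs with h5 h6
      · exact hX2 _ fun e => h1 (congrArg Fin.val e)
      · rw [smul_neg, hX2]
        intro e; have := congrArg Fin.val e; simp only [] at this; omega
      · exact smul_zero _
    · rw [hal, b1]; ring
    · rw [hal, b3]; ring

/-! ### The action of `𝔸_af` on `ℂ[𝒵]` -/

/-- The simple root `αₖ` as an element of `ℂ[𝒵]`. -/
def alphaCZ {n : ℕ} (k : Fin n) : CZ n := algebraMap (S n) (CZ n) (toS (simpleRoot k))

/-- The matrix `exp(-αₖ fₖ) Z exp(αₖ fₖ)`. -/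
def reflMat {n : ℕ} (k : Fin n) : Matrix (Idx n) (Idx n) (CZ n) :=
  uMat k (-alphaCZ k) * zMat n * uMat k (alphaCZ k)

/-- The ring homomorphism `S → ℂ[𝒵]` obtained from `sₖ : S → S`. -/
def reflS {n : ℕ} (k : Fin n) : S n →+* CZ n :=
  (algebraMap (S n) (CZ n)).comp (MulSemiringAction.toRingHom (W n) (S n) (sW k))

theorem map_fMat {n : ℕ} {R R' : Type*} [CommRing R] [CommRing R'] (f : R →+* R') (k : Fin n) :
    (fMat R k).map f = fMat R' k := by
  ext i j
  simp only [fMat, Matrix.map_apply, Matrix.of_apply]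
  split_ifs <;> simp

theorem map_uMat {n : ℕ} (k : Fin n) (p : S n) :
    (uMat k p).map (algebraMap (S n) (CZ n)) = uMat k (algebraMap (S n) (CZ n) p) := by
  have h : algebraMap (S n) (CZ n) (algebraMap ℂ (S n) 2⁻¹) = algebraMap ℂ (CZ n) 2⁻¹ :=
    (IsScalarTower.algebraMap_apply ℂ (S n) (CZ n) _).symm
  rw [uMat, uMat, ← map_fMat (algebraMap (S n) (CZ n)) k, ← Matrix.map_mul, ← h]
  ext i j
  simp only [Matrix.map_apply, Matrix.add_apply, Matrix.smul_apply, smul_eq_mul, map_add, map_mul,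
    map_pow, Matrix.one_apply]
  split_ifs <;> simp

theorem isCentralizerPoint_reflMat {n : ℕ} (k : Fin n) :
    @IsCentralizerPoint n (CZ n) _ (reflS k).toAlgebra (reflMat k) := by
  have hZ := isCentralizerPoint_zMat n
  have hu : uMat k (-alphaCZ k) * uMat k (alphaCZ k) = 1 := uMat_neg_mul k _
  have hu2 : uMat k (alphaCZ k) * uMat k (-alphaCZ k) = 1 := by
    have := uMat_neg_mul k (-alphaCZ k)
    rwa [neg_neg] at this
  have hL : uMat k (-alphaCZ k) * bidiag (fun i => algebraMap (S n) (CZ n) (bSeq i)) =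
      bidiag (fun i => reflS k (bSeq i)) * uMat k (-alphaCZ k) := by
    have h := congrArg (fun M => M.map (algebraMap (S n) (CZ n))) (uMat_bidiag k)
    simp only [Matrix.map_mul, map_bidiag, map_uMat, map_neg] at h
    exact h
  have hL2 : uMat k (alphaCZ k) * bidiag (fun i => reflS k (bSeq i)) =
      bidiag (fun i => algebraMap (S n) (CZ n) (bSeq i)) * uMat k (alphaCZ k) := by
    calc _ = uMat k (alphaCZ k) * (bidiag (fun i => reflS k (bSeq i)) * uMat k (-alphaCZ k)) *
          uMat k (alphaCZ k) := by
            rw [mul_assoc, mul_assoc, hu, mul_one]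
      _ = _ := by rw [← hL, ← mul_assoc, hu2, one_mul]
  have hcomm : reflMat k * bidiag (fun i => reflS k (bSeq i)) =
      bidiag (fun i => reflS k (bSeq i)) * reflMat k := by
    rw [reflMat, mul_assoc, hL2, ← mul_assoc, mul_assoc _ (zMat n), hZ.comm, ← mul_assoc, hL]
    simp only [mul_assoc]
  have horth : (reflMat k).transpose * Jmat n (CZ n) * reflMat k = Jmat n (CZ n) := by
    rw [reflMat, Matrix.transpose_mul, Matrix.transpose_mul]
    calc _ = (uMat k (alphaCZ k)).transpose * ((zMat n).transpose *
          ((uMat k (-alphaCZ k)).transpose * Jmat n (CZ n) * uMat k (-alphaCZ k)) * zMat n) *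
            uMat k (alphaCZ k) := by simp only [mul_assoc]
      _ = _ := by rw [uMat_J, hZ.orth, uMat_J]
  have hdet : (reflMat k).det = 1 := by
    have := congrArg Matrix.det hu
    rw [Matrix.det_mul, Matrix.det_one] at this
    rw [reflMat, Matrix.det_mul, Matrix.det_mul, hZ.det, mul_one, this]
  exact @IsCentralizerPoint.mk n (CZ n) _ (reflS k).toAlgebra (reflMat k)
    (fun i j => upper_of_comm _ _ hcomm i j) horth hdet hcomm

/-- The action of the simple reflection `sₖ` on `ℂ[𝒵]`: it acts on `S` as usual, and it sends the
matrix `Z` with entries `z_{ij}` to `exp(-αₖ fₖ) Z exp(αₖ fₖ)`. -/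
def sigma {n : ℕ} (k : Fin n) : CZ n →+* CZ n :=
  CZ.lift (reflS k) (reflMat k) (isCentralizerPoint_reflMat k)

theorem sigma_algebraMap {n : ℕ} (k : Fin n) (p : S n) :
    sigma k (algebraMap (S n) (CZ n) p) = algebraMap (S n) (CZ n) (sW k • p) :=
  CZ.lift_algebraMap _ _ _ p

theorem sigma_z {n : ℕ} (k : Fin n) (i j : Idx n) :
    sigma k (z i j) = (uMat k (-alphaCZ k) * zMat n * uMat k (alphaCZ k)) i j :=
  CZ.lift_z _ _ _ i j

/-- `ρ` is an action of `𝔸_af` on `ℂ[𝒵]` that extends the multiplication by `S` and the action of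
`W`, and for which the translation `t_{εᵢ}` acts by multiplication by `z_{ii}`. -/
structure IsStandardAction {n : ℕ} [NeZero n] (ρ : NilHecke n →+* AddMonoid.End (CZ n)) :
    Prop where
  scalar : ∀ (p : S n) (f : CZ n), ρ (NilHecke.ofS p) f = p • f
  refl : ∀ (k : Fin n) (f : CZ n), ρ (NilHecke.ofWaf (SemidirectProduct.inr (sW k))) f = sigma k f
  transl : ∀ (i : Fin n) (f : CZ n),
    ρ (NilHecke.ofWaf (transl (eps i))) f = z (Idx.ofFin i) (Idx.ofFin i) * f

end

end TypeC

/-! The bridge between the two sides is the matrix Ω(L₀|y) = ∑ₖ Q_k(y) L₀^k. It commutes with L₀. It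
is orthogonal, because L₀ is skew for J and Ω(-L₀|y) Ω(L₀|y) = 1, and its determinant squares to 1
and has constant term 1. Hence Z ↦ Ω(L₀|y) defines an S-algebra map `toLam` from ℂ[𝒵] to Λ̂_S. The
powers of a bidiagonal matrix have complete homogeneous polynomials as entries (`bidiag_pow`), which
gives the formula for β(z_ij). Since sₖ(L₀) is the conjugate of L₀ by exp(-αₖ fₖ), the map is
W-equivariant (`toLam_sigma`).

Injectivity (`toLam_injective`): where the bᵢ are distinct, a matrix commuting with L₀ is determined
by its diagonal. So some nonzero multiple of any element of ℂ[𝒵] is an S-combination of monomials in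
the z_ii and their inverses. These go to products of powers of Ω(aᵢ|y), whose coefficients at
squarefree monomials are pairwise distinct characters r ↦ (2 ∑ λᵢ aᵢ)^r, so they are linearly
independent by Dedekind. The nonzero multiple can be cancelled because ℂ[𝒵] is flat over S. Flatness
comes from formal smoothness: a matrix commuting with L₀ is freely given by its first row, and
failure of orthogonality over a square-zero ideal is repaired by one Newton step.

Image (`range_eq_cyclicSubalgebra`): it equals 𝔸_af · 1. The cyclic module is closed under products
by the Leibniz rule. The image is stable under all Aᵢ, the case of A₀ reducing to A₀(1) = (Ω(a₁|y) -
1)/(2a₁) and to division by θ. Conversely every z_ij is reached from 1 by the Aᵢ and the relation Z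
L₀ = L₀ Z.

Comparison with Γ̂ (`GammaHat_eq_cyclicSub`): the cosets t_x W are indexed by x in Q^∨, and an
explicit height gives the least length in each coset. The braid relations for the Aᵢ show that the
class attached to x does not depend on the reduced word, and that Aᵢ either sends it to the class of
a higher coset or kills it. So the span of the classes is stable under 𝔸_af.

The action on ℂ[𝒵] is then transported along `toLam`. It is unique because αᵢ Aᵢ = 1 - sᵢ and ℂ[𝒵]
is torsion-free. -/

namespace TypeC

open MvPolynomial

noncomputable section

/-! ### Power series in a matrix -/

section OmegaMat

variable {ι R : Type*} [Fintype ι] [DecidableEq ι] [CommRing R]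

/-- The series `Ω(L|y) = ∑ₖ Q_k(y) L^k` attached to a square matrix `L`. -/
def omegaMat (L : Matrix ι ι R) : Matrix ι ι (MvPowerSeries ℕ R) :=
  Matrix.of fun i j d => 2 ^ d.support.card * (L ^ d.degree) i j

theorem coeff_omegaMat (L : Matrix ι ι R) (i j : ι) (d : ℕ →₀ ℕ) :
    MvPowerSeries.coeff d (omegaMat L i j) = 2 ^ d.support.card * (L ^ d.degree) i j := rfl

/-- An intertwiner of two matrices intertwines their powers, hence the series coefficient by
coefficient. The lemma is used with A = L₀ for commutation, with A = J for orthogonality and with A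
= exp(-αₖ fₖ) for equivariance. -/
theorem map_C_mul_omegaMat {A L L' : Matrix ι ι R} (h : A * L = L' * A) :
    A.map MvPowerSeries.C * omegaMat L = omegaMat L' * A.map (MvPowerSeries.C (σ := ℕ)) := by
  ext i j d
  have h1 : A * L ^ d.degree = L' ^ d.degree * A :=
    (SemiconjBy.pow_right (show SemiconjBy A L L' from h) _)
  have h2 := congrFun (congrFun h1 i) j
  simp only [Matrix.mul_apply] at h2
  simp only [Matrix.mul_apply, map_sum, Matrix.map_apply, MvPowerSeries.coeff_C_mul,
    MvPowerSeries.coeff_mul_C, coeff_omegaMat, mul_assoc, ← Finset.mul_sum, ← h2]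
  rw [Finset.mul_sum]
  exact Finset.sum_congr rfl fun l _ => by ring

theorem omegaMat_transpose (L : Matrix ι ι R) : (omegaMat L).transpose = omegaMat L.transpose := by
  ext i j d
  rw [Matrix.transpose_apply, coeff_omegaMat, coeff_omegaMat, ← Matrix.transpose_pow,
    Matrix.transpose_apply]

/-- The coefficient of y^d is a scalar times L^(deg d), and that scalar is the coefficient of y^d in
Ω(-1|y) Ω(1|y) = 1. The matrix identity is thus the scalar one. -/
theorem omegaMat_neg_mul (L : Matrix ι ι R) : omegaMat (-L) * omegaMat L = 1 := by
  classical
  ext i j d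
  have h1 := congrArg (MvPowerSeries.coeff d) (omegaSeries_mul_neg (-1 : R))
  rw [MvPowerSeries.coeff_mul] at h1
  simp only [coeff_omegaSeries, neg_neg, one_pow, one_mul] at h1
  rw [Matrix.mul_apply, map_sum]
  simp only [MvPowerSeries.coeff_mul, coeff_omegaMat]
  rw [Finset.sum_comm]
  have h2 : ∀ p ∈ Finset.HasAntidiagonal.antidiagonal d, ∑ l, 2 ^ p.1.support.card * ((-L) ^ p.1.degree) i l *
      (2 ^ p.2.support.card * (L ^ p.2.degree) l j) =
      ((-1) ^ p.1.degree * 2 ^ p.1.support.card * 2 ^ p.2.support.card) * (L ^ d.degree) i j := by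
    intro p hp
    have h3 : d.degree = p.1.degree + p.2.degree := by
      rw [← Finset.HasAntidiagonal.mem_antidiagonal.mp hp, map_add]
    rw [h3, pow_add, Matrix.mul_apply, Finset.mul_sum]
    refine Finset.sum_congr rfl fun l _ => ?_
    rw [← neg_one_smul R L, smul_pow, Matrix.smul_apply, smul_eq_mul]
    ring
  rw [Finset.sum_congr rfl h2, ← Finset.sum_mul, h1, MvPowerSeries.coeff_one, Matrix.one_apply]
  split_ifs with h4 h5 h5
  · subst h4; subst h5; simp
  · subst h4; simp [h5]
  · rw [MvPowerSeries.coeff_one, if_neg h4, zero_mul]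
  · simp

end OmegaMat

/-! ### Complete homogeneous polynomials and powers of bidiagonal matrices -/

/-- A multiset of size k+1 either contains the extra variable, which can be split off once, or
avoids it. -/
theorem hsymm_option_succ (τ : Type*) [Fintype τ] [DecidableEq τ] (R : Type*) [CommRing R] (k : ℕ) :
    hsymm (Option τ) R (k + 1) =
      X none * hsymm (Option τ) R k + rename some (hsymm τ R (k + 1)) := by
  rw [hsymm, ← Equiv.sum_comp (symOptionSuccEquiv.symm : _ ≃ Sym (Option τ) k.succ)]
  rw [Fintype.sum_sum_type, hsymm, hsymm, Finset.mul_sum, map_sum]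
  congr 1
  · refine Finset.sum_congr rfl fun s _ => ?_
    change ((none ::ₛ s : Sym _ _).1.map X).prod = _
    simp [Sym.cons]
  · refine Finset.sum_congr rfl fun s _ => ?_
    change ((s.map Function.Embedding.some).1.map X).prod = _
    rw [map_multiset_prod, Multiset.map_map]
    simp [Sym.map, Multiset.map_map, Function.comp_def]

/-- The complete homogeneous polynomial of degree `k` in the values `c i`, `i ∈ s`. -/
def hFin {ι A : Type*} [DecidableEq ι] [CommRing A] [Algebra ℂ A] (c : ι → A) (s : Finset ι)
    (k : ℕ) : A := aeval (fun l : s => c l) (hsymm s ℂ k)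

section hFin

variable {ι A : Type*} [DecidableEq ι] [CommRing A] [Algebra ℂ A] (c : ι → A)

theorem hFin_zero (s : Finset ι) : hFin c s 0 = 1 := by simp [hFin]

theorem hFin_empty_succ (k : ℕ) : hFin c ∅ (k + 1) = 0 := by
  have : IsEmpty (Sym (∅ : Finset ι) (k + 1)) := inferInstance
  simp [hFin, hsymm]

theorem hFin_insert_succ {a : ι} {s : Finset ι} (h : a ∉ s) (k : ℕ) :
    hFin c (insert a s) (k + 1) = c a * hFin c (insert a s) k + hFin c s (k + 1) := by
  have key : ∀ m, hFin c (insert a s) m =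
      aeval (fun o : Option s => o.elim (c a) fun l => c l) (hsymm (Option s) ℂ m) := by
    intro m
    rw [hFin, ← rename_hsymm _ _ _ (Finset.subtypeInsertEquivOption h), aeval_rename]
    congr 2
    funext l
    by_cases hl : (l : ι) = a
    · simp [Finset.subtypeInsertEquivOption, hl]
    · simp [Finset.subtypeInsertEquivOption, hl]
  rw [key, key, hsymm_option_succ, map_add, map_mul, aeval_X, aeval_rename]
  rfl

end hFin

/-- The entry counts weighted walks of m moves from i to j. Each of the j - i steps along the
superdiagonal has weight -1, and each rest at l has weight c_l, so the rests sum to a complete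
homogeneous polynomial. The induction separates the first move, rest or step, which is the recursion
`hFin_insert_succ`. -/
theorem bidiag_pow {n : ℕ} {A : Type*} [CommRing A] [Algebra ℂ A] (c : Idx n → A) (m : ℕ) :
    ∀ i j : Idx n, (bidiag c ^ m) i j = if i ≤ j ∧ (j : ℕ) ≤ i + m then
      (-1) ^ ((j : ℕ) - i) * hFin c (Finset.Icc i j) (m + i - j) else 0 := by
  induction m with
  | zero =>
    intro i j
    rw [pow_zero, Matrix.one_apply]
    by_cases h : i = j
    · subst h; simp [hFin_zero]
    · rw [if_neg h, if_neg]
      rintro ⟨h1, h2⟩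
      exact h (Fin.ext (by have := Fin.le_def.mp h1; omega))
  | succ m ih =>
    intro i j
    rw [pow_succ', bidiag_mul]
    rcases lt_trichotomy i j with h | h | h
    · have h1 : (i : ℕ) + 1 < 2 * n + 1 := by have := j.2; have := Fin.lt_def.mp h; omega
      have hlt := Fin.lt_def.mp h
      have hIcc : Finset.Icc i j = insert i (Finset.Icc ⟨i + 1, h1⟩ j) := by
        ext l
        simp only [Finset.mem_insert, Finset.mem_Icc, Fin.le_def, Fin.ext_iff]
        omega
      have hni : i ∉ Finset.Icc (⟨i + 1, h1⟩ : Idx n) j := fun hm =>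
        absurd (Fin.le_def.mp (Finset.mem_Icc.mp hm).1) (by simp)
      rw [dif_pos h1, ih, ih]
      simp only [Fin.le_def]
      have e1 : (-1 : A) ^ ((j : ℕ) - i) = -(-1) ^ ((j : ℕ) - (i + 1)) := by
        have : (j : ℕ) - i = (j - (i + 1)) + 1 := by omega
        rw [this, pow_succ]; ring
      by_cases h2 : (j : ℕ) ≤ i + m
      · rw [if_pos ⟨hlt.le, h2⟩, if_pos ⟨hlt, by omega⟩, if_pos ⟨hlt.le, by omega⟩]
        have e2 : m + 1 + i - j = (m + i - j) + 1 := by omega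
        have e3 : m + (i + 1) - (j : ℕ) = (m + i - j) + 1 := by omega
        rw [e2, e3, hIcc, hFin_insert_succ c hni, e1]
        ring
      -- At j = i + m + 1 no rest is possible: only the step term survives and both polynomials have
      -- degree 0.
      · by_cases h3 : (j : ℕ) ≤ i + (m + 1)
        · rw [if_neg (by omega), if_pos ⟨hlt, by omega⟩, if_pos ⟨hlt.le, by omega⟩]
          have e2 : m + 1 + i - (j : ℕ) = 0 := by omega
          have e3 : m + (i + 1) - (j : ℕ) = 0 := by omega
          rw [e2, e3, hFin_zero, hFin_zero, e1]
          ring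
        · rw [if_neg (by omega), if_neg (by omega), if_neg (by omega)]
          ring
    · subst h
      rw [ih]
      have e1 : (if h : (i : ℕ) + 1 < 2 * n + 1 then
          (bidiag c ^ m) ⟨i + 1, h⟩ i else 0) = 0 := by
        split_ifs with h
        · rw [ih, if_neg]
          simp [Fin.le_def]
        · rfl
      rw [e1, if_pos ⟨le_rfl, by omega⟩, if_pos ⟨le_rfl, by omega⟩]
      have e2 : m + i - (i : ℕ) = m := by omega
      have e3 : m + 1 + i - (i : ℕ) = m + 1 := by omega
      have hI : Finset.Icc i i = insert i (∅ : Finset (Idx n)) := by simp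
      rw [e2, e3, hI, hFin_insert_succ c (by simp), hFin_empty_succ]
      simp
    · have hlt := Fin.lt_def.mp h
      rw [ih, if_neg (by rw [Fin.le_def]; omega), if_neg (by rw [Fin.le_def]; omega)]
      split_ifs with h1
      · rw [ih, if_neg (by rw [Fin.le_def]; simp; omega)]; simp
      · simp

/-- In degree deg d only the summand with j - i + k = deg d of the series q̂ is nonzero, and its h_k
is the one in the power of L₀. -/
theorem coeff_omegaMat_bidiag {n : ℕ} (i j : Idx n) (h : i ≤ j) :
    omegaMat (bidiag (bSeq (n := n))) i j =
      (-1) ^ ((j : ℕ) - i) * qHatSeries ((j : ℕ) - i) (fun l : Finset.Icc i j => bSeq (l : Idx n)) := by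
  have hle := Fin.le_def.mp h
  ext1 d
  have e : ((-1) ^ ((j : ℕ) - i) : MvPowerSeries ℕ (S n)) =
      MvPowerSeries.C ((-1) ^ ((j : ℕ) - i)) := by simp
  rw [e, MvPowerSeries.coeff_C_mul, coeff_omegaMat, bidiag_pow, coeff_qHatSeries]
  simp only [coeff_schurQ]
  by_cases h1 : (j : ℕ) ≤ i + d.degree
  · rw [if_pos ⟨h, h1⟩, Finset.sum_eq_single (d.degree + i - j)]
    · rw [if_pos (by omega)]
      change _ = _ * (hFin bSeq (Finset.Icc i j) _ * _)
      ring
    · intro k _ hk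
      rw [if_neg (by omega), mul_zero]
    · intro hk
      exact absurd (Finset.mem_range.mpr (by omega)) hk
  · rw [if_neg (by tauto), Finset.sum_eq_zero]
    · simp
    · intro k _
      rw [if_neg (by omega), mul_zero]

/-! ### Orthogonal matrices that commute with `L₀` -/

theorem Jmat_mul {n : ℕ} {R : Type*} [CommRing R] (M : Matrix (Idx n) (Idx n) R) (i j : Idx n) :
    (Jmat n R * M) i j = (-1) ^ (i : ℕ) * M i.rev j := by
  have hi := i.2
  rw [Matrix.mul_apply, Finset.sum_eq_single i.rev]
  · rw [Jmat, Matrix.of_apply, if_pos (by rw [Fin.val_rev]; omega)]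
  · intro l _ hl
    have : (i : ℕ) + l ≠ 2 * n := fun e => hl (Fin.ext (by rw [Fin.val_rev]; omega))
    simp [Jmat, this]
  · simp

theorem mul_Jmat {n : ℕ} {R : Type*} [CommRing R] (M : Matrix (Idx n) (Idx n) R) (i j : Idx n) :
    (M * Jmat n R) i j = M i j.rev * (-1) ^ (j : ℕ) := by
  have hj := j.2
  rw [Matrix.mul_apply, Finset.sum_eq_single j.rev]
  · rw [Jmat, Matrix.of_apply, if_pos (by rw [Fin.val_rev]; omega)]
    congr 1
    apply neg_one_pow_congr
    rw [Fin.val_rev]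
    grind
  · intro l _ hl
    have : (l : ℕ) + j ≠ 2 * n := fun e => hl (Fin.ext (by rw [Fin.val_rev]; omega))
    simp [Jmat, this]
  · simp

theorem Jmat_mul_Jmat (n : ℕ) (R : Type*) [CommRing R] : Jmat n R * Jmat n R = 1 := by
  ext i j
  have hi := i.2
  have hj := j.2
  rw [Jmat_mul, Jmat, Matrix.of_apply, Fin.val_rev, Matrix.one_apply]
  by_cases h : i = j
  · subst h
    rw [if_pos (by omega), if_pos rfl, ← pow_add]
    exact Even.neg_one_pow ⟨n, by omega⟩
  · have h' : (i : ℕ) ≠ j := fun e => h (Fin.ext e)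
    rw [if_neg (by omega), if_neg h, mul_zero]

/-- This places L₀ in the Lie algebra of the orthogonal group of J. Reversal negates the diagonal by
hypothesis, and on the superdiagonal the alternating signs of J supply the minus sign. -/
theorem bidiag_transpose_mul_Jmat {n : ℕ} {R : Type*} [CommRing R] (c : Idx n → R)
    (hc : ∀ i : Idx n, c i.rev = -c i) :
    (bidiag c).transpose * Jmat n R = Jmat n R * -bidiag c := by
  ext i j
  have hi := i.2
  have hj := j.2
  have h1 : i = j.rev ↔ j = i.rev := by rw [Fin.ext_iff, Fin.ext_iff, Fin.val_rev, Fin.val_rev]; omega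
  rw [mul_Jmat, Jmat_mul, Matrix.transpose_apply, Matrix.neg_apply]
  simp only [bidiag, Matrix.of_apply, h1]
  by_cases h : j = i.rev
  · subst h
    rw [if_pos rfl, if_pos rfl, Fin.rev_rev, hc]
    have e : (-1 : R) ^ (i.rev : ℕ) = (-1) ^ (i : ℕ) :=
      neg_one_pow_congr (by rw [Fin.val_rev]; grind)
    rw [e]; ring
  · rw [if_neg h, if_neg h, Fin.val_rev, Fin.val_rev]
    by_cases h2 : (i : ℕ) + j = 2 * n + 1
    · have e : (-1 : R) ^ (i : ℕ) = -(-1) ^ (j : ℕ) := by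
        rcases Nat.even_or_odd (j : ℕ) with h3 | h3
        · rw [h3.neg_one_pow, Odd.neg_one_pow (by grind)]
        · rw [h3.neg_one_pow, Even.neg_one_pow (by grind)]; ring
      rw [if_pos (by omega), if_pos (by omega), e]; ring
    · rw [if_neg (by omega), if_neg (by omega)]; ring

theorem bSeq_rev {n : ℕ} (i : Idx n) : (bSeq i.rev : S n) = -bSeq i := by
  have hi := i.2
  unfold bSeq
  simp only [Fin.val_rev]
  split_ifs <;> first | omega | skip
  · rw [neg_neg]; congr 1; simp only [Fin.mk.injEq]; omega
  · congr 2; simp only [Fin.mk.injEq]; omega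
  · simp

theorem det_sq_of_orth {n : ℕ} {R : Type*} [CommRing R] {Z : Matrix (Idx n) (Idx n) R}
    (h : Z.transpose * Jmat n R * Z = Jmat n R) : Z.det * Z.det = 1 := by
  have h1 := congrArg Matrix.det h
  have h2 := congrArg Matrix.det (Jmat_mul_Jmat n R)
  rw [Matrix.det_mul, Matrix.det_one] at h2
  rw [Matrix.det_mul, Matrix.det_mul, Matrix.det_transpose] at h1
  linear_combination (Z.det * Z.det - 1) * (-h2) + (Jmat n R).det * h1

/-! ### The homomorphism from `ℂ[𝒵]` to `Λ̂_S` -/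

theorem algebraMap_LamHat_val {n : ℕ} (p : S n) :
    ((algebraMap (S n) (LamHat n) p : LamHat n) : MvPowerSeries ℕ (S n)) = MvPowerSeries.C p := rfl

theorem omegaMat_mem {n : ℕ} (L : Matrix (Idx n) (Idx n) (S n)) (i j : Idx n) :
    omegaMat L i j ∈ LamHat n := by
  refine mem_LamHat_of_coeff fun d e h1 h2 => ?_
  rw [coeff_omegaMat, coeff_omegaMat, h1, h2]

/-- The matrix `Ω(L₀|y)` over `Λ̂_S`. -/
def lamMat (n : ℕ) : Matrix (Idx n) (Idx n) (LamHat n) :=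
  Matrix.of fun i j => ⟨omegaMat (bidiag bSeq) i j, omegaMat_mem _ i j⟩

theorem lamMat_map_val (n : ℕ) : (lamMat n).map ((LamHat n).val : LamHat n →+* _) =
    omegaMat (bidiag bSeq) := rfl

/-- Since L₀ is skew for J, moving J across the transpose of Ω(L₀) produces J Ω(-L₀), and Ω(-L₀) is
inverse to Ω(L₀). -/
theorem omegaMat_orth (n : ℕ) : (omegaMat (bidiag (bSeq (n := n)))).transpose *
    Jmat n (MvPowerSeries ℕ (S n)) * omegaMat (bidiag bSeq) = Jmat n (MvPowerSeries ℕ (S n)) := by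
  have h := bidiag_transpose_mul_Jmat (bSeq (n := n)) bSeq_rev
  have h1 := map_C_mul_omegaMat h.symm
  rw [map_Jmat] at h1
  rw [omegaMat_transpose, ← h1, mul_assoc, omegaMat_neg_mul, mul_one]

theorem isUnit_two (n : ℕ) : IsUnit (2 : S n) := by
  have : (2 : S n) = C 2 := (map_ofNat C 2).symm
  rw [this]
  exact (isUnit_iff_ne_zero.mpr two_ne_zero).map C

/-- Orthogonality leaves (D + 1)(D - 1) = 0. The constant term of D + 1 is 2, a unit, so D + 1 is
invertible as a power series. -/
theorem omegaMat_det (n : ℕ) : (omegaMat (bidiag (bSeq (n := n)))).det = 1 := by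
  have h := det_sq_of_orth (omegaMat_orth n)
  set D := (omegaMat (bidiag (bSeq (n := n)))).det with hD
  have h0 : MvPowerSeries.constantCoeff D = 1 := by
    have e : (omegaMat (bidiag (bSeq (n := n)))).map
        (MvPowerSeries.constantCoeff : MvPowerSeries ℕ (S n) →+* S n) = 1 := by
      ext1 i j
      rw [Matrix.map_apply, ← MvPowerSeries.coeff_zero_eq_constantCoeff_apply, coeff_omegaMat]
      simp
    rw [hD, RingHom.map_det, RingHom.mapMatrix_apply, e, Matrix.det_one]
  have hu : IsUnit (D + 1) := by
    rw [MvPowerSeries.isUnit_iff_constantCoeff, map_add, h0, map_one, one_add_one_eq_two]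
    exact isUnit_two n
  have h1 : (D + 1) * (D - 1) = (D + 1) * 0 := by linear_combination h
  exact sub_eq_zero.mp (hu.mul_left_cancel h1)

theorem isCentralizerPoint_lamMat (n : ℕ) : IsCentralizerPoint (lamMat n) := by
  have hinj : Function.Injective ((LamHat n).val : LamHat n →+* MvPowerSeries ℕ (S n)) :=
    Subtype.val_injective
  have hM : ∀ A B : Matrix (Idx n) (Idx n) (LamHat n),
      A.map ((LamHat n).val : LamHat n →+* MvPowerSeries ℕ (S n)) =
        B.map ((LamHat n).val : LamHat n →+* MvPowerSeries ℕ (S n)) → A = B :=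
    fun A B h => Matrix.map_injective hinj h
  have hcomm : lamMat n * bidiag (fun i => algebraMap (S n) (LamHat n) (bSeq i)) =
      bidiag (fun i => algebraMap (S n) (LamHat n) (bSeq i)) * lamMat n := by
    apply hM
    rw [Matrix.map_mul, Matrix.map_mul, lamMat_map_val, map_bidiag]
    have h := map_C_mul_omegaMat (rfl : bidiag (bSeq (n := n)) * bidiag bSeq = _)
    rw [map_bidiag] at h
    exact h.symm
  refine ⟨fun i j hij => upper_of_comm _ _ hcomm i j hij, ?_, ?_, hcomm⟩
  · apply hM
    rw [Matrix.map_mul, Matrix.map_mul, map_Jmat, Matrix.transpose_map, lamMat_map_val]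
    exact omegaMat_orth n
  · apply hinj
    rw [RingHom.map_det, RingHom.mapMatrix_apply, lamMat_map_val, map_one]
    exact omegaMat_det n

/-- An `S`-algebra homomorphism out of `ℂ[𝒵]` attached to a point of the centralizer family. -/
def CZ.liftAlg {n : ℕ} {R : Type*} [CommRing R] [Algebra (S n) R]
    (M : Matrix (Idx n) (Idx n) R) (hM : IsCentralizerPoint M) : CZ n →ₐ[S n] R where
  toRingHom := Ideal.Quotient.lift (centralizerIdeal n)
    (eval₂Hom (algebraMap (S n) R) (fun ij => M ij.1 ij.2))
    (eval_mem (algebraMap (S n) R) M (@IsCentralizerPoint.mk n R _ (algebraMap (S n) R).toAlgebra M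
      hM.upper hM.orth hM.det hM.comm))
  commutes' p := eval₂Hom_C (algebraMap (S n) R) _ p

theorem CZ.liftAlg_z {n : ℕ} {R : Type*} [CommRing R] [Algebra (S n) R]
    (M : Matrix (Idx n) (Idx n) R) (hM : IsCentralizerPoint M) (i j : Idx n) :
    CZ.liftAlg M hM (z i j) = M i j :=
  eval₂Hom_X' (algebraMap (S n) R) _ (i, j)

theorem CZ.mk_surjective (n : ℕ) : Function.Surjective (CZ.mk n) := Ideal.Quotient.mk_surjective

@[elab_as_elim]
theorem CZ.induction {n : ℕ} {p : CZ n → Prop} (halg : ∀ r, p (algebraMap (S n) (CZ n) r))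
    (hz : ∀ i j, p (z i j)) (hadd : ∀ f g, p f → p g → p (f + g))
    (hmul : ∀ f g, p f → p g → p (f * g)) (f : CZ n) : p f := by
  obtain ⟨q, rfl⟩ := CZ.mk_surjective n f
  induction q using MvPolynomial.induction_on with
  | C r => exact halg r
  | add f g hf hg => rw [map_add]; exact hadd _ _ hf hg
  | mul_X f ij hf => rw [map_mul]; exact hmul _ _ hf (hz ij.1 ij.2)

theorem CZ.ringHom_ext {n : ℕ} {R : Type*} [Semiring R] {f g : CZ n →+* R}
    (h1 : ∀ r, f (algebraMap (S n) (CZ n) r) = g (algebraMap (S n) (CZ n) r))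
    (h2 : ∀ i j, f (z i j) = g (z i j)) : f = g := by
  ext x
  induction x using CZ.induction with
  | halg r => exact h1 r
  | hz i j => exact h2 i j
  | hadd f g hf hg => rw [map_add, map_add, hf, hg]
  | hmul f g hf hg => rw [map_mul, map_mul, hf, hg]

/-- The homomorphism `ℂ[𝒵] → Λ̂_S` that sends `Z` to `Ω(L₀|y)`. -/
def toLam (n : ℕ) : CZ n →ₐ[S n] LamHat n := CZ.liftAlg (lamMat n) (isCentralizerPoint_lamMat n)

theorem toLam_z {n : ℕ} (i j : Idx n) : toLam n (z i j) = lamMat n i j := CZ.liftAlg_z _ _ i j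

theorem toLam_z_eq_qHat {n : ℕ} (i j : Idx n) (h : i ≤ j) :
    toLam n (z i j) = (-1) ^ ((j : ℕ) - (i : ℕ)) *
      qHat ((j : ℕ) - (i : ℕ)) (fun l : Finset.Icc i j => bSeq (l : Idx n)) := by
  rw [toLam_z]
  apply Subtype.ext
  refine (coeff_omegaMat_bidiag i j h).trans ?_
  simp [qHat]

theorem lamMat_diag {n : ℕ} (i : Idx n) : lamMat n i i = Omega (bSeq i) := by
  apply Subtype.ext
  ext1 d
  change MvPowerSeries.coeff d (omegaMat (bidiag bSeq) i i) = _
  have h : ∀ m : ℕ, (bidiag (bSeq (n := n)) ^ m) i i = bSeq i ^ m := by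
    intro m
    induction m with
    | zero => simp
    | succ m ih =>
      rw [pow_succ', bidiag_mul, ih, pow_succ']
      have : (if h : (i : ℕ) + 1 < 2 * n + 1 then
          (bidiag (bSeq (n := n)) ^ m) ⟨i + 1, h⟩ i else 0) = 0 := by
        split_ifs with h
        · rw [bidiag_pow, if_neg]
          simp [Fin.le_def]
        · rfl
      rw [this, sub_zero]
  rw [coeff_omegaMat, h]
  exact mul_comm _ _

theorem bSeq_ofFin {n : ℕ} (i : Fin n) : bSeq (Idx.ofFin i) = (X i : S n) := by
  rw [bSeq, dif_pos (show ((Idx.ofFin i : Idx n) : ℕ) < n from i.2)]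
  rfl

theorem toLam_z_diag {n : ℕ} (i : Fin n) :
    toLam n (z (Idx.ofFin i) (Idx.ofFin i)) = Omega (X i) := by
  rw [toLam_z, lamMat_diag, bSeq_ofFin]

/-! ### Equivariance under the Weyl group -/

/-- The action of `w ∈ W` on the coefficients of the elements of `Λ̂_S`. -/
def lamAut {n : ℕ} (w : W n) : LamHat n →+* LamHat n where
  toFun f := ⟨MvPowerSeries.map (MulSemiringAction.toRingHom (W n) (S n) w) f, map_mem_LamHat w f.2⟩
  map_one' := Subtype.ext (map_one _)
  map_zero' := Subtype.ext (map_zero _)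
  map_mul' _ _ := Subtype.ext (map_mul _ _ _)
  map_add' _ _ := Subtype.ext (map_add _ _ _)

theorem lamAut_val {n : ℕ} (w : W n) (f : LamHat n) : (lamAut w f : MvPowerSeries ℕ (S n)) =
    MvPowerSeries.map (MulSemiringAction.toRingHom (W n) (S n) w) f := rfl

theorem lamAut_algebraMap {n : ℕ} (w : W n) (p : S n) :
    lamAut w (algebraMap (S n) (LamHat n) p) = algebraMap (S n) (LamHat n) (w • p) := by
  apply Subtype.ext
  rw [lamAut_val, algebraMap_LamHat_val, algebraMap_LamHat_val, MvPowerSeries.map_C]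
  rfl

theorem lamAut_smul {n : ℕ} (w : W n) (p : S n) (f : LamHat n) :
    lamAut w (p • f) = (w • p) • lamAut w f := by
  rw [Algebra.smul_def, Algebra.smul_def, map_mul, lamAut_algebraMap]

theorem lamAut_mul {n : ℕ} (v w : W n) (f : LamHat n) :
    lamAut (v * w) f = lamAut v (lamAut w f) := by
  apply Subtype.ext
  ext1 d
  simp [lamAut_val, mul_smul]

theorem lamAut_one {n : ℕ} (f : LamHat n) : lamAut 1 f = f := by
  apply Subtype.ext
  ext1 d
  simp [lamAut_val]

theorem lamAut_Omega {n : ℕ} (w : W n) (p : S n) : lamAut w (Omega p) = Omega (w • p) :=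
  Subtype.ext (map_omegaSeries _ p)

theorem ofWaf_inr_smul {n : ℕ} [NeZero n] (w : W n) (f : LamHat n) :
    NilHecke.ofWaf (SemidirectProduct.inr w) • f = lamAut w f := by
  refine LamHat.toReg_inj ((NilHecke.act_spec _ f).trans ?_)
  change actTwisted n (SkewMonoidAlgebra.single _ 1) _ = _
  rw [actTwisted_single, one_smul, actWaf_apply]
  have h1 : (SemidirectProduct.inr w : Waf n).left = 1 := rfl
  have h2 : (SemidirectProduct.inr w : Waf n).right = w := rfl
  rw [h1, h2, map_one, Units.val_one, one_mul, coeffAut_toReg]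
  rfl

theorem omegaMat_map {n : ℕ} (w : W n) (L : Matrix (Idx n) (Idx n) (S n)) :
    (omegaMat L).map (MvPowerSeries.map (MulSemiringAction.toRingHom (W n) (S n) w)) =
      omegaMat (L.map (MulSemiringAction.toRingHom (W n) (S n) w)) := by
  ext1 i j
  ext1 d
  rw [Matrix.map_apply, MvPowerSeries.coeff_map, coeff_omegaMat, coeff_omegaMat, map_mul, map_pow,
    map_ofNat, ← RingHom.mapMatrix_apply, ← map_pow]
  rfl

theorem map_uMat_hom {n : ℕ} {R R' : Type*} [CommRing R] [CommRing R'] [Algebra ℂ R] [Algebra ℂ R']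
    (f : R →ₐ[ℂ] R') (k : Fin n) (x : R) :
    (uMat k x).map (f : R →+* R') = uMat k (f x) := by
  have h : f (algebraMap ℂ R 2⁻¹) = algebraMap ℂ R' 2⁻¹ := f.commutes _
  rw [uMat, uMat, ← map_fMat (f : R →+* R') k, ← Matrix.map_mul, ← h]
  ext i j
  simp only [Matrix.map_apply, Matrix.add_apply, Matrix.smul_apply, smul_eq_mul, map_add, map_mul,
    Matrix.one_apply, AlgHom.coe_toRingHom, map_pow]
  split_ifs <;> simp

/-- Applying sₖ to the coefficients replaces L₀ by sₖ(L₀), which is conjugate to L₀ by exp(-αₖ fₖ);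
the series Ω follows the conjugation. -/
theorem lamMat_map_lamAut {n : ℕ} (k : Fin n) : (lamMat n).map (lamAut (sW k)) =
    uMat k (-algebraMap (S n) (LamHat n) (toS (simpleRoot k))) * lamMat n *
      uMat k (algebraMap (S n) (LamHat n) (toS (simpleRoot k))) := by
  have hinj : Function.Injective ((LamHat n).val : LamHat n →+* MvPowerSeries ℕ (S n)) :=
    Subtype.val_injective
  apply Matrix.map_injective hinj
  have hC : ∀ x : S n, ((uMat k (algebraMap (S n) (LamHat n) x)).map
      ((LamHat n).val : LamHat n →+* MvPowerSeries ℕ (S n))) =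
        (uMat k x).map (MvPowerSeries.C (σ := ℕ)) := by
    intro x
    have h1 := map_uMat_hom (((LamHat n).val.restrictScalars ℂ : LamHat n →ₐ[ℂ] _)) k
      (algebraMap (S n) (LamHat n) x)
    have h2 := map_uMat_hom (Algebra.algHom ℂ (S n) (MvPowerSeries ℕ (S n))) k x
    exact h1.trans h2.symm
  have hl : ((lamMat n).map (lamAut (sW k))).map
      ((LamHat n).val : LamHat n →+* MvPowerSeries ℕ (S n)) =
        omegaMat (bidiag fun l => sW k • bSeq l) := by
    have h := omegaMat_map (sW k) (bidiag bSeq)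
    rw [map_bidiag] at h
    exact h
  beta_reduce
  rw [Matrix.map_mul, Matrix.map_mul, ← map_neg (algebraMap (S n) (LamHat n)), hC, hC,
    lamMat_map_val, map_C_mul_omegaMat (uMat_bidiag k)]
  refine hl.trans ?_
  rw [mul_assoc, ← Matrix.map_mul, uMat_neg_mul]
  simp

theorem toLam_sigma {n : ℕ} (k : Fin n) (f : CZ n) :
    toLam n (sigma k f) = lamAut (sW k) (toLam n f) := by
  have h : ((toLam n : CZ n →+* LamHat n).comp (sigma k)) =
      (lamAut (sW k)).comp (toLam n : CZ n →+* LamHat n) := by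
    apply CZ.ringHom_ext
    · intro r
      simp [sigma_algebraMap, lamAut_algebraMap]
    · intro i j
      have h1 := congrFun (congrFun (lamMat_map_lamAut k) i) j
      have h2 : (zMat n).map (toLam n : CZ n →+* LamHat n) = lamMat n := by
        ext1 i j
        exact toLam_z i j
      have h3 : ∀ x : CZ n, (uMat k x).map (toLam n : CZ n →+* LamHat n) = uMat k (toLam n x) :=
        fun x => map_uMat_hom ((toLam n).restrictScalars ℂ) k x
      have h4 : toLam n (alphaCZ k) = algebraMap (S n) (LamHat n) (toS (simpleRoot k)) :=
        (toLam n).commutes _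
      rw [← h4, ← map_neg, ← h3, ← h3, ← h2, ← Matrix.map_mul, ← Matrix.map_mul] at h1
      simp only [RingHom.comp_apply, sigma_z]
      exact h1.symm.trans rfl
  exact DFunLike.congr_fun h f

/-! ### Flatness of `ℂ[𝒵]` over `S` -/

section Commutant

variable {n : ℕ} {R : Type*} [CommRing R]

/-- Because the superdiagonal of L is -1, the commutation relation expresses row i + 1 through row
i, so the first row determines the whole matrix. -/
theorem eq_of_comm_bidiag {c : Idx n → R} {M N : Matrix (Idx n) (Idx n) R}
    (hM : M * bidiag c = bidiag c * M) (hN : N * bidiag c = bidiag c * N)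
    (h : ∀ j, M 0 j = N 0 j) : M = N := by
  have key : ∀ (a : ℕ) (ha : a < 2 * n + 1) (j : Idx n), M ⟨a, ha⟩ j = N ⟨a, ha⟩ j := by
    intro a
    induction a with
    | zero => intro _ j; exact h j
    | succ a ih =>
      intro ha j
      have e1 := congrFun (congrFun hM ⟨a, by omega⟩) j
      have e2 := congrFun (congrFun hN ⟨a, by omega⟩) j
      rw [mul_bidiag, bidiag_mul, dif_pos ha] at e1 e2
      simp only [ih (by omega)] at e1
      linear_combination e1 - e2
  ext i j
  exact key i i.2 j

/-- The products `∏_{l < m} (L - c_l)` for the bidiagonal matrix `L` with diagonal `c`. -/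
def bidiagProd (c : Idx n → R) : ℕ → Matrix (Idx n) (Idx n) R
  | 0 => 1
  -- The value 0 outside the index range is a dummy: only the products with m ≤ 2n are used.
  | m + 1 => bidiagProd c m * (bidiag c - (if h : m < 2 * n + 1 then c ⟨m, h⟩ else 0) • 1)

theorem bidiagProd_comm (c : Idx n → R) (m : ℕ) : Commute (bidiagProd c m) (bidiag c) := by
  induction m with
  | zero => exact Commute.one_left _
  | succ m ih =>
    exact ih.mul_left (((Commute.refl _).sub_left ((Commute.one_left _).smul_left _)))

/-- Multiplying the m-th unit row vector by L - c_m gives minus the next one. So these products have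
the unit vectors, up to sign, as first rows, and an element of the commutant with any prescribed
first row is a combination of them. -/
theorem bidiagProd_zero_row (c : Idx n → R) (m : ℕ) (l : Idx n) :
    bidiagProd c m 0 l = if (l : ℕ) = m then (-1) ^ m else 0 := by
  induction m generalizing l with
  | zero =>
    rw [bidiagProd, Matrix.one_apply, pow_zero]
    exact if_congr ⟨fun h => by rw [← h]; rfl, fun h => (Fin.ext h.symm)⟩ rfl rfl
  | succ m ih =>
    have e : (if h : (l : ℕ) = 0 then 0 else bidiagProd c m 0 ⟨l - 1, by omega⟩) =
        if (l : ℕ) = m + 1 then (-1) ^ m else 0 := by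
      split_ifs with h1 h2 h2
      · omega
      · rfl
      · rw [ih, if_pos (by simp; omega)]
      · rw [ih, if_neg (by simp; omega)]
    rw [bidiagProd, mul_sub, Matrix.sub_apply, mul_bidiag, mul_smul_comm, mul_one,
      Matrix.smul_apply, smul_eq_mul, e, ih]
    by_cases h : (l : ℕ) = m
    · have hl := l.2
      subst h
      rw [if_pos rfl, dif_pos hl, if_neg (by omega), if_neg (by omega)]
      ring
    · rw [if_neg h]
      by_cases h2 : (l : ℕ) = m + 1
      · rw [if_pos h2, if_pos h2, pow_succ]; ring
      · rw [if_neg h2, if_neg h2]; ring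

/-- The first row of a matrix in the commutant is arbitrary, so it can be lifted entry by entry and
completed by the products `bidiagProd`. The image agrees with Z because its first row does. -/
theorem exists_comm_bidiag_lift {R' : Type*} [CommRing R'] (f : R →+* R')
    (hf : Function.Surjective f) (c : Idx n → R) (Z : Matrix (Idx n) (Idx n) R')
    (hZ : Z * bidiag (fun i => f (c i)) = bidiag (fun i => f (c i)) * Z) :
    ∃ Y : Matrix (Idx n) (Idx n) R, Y.map f = Z ∧ Y * bidiag c = bidiag c * Y := by
  choose r hr using fun j => hf (Z 0 j)
  have hcomm : Commute (∑ j : Idx n, ((-1) ^ (j : ℕ) * r j) • bidiagProd c j) (bidiag c) :=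
    Commute.sum_left _ _ _ fun j _ => (bidiagProd_comm c j).smul_left _
  refine ⟨_, eq_of_comm_bidiag ?_ hZ fun j => ?_, hcomm⟩
  · have h := congrArg (fun M => M.map f) (show _ * _ = _ * _ from hcomm)
    simpa only [Matrix.map_mul, map_bidiag] using h
  · rw [Matrix.map_apply, ← hr, Matrix.sum_apply, Finset.sum_eq_single j]
    · rw [Matrix.smul_apply, bidiagProd_zero_row, if_pos rfl, smul_eq_mul, mul_right_comm,
        ← pow_add, Even.neg_one_pow ⟨j, rfl⟩, one_mul]
    · intro l _ hl
      rw [Matrix.smul_apply, bidiagProd_zero_row, if_neg, smul_zero]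
      exact fun e => hl (Fin.ext e.symm)
    · simp

/-- A single Newton step. The error E = J Yᵗ J Y - 1 has entries in the square-zero kernel, commutes
with L and is self-adjoint for J, so Y (1 - E/2) is orthogonal, still commutes with L and has the
same image. The element a plays the role of 1/2. -/
theorem exists_orth_lift {R' : Type*} [CommRing R'] (f : R →+* R')
    (hsq : ∀ x y, f x = 0 → f y = 0 → x * y = 0) (a : R) (ha : 2 * a = 1) (c : Idx n → R)
    (hc : ∀ i : Idx n, c i.rev = -c i) (Y : Matrix (Idx n) (Idx n) R)
    (hY : Y * bidiag c = bidiag c * Y)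
    (horth : (Y.map f).transpose * Jmat n R' * Y.map f = Jmat n R') :
    ∃ Z : Matrix (Idx n) (Idx n) R, Z.map f = Y.map f ∧ Z * bidiag c = bidiag c * Z ∧
      Z.transpose * Jmat n R * Z = Jmat n R := by
  have hJJ := Jmat_mul_Jmat n R
  set J := Jmat n R with hJ
  have hJt : J.transpose = J := by
    ext i j
    simp only [Matrix.transpose_apply, hJ, Jmat, Matrix.of_apply]
    by_cases h : (i : ℕ) + j = 2 * n
    · rw [if_pos h, if_pos (by omega)]
      apply neg_one_pow_congr
      grind
    · rw [if_neg h, if_neg (by omega)]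
  set L := bidiag c with hL
  have hLJ : L.transpose * J = -(J * L) := by
    rw [bidiag_transpose_mul_Jmat c hc, mul_neg]
  have hJL : J * L.transpose = -(L * J) := by
    calc J * L.transpose = J * (L.transpose * J) * J := by
          rw [mul_assoc, mul_assoc, hJJ, mul_one]
      _ = -(J * J * L * J) := by rw [hLJ]; simp [mul_assoc]
      _ = _ := by rw [hJJ, one_mul]
  set E := J * Y.transpose * J * Y - 1 with hE
  have hYt : L.transpose * Y.transpose = Y.transpose * L.transpose := by
    rw [← Matrix.transpose_mul, ← Matrix.transpose_mul, hY]
  -- L is skew for J, so passing it through J Yᵗ J changes the sign twice.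
  have hEL : E * L = L * E := by
    have : J * Y.transpose * J * Y * L = L * (J * Y.transpose * J * Y) := by
      calc J * Y.transpose * J * Y * L = J * Y.transpose * (J * L) * Y := by
            rw [mul_assoc _ Y, hY]; simp only [mul_assoc]
        _ = -(J * (Y.transpose * L.transpose) * J * Y) := by
            rw [← neg_neg (J * L), ← hLJ]; simp only [mul_assoc, neg_mul, mul_neg]
        _ = -((J * L.transpose) * Y.transpose * J * Y) := by rw [← hYt]; simp only [mul_assoc]
        _ = _ := by rw [hJL]; simp only [mul_assoc, neg_mul, neg_neg]
    rw [hE, sub_mul, mul_sub, this, one_mul, mul_one]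
  have hYJ : Y.transpose * J * Y = J * (1 + E) := by
    rw [hE, add_sub_cancel, ← mul_assoc, ← mul_assoc, ← mul_assoc, hJJ, one_mul]
  -- Self-adjointness lets both corrections 1 - aE be collected on the same side of J.
  have hEt : E.transpose * J = J * E := by
    rw [hE]
    simp only [Matrix.transpose_sub, Matrix.transpose_mul, Matrix.transpose_transpose, hJt,
      Matrix.transpose_one, sub_mul, mul_sub, one_mul, mul_one]
    congr 1
    calc Y.transpose * (J * (Y * J)) * J = Y.transpose * J * Y * (J * J) := by
          simp only [mul_assoc]
      _ = J * J * Y.transpose * J * Y := by rw [hJJ, mul_one, one_mul]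
      _ = _ := by simp only [mul_assoc]
  have hE0 : ∀ i j, f (E i j) = 0 := by
    have h : E.map f = 0 := by
      have h1 : E.map f = (J * Y.transpose * J * Y).map f - 1 := by
        rw [hE]
        ext i j
        simp only [Matrix.map_apply, Matrix.sub_apply, map_sub, Matrix.one_apply, apply_ite f,
          map_one, map_zero]
      rw [h1, Matrix.map_mul, Matrix.map_mul, Matrix.map_mul, hJ, map_Jmat, mul_assoc, mul_assoc,
        ← mul_assoc _ (Jmat n R'), Matrix.transpose_map, horth, Jmat_mul_Jmat, sub_self]
    intro i j
    exact congrFun (congrFun h i) j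
  have hEE : E * E = 0 := by
    ext i j
    rw [Matrix.mul_apply]
    exact Finset.sum_eq_zero fun l _ => hsq _ _ (hE0 _ _) (hE0 _ _)
  refine ⟨Y * (1 - a • E), ?_, ?_, ?_⟩
  · ext i j
    rw [mul_sub, mul_one, Matrix.map_apply, Matrix.map_apply, Matrix.sub_apply, map_sub]
    have : f ((Y * a • E) i j) = 0 := by
      rw [Matrix.mul_apply, map_sum]
      refine Finset.sum_eq_zero fun l _ => ?_
      simp [hE0]
    rw [this, sub_zero]
  · have h : (1 - a • E) * L = L * (1 - a • E) := by
      rw [sub_mul, one_mul, smul_mul_assoc, hEL, mul_sub L 1, mul_one, mul_smul_comm]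
    rw [mul_assoc, h, ← mul_assoc, hY, mul_assoc]
  · have e1 : (1 - a • E).transpose * J = J * (1 - a • E) := by
      simp only [Matrix.transpose_sub, Matrix.transpose_one, Matrix.transpose_smul, sub_mul,
        mul_sub, one_mul, mul_one, smul_mul_assoc, mul_smul_comm, hEt]
    calc (Y * (1 - a • E)).transpose * J * (Y * (1 - a • E)) =
          (1 - a • E).transpose * (Y.transpose * J * Y) * (1 - a • E) := by
            rw [Matrix.transpose_mul]; simp only [mul_assoc]
      _ = J * ((1 - a • E) * (1 + E) * (1 - a • E)) := by
          rw [hYJ, ← mul_assoc, e1]; simp only [mul_assoc]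
      _ = J := by
          have e2 : (1 - a • E) * (1 + E) * (1 - a • E) = 1 := by
            simp only [sub_mul, mul_sub, mul_add, add_mul, one_mul, mul_one, smul_mul_assoc,
              mul_smul_comm, hEE, smul_zero, add_zero, sub_zero]
            have : 1 - a • E + E - a • E = 1 + (1 - 2 * a) • E := by module
            rw [this, ha, sub_self, zero_smul, add_zero]
          rw [e2, mul_one]

end Commutant

/-- A point modulo a square-zero ideal is lifted first inside the commutant of L₀, then corrected to
an orthogonal matrix; triangularity is automatic from commutation, and the determinant takes care of
itself. -/
theorem formallySmooth_CZ (n : ℕ) : Algebra.FormallySmooth (S n) (CZ n) := by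
  refine Algebra.FormallySmooth.of_comp_surjective fun B _ _ I hI g => ?_
  set f : B →+* B ⧸ I := Ideal.Quotient.mk I with hf
  have hsq : ∀ x y, f x = 0 → f y = 0 → x * y = 0 := by
    intro x y hx hy
    have := Ideal.mul_mem_mul (Ideal.Quotient.eq_zero_iff_mem.mp hx)
      (Ideal.Quotient.eq_zero_iff_mem.mp hy)
    rwa [← pow_two, hI, Ideal.mem_bot] at this
  obtain ⟨a, ha⟩ : ∃ a : B, 2 * a = 1 := by
    obtain ⟨u, hu⟩ := (isUnit_two n).exists_right_inv
    exact ⟨algebraMap (S n) B u, by rw [← map_ofNat (algebraMap (S n) B) 2, ← map_mul, hu, map_one]⟩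
  set c : Idx n → B := fun i => algebraMap (S n) B (bSeq i)
  have hc : ∀ i : Idx n, c i.rev = -c i := fun i => by simp only [c, bSeq_rev, map_neg]
  have hZ := isCentralizerPoint_zMat n
  have hcomm : (zMat n).map (g : CZ n →+* B ⧸ I) * bidiag (fun i => f (c i)) =
      bidiag (fun i => f (c i)) * (zMat n).map (g : CZ n →+* B ⧸ I) := by
    have h := congrArg (fun M => M.map (g : CZ n →+* B ⧸ I)) hZ.comm
    simp only [Matrix.map_mul, map_bidiag] at h
    have e : ∀ i, (g : CZ n →+* B ⧸ I) (algebraMap (S n) (CZ n) (bSeq i)) = f (c i) :=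
      fun i => g.commutes _
    simpa only [e] using h
  obtain ⟨Y, hYZ, hY⟩ := exists_comm_bidiag_lift f Ideal.Quotient.mk_surjective c _ hcomm
  have horth : (Y.map f).transpose * Jmat n (B ⧸ I) * Y.map f = Jmat n (B ⧸ I) := by
    have h := congrArg (fun M => M.map (g : CZ n →+* B ⧸ I)) hZ.orth
    simpa only [Matrix.map_mul, map_Jmat, Matrix.transpose_map, ← hYZ] using h
  obtain ⟨Z, hZY, hZL, hZJ⟩ := exists_orth_lift f hsq a ha c hc Y hY horth
  rw [hYZ] at hZY
  -- Both det² = 1 and (det - 1)² = 0 hold; subtracting gives 2 (det - 1) = 0, and 2 is invertible.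
  have hdet : Z.det = 1 := by
    have h1 := det_sq_of_orth hZJ
    have h2 : f (Z.det - 1) = 0 := by
      have h3 := congrArg (g : CZ n →+* B ⧸ I) hZ.det
      rw [RingHom.map_det, RingHom.mapMatrix_apply, ← hZY, ← RingHom.mapMatrix_apply,
        ← RingHom.map_det, map_one] at h3
      rw [map_sub, h3, map_one, sub_self]
    have h4 := hsq _ _ h2 h2
    linear_combination a * h1 - a * h4 + (1 - Z.det) * ha
  have hpt : IsCentralizerPoint Z := ⟨fun i j hij => upper_of_comm _ _ hZL i j hij, hZJ, hdet, hZL⟩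
  refine ⟨CZ.liftAlg Z hpt, AlgHom.coe_ringHom_injective (CZ.ringHom_ext (fun r => ?_) fun i j => ?_)⟩
  · simp
  · change f (CZ.liftAlg Z hpt (z i j)) = g (z i j)
    rw [CZ.liftAlg_z]
    exact congrFun (congrFun hZY i) j

/-- Formal smoothness gives flatness for a quotient of a polynomial ring in finitely many variables
over the Noetherian ring S. What is needed later is that nonzero elements of S can be cancelled in
ℂ[𝒵]. -/
theorem flat_CZ (n : ℕ) : Module.Flat (S n) (CZ n) :=
  have := formallySmooth_CZ n
  Algebra.FormallySmooth.flat_of_algHom_of_isNoetherianRing (CZ.mk n) (CZ.mk_surjective n)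

theorem smul_CZ_eq_zero {n : ℕ} {p : S n} (hp : p ≠ 0) {f : CZ n} (h : p • f = 0) : f = 0 := by
  have := flat_CZ n
  exact (smul_eq_zero_iff_right hp).mp h

/-! ### Linear independence of the products of the series `Ω(aᵢ|y)` -/

/-- The exponent of the squarefree monomial `∏_{j ∈ T} yⱼ`. -/
def sqfree (T : Finset ℕ) : ℕ →₀ ℕ := Finsupp.indicator T fun _ _ => 1

theorem sqfree_apply (T : Finset ℕ) (j : ℕ) : sqfree T j = if j ∈ T then 1 else 0 := by
  simp [sqfree, Finsupp.indicator_apply]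

theorem sqfree_support (T : Finset ℕ) : (sqfree T).support = T := by
  ext j; simp [sqfree_apply]

theorem sqfree_degree (T : Finset ℕ) : (sqfree T).degree = T.card := by
  rw [Finsupp.degree_apply, sqfree_support, Finset.card_eq_sum_ones]
  exact Finset.sum_congr rfl fun j hj => by rw [sqfree_apply, if_pos hj]

/-- The coefficient of `f` at each squarefree monomial of degree `r` is `u^r`. -/
def IsExp {R : Type*} [CommRing R] (f : MvPowerSeries ℕ R) (u : R) : Prop :=
  ∀ T : Finset ℕ, MvPowerSeries.coeff (sqfree T) f = u ^ T.card

section IsExp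

variable {R : Type*} [CommRing R]

/-- The decompositions of a squarefree exponent correspond to the subsets U of T, and the sum of
u^|U| v^|T \ U| over them is (u + v)^|T|. -/
theorem IsExp.mul {f g : MvPowerSeries ℕ R} {u v : R} (hf : IsExp f u) (hg : IsExp g v) :
    IsExp (f * g) (u + v) := by
  classical
  intro T
  rw [MvPowerSeries.coeff_mul, ← Finset.sum_pow_mul_eq_add_pow]
  refine Finset.sum_nbij' (fun p => p.1.support) (fun U => (sqfree U, sqfree (T \ U))) ?_ ?_ ?_ ?_ ?_
  · intro p hp
    have hp' : p.1 + p.2 = sqfree T := Finset.HasAntidiagonal.mem_antidiagonal.mp hp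
    rw [Finset.mem_powerset, ← sqfree_support T, ← hp']
    exact Finsupp.support_mono le_self_add
  · intro U hU
    rw [Finset.HasAntidiagonal.mem_antidiagonal]
    ext j
    have := @Finset.mem_powerset _ _ _ |>.mp hU
    simp only [Finsupp.add_apply, sqfree_apply, Finset.mem_sdiff]
    by_cases h1 : j ∈ U
    · simp [h1, this h1]
    · simp [h1]
  · intro p hp
    have hp' : p.1 + p.2 = sqfree T := Finset.HasAntidiagonal.mem_antidiagonal.mp hp
    have h : ∀ j, p.1 j + p.2 j = if j ∈ T then 1 else 0 := fun j => by
      rw [← sqfree_apply, ← hp']; rfl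
    refine Prod.ext ?_ ?_
    · ext j
      have := h j
      simp only [sqfree_apply, Finsupp.mem_support_iff]
      grind
    · ext j
      have := h j
      simp only [sqfree_apply, Finsupp.mem_support_iff, Finset.mem_sdiff]
      grind
  · intro U hU
    exact sqfree_support U
  · intro p hp
    have hp' : p.1 + p.2 = sqfree T := Finset.HasAntidiagonal.mem_antidiagonal.mp hp
    have h : ∀ j, p.1 j + p.2 j = if j ∈ T then 1 else 0 := fun j => by
      rw [← sqfree_apply, ← hp']; rfl
    have h1 : p.1 = sqfree p.1.support := by
      ext j
      have := h j
      simp only [sqfree_apply, Finsupp.mem_support_iff]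
      grind
    have h2 : p.2 = sqfree (T \ p.1.support) := by
      ext j
      have := h j
      simp only [sqfree_apply, Finsupp.mem_support_iff, Finset.mem_sdiff]
      grind
    have h3 : p.1.support ⊆ T := by
      rw [← sqfree_support T, ← hp']
      exact Finsupp.support_mono le_self_add
    have e1 := hf p.1.support
    have e2 := hg (T \ p.1.support)
    rw [← h1] at e1
    rw [← h2, Finset.card_sdiff_of_subset h3] at e2
    rw [e1, e2]

theorem IsExp.one : IsExp (1 : MvPowerSeries ℕ R) 0 := by
  classical
  intro T
  have : sqfree T = 0 ↔ T.card = 0 := by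
    rw [Finset.card_eq_zero, ← Finsupp.support_eq_empty, sqfree_support]
  rw [MvPowerSeries.coeff_one]
  split_ifs with h
  · rw [this.mp h, pow_zero]
  · rw [zero_pow (fun e => h (this.mpr e))]

theorem isExp_omegaSeries (c : R) : IsExp (omegaSeries c) (2 * c) := by
  intro T
  rw [coeff_omegaSeries, sqfree_degree, sqfree_support, mul_pow, mul_comm]

theorem IsExp.prod {ι : Type*} (s : Finset ι) (f : ι → MvPowerSeries ℕ R) (u : ι → R)
    (h : ∀ i, IsExp (f i) (u i)) : IsExp (∏ i ∈ s, f i) (∑ i ∈ s, u i) := by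
  induction s using Finset.cons_induction with
  | empty => simpa using IsExp.one
  | cons a s ha ih => rw [Finset.prod_cons, Finset.sum_cons]; exact (h a).mul ih

theorem IsExp.pow {f : MvPowerSeries ℕ R} {u : R} (h : IsExp f u) (m : ℕ) :
    IsExp (f ^ m) (m * u) := by
  have := IsExp.prod (Finset.range m) (fun _ => f) (fun _ => u) fun _ => h
  simpa using this

theorem isExp_omegaUnit_zpow (c : R) (m : ℤ) :
    IsExp ((omegaUnit c ^ m : (MvPowerSeries ℕ R)ˣ) : MvPowerSeries ℕ R) (m * (2 * c)) := by
  obtain ⟨k, rfl | rfl⟩ := m.eq_nat_or_neg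
  · rw [zpow_natCast, Units.val_pow_eq_pow_val]
    rw [Int.cast_natCast]
    exact (isExp_omegaSeries c).pow k
  · rw [zpow_neg, zpow_natCast, ← inv_pow, ← omegaUnit_neg, Units.val_pow_eq_pow_val]
    have := (isExp_omegaSeries (-c)).pow k
    have e : (k : R) * (2 * -c) = ((-(k : ℤ) : ℤ) : R) * (2 * c) := by push_cast; ring
    rw [← e]
    exact this

end IsExp

/-- The product `∏ᵢ Ω(aᵢ|y)^{λᵢ}`. -/
def omegaMon {n : ℕ} (v : Fin n → ℤ) : (MvPowerSeries ℕ (S n))ˣ :=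
  ∏ i, omegaUnit (X i : S n) ^ v i

/-- The coefficients at y₀ ⋯ y_(r-1), for varying r, turn each product into the monoid homomorphism
r ↦ (2 ∑ vᵢ aᵢ)^r. These are distinct for distinct v, so Dedekind's theorem on characters applies.
-/
theorem linearIndependent_omegaMon (n : ℕ) :
    LinearIndependent (S n) fun v : Fin n → ℤ => ((omegaMon v : (MvPowerSeries ℕ (S n))ˣ) :
      MvPowerSeries ℕ (S n)) := by
  let φ : MvPowerSeries ℕ (S n) →ₗ[S n] (Multiplicative ℕ → S n) :=
    LinearMap.pi fun r => MvPowerSeries.coeff (sqfree (Finset.range r.toAdd))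
  apply LinearIndependent.of_comp φ
  have hx : ∀ v : Fin n → ℤ, (2 : S n) * toS v = ∑ i, (v i : S n) * (2 * X i) := by
    intro v
    change (2 : S n) * ∑ j, v j • (X j : S n) = _
    rw [Finset.mul_sum]
    exact Finset.sum_congr rfl fun i _ => by rw [zsmul_eq_mul]; ring
  have h : (φ ∘ fun v : Fin n → ℤ => ((omegaMon v : (MvPowerSeries ℕ (S n))ˣ) :
      MvPowerSeries ℕ (S n))) =
      (fun g : Multiplicative ℕ →* S n => (g : Multiplicative ℕ → S n)) ∘
        fun v : Fin n → ℤ => powersHom (S n) (2 * toS v) := by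
    funext v r
    have h1 : IsExp ((omegaMon v : (MvPowerSeries ℕ (S n))ˣ) : MvPowerSeries ℕ (S n))
        (2 * toS v) := by
      rw [hx, omegaMon, Units.coe_prod]
      exact IsExp.prod _ _ _ fun i => isExp_omegaUnit_zpow _ _
    change MvPowerSeries.coeff (sqfree (Finset.range r.toAdd)) _ = _
    rw [h1, Finset.card_range]
    simp [powersHom_apply]
  rw [h]
  refine (linearIndependent_monoidHom (Multiplicative ℕ) (S n)).comp _ fun v w hvw => ?_
  have h2 := (powersHom (S n)).injective hvw
  exact toS_injective n ((isUnit_two n).mul_left_cancel h2)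

/-! ### Injectivity of the homomorphism to `Λ̂_S` -/

theorem z_upper {n : ℕ} {i j : Idx n} (h : j < i) : (z i j : CZ n) = 0 :=
  (isCentralizerPoint_zMat n).upper i j h

/-- In the entry (i, rev i) of Zᵗ J Z, a summand l > i contains z_li = 0 and a summand l < i
contains another entry below the diagonal, so only l = i is left. -/
theorem z_mul_z_rev {n : ℕ} (i : Idx n) : (z i i * z i.rev i.rev : CZ n) = 1 := by
  have h := congrFun (congrFun (isCentralizerPoint_zMat n).orth i) i.rev
  have e : (-1 : CZ n) ^ (i : ℕ) * (-1) ^ (i : ℕ) = 1 := by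
    rw [← pow_add]; exact Even.neg_one_pow ⟨i, rfl⟩
  rw [mul_assoc, Matrix.mul_apply, Finset.sum_eq_single i] at h
  · rw [Jmat_mul, Matrix.transpose_apply, Jmat, Matrix.of_apply,
      if_pos (by rw [Fin.val_rev]; omega)] at h
    change z i i * ((-1) ^ (i : ℕ) * z i.rev i.rev) = _ at h
    linear_combination (-1) ^ (i : ℕ) * h + (1 - z i i * z i.rev i.rev) * e
  · intro l _ hl
    rw [Jmat_mul, Matrix.transpose_apply]
    change z l i * (_ * z l.rev i.rev) = 0
    rcases lt_or_gt_of_ne hl with h1 | h1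
    · rw [z_upper (Fin.rev_lt_rev.mpr h1)]; ring
    · rw [z_upper h1]; ring
  · simp

/-- The index of the middle row. -/
def Idx.mid (n : ℕ) : Idx n := ⟨n, by omega⟩

/-- The determinant is the product of the diagonal entries. Those away from the middle cancel in
pairs under reversal, and det Z = 1 gives the middle one. -/
theorem z_mid {n : ℕ} : (z (Idx.mid n) (Idx.mid n) : CZ n) = 1 := by
  have h := (isCentralizerPoint_zMat n).det
  rw [Matrix.det_of_isUpperTriangular, ← Finset.mul_prod_erase _ _ (Finset.mem_univ (Idx.mid n)),
    Finset.prod_involution (fun i _ => i.rev), mul_one] at h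
  · exact h
  · intro i _; exact z_mul_z_rev i
  · intro i hi _ he
    apply (Finset.mem_erase.mp hi).1
    have := congrArg Fin.val he
    rw [Fin.val_rev] at this
    exact Fin.ext (by change (i : ℕ) = n; omega)
  · intro i hi
    refine Finset.mem_erase.mpr ⟨fun he => (Finset.mem_erase.mp hi).1 ?_, Finset.mem_univ _⟩
    have := congrArg Fin.val he
    rw [Fin.val_rev] at this
    change _ = n at this
    exact Fin.ext (by change (i : ℕ) = n; omega)
  · intro i _; exact Fin.rev_rev i
  · intro i j hij; exact z_upper hij

/-- The diagonal entry `z_{ii}` as a unit. -/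
def zUnit {n : ℕ} (i : Fin n) : (CZ n)ˣ where
  val := z (Idx.ofFin i) (Idx.ofFin i)
  inv := z (Idx.ofFin i).rev (Idx.ofFin i).rev
  val_inv := z_mul_z_rev _
  inv_val := by rw [mul_comm]; exact z_mul_z_rev _

/-- The product `∏ᵢ z_{ii}^{λᵢ}`. -/
def zMon {n : ℕ} (v : Fin n → ℤ) : CZ n := ((∏ i, zUnit i ^ v i : (CZ n)ˣ) : CZ n)

theorem zMon_zero {n : ℕ} : zMon (0 : Fin n → ℤ) = 1 := by simp [zMon]

theorem zMon_add {n : ℕ} (v w : Fin n → ℤ) : zMon (v + w) = zMon v * zMon w := by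
  simp [zMon, zpow_add, Finset.prod_mul_distrib]

theorem zMon_single {n : ℕ} (i : Fin n) (m : ℤ) :
    zMon (Pi.single i m) = ((zUnit i ^ m : (CZ n)ˣ) : CZ n) := by
  rw [zMon, Finset.prod_eq_single i]
  · simp
  · intro j _ hj; simp [hj]
  · simp

theorem toLam_zMon {n : ℕ} (v : Fin n → ℤ) :
    (toLam n (zMon v) : MvPowerSeries ℕ (S n)) = (omegaMon v : (MvPowerSeries ℕ (S n))ˣ) := by
  obtain ⟨g, hg⟩ : ∃ g : CZ n →* MvPowerSeries ℕ (S n),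
      ∀ f, g f = (toLam n f : MvPowerSeries ℕ (S n)) :=
    ⟨(((LamHat n).val : LamHat n →* MvPowerSeries ℕ (S n))).comp (toLam n : CZ n →* LamHat n),
      fun f => rfl⟩
  have h : ∀ i : Fin n, Units.map g (zUnit i) = omegaUnit (X i) := fun i => Units.ext (by
    change g (z (Idx.ofFin i) (Idx.ofFin i)) = _
    rw [hg, toLam_z_diag]
    rfl)
  rw [← hg, zMon, ← Units.coe_map, map_prod, omegaMon]
  simp only [map_zpow, h]

theorem z_diag_mem {n : ℕ} (i : Idx n) : ∃ v : Fin n → ℤ, z i i = zMon v := by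
  rcases lt_trichotomy (i : ℕ) n with h | h | h
  · refine ⟨Pi.single ⟨i, h⟩ 1, ?_⟩
    rw [zMon_single, zpow_one]
    rfl
  · refine ⟨0, ?_⟩
    have : i = Idx.mid n := Fin.ext h
    rw [zMon_zero, this, z_mid]
  · refine ⟨Pi.single ⟨2 * n - i, by omega⟩ (-1), ?_⟩
    rw [zMon_single, zpow_neg_one]
    have : i = (Idx.ofFin (⟨2 * n - i, by omega⟩ : Fin n)).rev := by
      apply Fin.ext
      rw [Fin.val_rev]
      change (i : ℕ) = _ - ((2 * n - i : ℕ) + 1)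
      omega
    conv_lhs => rw [this]
    rfl

/-- This makes the differences b_j - b_i with i ≠ j nonzero, so that they may serve as denominators
for the off-diagonal entries of Z. -/
theorem bSeq_injective (n : ℕ) : Function.Injective (bSeq (n := n)) := by
  let v : Idx n → P n := fun l => if h : (l : ℕ) < n then Pi.single ⟨l, h⟩ 1
    else if h : n < (l : ℕ) then -Pi.single ⟨2 * n - l, by omega⟩ 1 else 0
  have hv : ∀ l, bSeq l = toS (v l) := by
    intro l
    simp only [bSeq, v]
    split_ifs
    · rw [toS_one]
    · rw [map_neg, toS_one]
    · rw [map_zero]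
  intro i j hij
  rw [hv, hv] at hij
  have h := toS_injective n hij
  have hi := i.2
  have hj := j.2
  have h0 : ∀ k : Fin n, (Pi.single k 1 : P n) ≠ 0 := fun k e => by
    simpa using congrFun e k
  have hs : ∀ k l : Fin n, (Pi.single k 1 : P n) = Pi.single l 1 → k = l := by
    intro k l e
    by_contra hne
    have := congrFun e k
    simp [hne] at this
  have hn : ∀ k l : Fin n, (Pi.single k 1 : P n) ≠ -Pi.single l 1 := by
    intro k l e
    have := congrFun e k
    simp only [Pi.single_eq_same, Pi.neg_apply, Pi.single_apply] at this
    split_ifs at this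
    omega
  apply Fin.ext
  simp only [v] at h
  split_ifs at h with h1 h2 h3 h4 h5 h6 h7 h8
  · simpa using congrArg Fin.val (hs _ _ h)
  · exact absurd h (hn _ _)
  · exact absurd h (h0 _)
  · exact absurd h.symm (hn _ _)
  · have := congrArg Fin.val (hs _ _ (neg_injective h))
    simp only at this
    omega
  · exact absurd (neg_eq_zero.mp h) (h0 _)
  · exact absurd h.symm (h0 _)
  · exact absurd (neg_eq_zero.mp h.symm) (h0 _)
  · omega

/-- This is one entry of Z L₀ = L₀ Z. It is read in two ways: as a formula for z_ij, up to a
denominator, by entries nearer to the diagonal, and as a formula for row i + 1 in terms of row i. -/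
theorem bSeq_sub_smul_z {n : ℕ} (i j : Idx n) (hi : (i : ℕ) + 1 < 2 * n + 1) (hj : (j : ℕ) ≠ 0) :
    (bSeq j - bSeq i : S n) • (z i j : CZ n) = z i ⟨j - 1, by omega⟩ - z ⟨i + 1, hi⟩ j := by
  have h := congrFun (congrFun (isCentralizerPoint_zMat n).comm i) j
  rw [mul_bidiag, bidiag_mul, dif_neg hj, dif_pos hi] at h
  change z i j * _ - z _ _ = _ * z i j - z _ _ at h
  rw [Algebra.smul_def, map_sub]
  linear_combination h

/-- Generically L₀ has distinct eigenvalues and its centralizer is a torus with coordinates the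
diagonal entries of Z. Clearing denominators gives the multiplier p. -/
theorem exists_smul_mem_span_zMon {n : ℕ} (f : CZ n) :
    ∃ p : S n, p ≠ 0 ∧ p • f ∈ Submodule.span (S n) (Set.range (zMon (n := n))) := by
  set N := Submodule.span (S n) (Set.range (zMon (n := n))) with hN
  have hmul : ∀ f ∈ N, ∀ g ∈ N, f * g ∈ N := by
    intro f hf g hg
    have h := Submodule.mul_mem_mul hf hg
    rw [hN, Submodule.span_mul_span] at h
    refine Submodule.span_mono ?_ h
    rintro _ ⟨_, ⟨v, rfl⟩, _, ⟨w, rfl⟩, rfl⟩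
    exact ⟨v + w, zMon_add v w⟩
  have hone : (1 : CZ n) ∈ N := Submodule.subset_span ⟨0, zMon_zero⟩
  have hadd : ∀ f g : CZ n, (∃ p : S n, p ≠ 0 ∧ p • f ∈ N) → (∃ p : S n, p ≠ 0 ∧ p • g ∈ N) →
      ∃ p : S n, p ≠ 0 ∧ p • (f + g) ∈ N := by
    rintro f g ⟨p, hp, hf⟩ ⟨q, hq, hg⟩
    refine ⟨p * q, mul_ne_zero hp hq, ?_⟩
    rw [smul_add]
    refine N.add_mem ?_ ?_
    · rw [mul_comm, mul_smul]; exact N.smul_mem _ hf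
    · rw [mul_smul]; exact N.smul_mem _ hg
  induction f using CZ.induction with
  | halg r =>
    refine ⟨1, one_ne_zero, ?_⟩
    rw [one_smul, Algebra.algebraMap_eq_smul_one]
    exact N.smul_mem _ hone
  | hz i j =>
    -- Induction on the distance m to the diagonal; each step costs one factor b_j - b_i.
    have key : ∀ (m : ℕ) (i j : Idx n), (j : ℕ) = i + m → ∃ p : S n, p ≠ 0 ∧ p • z i j ∈ N := by
      intro m
      induction m with
      | zero =>
        intro i j h
        have : j = i := Fin.ext h
        subst this
        obtain ⟨v, hv⟩ := z_diag_mem j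
        exact ⟨1, one_ne_zero, by rw [one_smul, hv]; exact Submodule.subset_span ⟨v, rfl⟩⟩
      | succ m ih =>
        intro i j h
        have hj := j.2
        have h1 := ih i ⟨j - 1, by omega⟩ (by simp; omega)
        have h2 := ih ⟨i + 1, by omega⟩ j (by simp; omega)
        have h3 : ∃ p : S n, p ≠ 0 ∧ p • -(z ⟨i + 1, by omega⟩ j : CZ n) ∈ N := by
          obtain ⟨p, hp, h⟩ := h2
          exact ⟨p, hp, by rw [smul_neg]; exact N.neg_mem h⟩
        obtain ⟨p, hp, h4⟩ := hadd _ _ h1 h3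
        refine ⟨p * (bSeq j - bSeq i), mul_ne_zero hp (sub_ne_zero.mpr fun e => ?_), ?_⟩
        · have := congrArg Fin.val (bSeq_injective n e)
          omega
        · rw [mul_smul, bSeq_sub_smul_z i j (by omega) (by omega), sub_eq_add_neg]
          exact h4
    rcases lt_or_ge j i with h | h
    · exact ⟨1, one_ne_zero, by rw [z_upper h, smul_zero]; exact N.zero_mem⟩
    · exact key (j - i) i j (by have := Fin.le_def.mp h; omega)
  | hadd f g hf hg => exact hadd f g hf hg
  | hmul f g hf hg =>
    obtain ⟨p, hp, hf⟩ := hf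
    obtain ⟨q, hq, hg⟩ := hg
    refine ⟨p * q, mul_ne_zero hp hq, ?_⟩
    rw [← smul_mul_smul_comm]
    exact hmul _ hf _ hg

/-- A multiple of a kernel element lies in the span of the diagonal monomials, whose images are
independent; hence the multiple vanishes, and torsion-freeness removes the multiplier. -/
theorem toLam_injective (n : ℕ) : Function.Injective (toLam n) := by
  rw [injective_iff_map_eq_zero]
  intro f hf
  obtain ⟨p, hp, h⟩ := exists_smul_mem_span_zMon f
  apply smul_CZ_eq_zero hp
  obtain ⟨c, hc⟩ := Finsupp.mem_span_range_iff_exists_finsupp.mp h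
  have h1 : Finsupp.linearCombination (S n) (fun v : Fin n → ℤ =>
      ((omegaMon v : (MvPowerSeries ℕ (S n))ˣ) : MvPowerSeries ℕ (S n))) c = 0 := by
    have h2 : toLam n (p • f) = 0 := by rw [map_smul, hf, smul_zero]
    rw [← hc, Finsupp.sum, map_sum] at h2
    have h3 := congrArg (LamHat n).val h2
    rw [map_sum, map_zero] at h3
    rw [Finsupp.linearCombination_apply, Finsupp.sum, ← h3]
    refine Finset.sum_congr rfl fun v _ => ?_
    rw [map_smul, map_smul]
    exact congrArg _ (toLam_zMon v).symm
  have h3 : c = 0 := linearIndependent_iff.mp (linearIndependent_omegaMon n) c h1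
  rw [← hc, h3, Finsupp.sum_zero_index]

/-! ### The operators `Aᵢ` on `Λ̂_S` -/

theorem smul_LamHat_cancel {n : ℕ} {p : S n} (hp : p ≠ 0) {f g : LamHat n} (h : p • f = p • g) :
    f = g := by
  apply Subtype.ext
  ext1 d
  have h1 := congrArg (fun f : LamHat n => MvPowerSeries.coeff d (f : MvPowerSeries ℕ (S n))) h
  exact mul_left_cancel₀ hp h1

theorem toS_alphaAf_ne_zero {n : ℕ} [NeZero n] (i : Fin (n + 1)) : (toS (alphaAf i) : S n) ≠ 0 := by
  intro h
  have h2 := isUnit_alphaAf i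
  have := Sreg_nontrivial n
  rw [h, map_zero] at h2
  exact not_isUnit_zero h2

theorem ofWaf_mul {n : ℕ} [NeZero n] (x y : Waf n) :
    NilHecke.ofWaf (x * y) = NilHecke.ofWaf x * NilHecke.ofWaf y :=
  Subtype.ext (map_mul _ _ _)

theorem ofWaf_one {n : ℕ} [NeZero n] : NilHecke.ofWaf (1 : Waf n) = 1 :=
  Subtype.ext (map_one _)

theorem ofS_alphaAf_mul_A {n : ℕ} [NeZero n] (i : Fin (n + 1)) :
    NilHecke.ofS (toS (alphaAf i)) * NilHecke.A i = 1 - NilHecke.ofWaf (sAf i) :=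
  Subtype.ext (embS_mul_demazure i)

theorem alphaAf_smul_A {n : ℕ} [NeZero n] (i : Fin (n + 1)) (f : LamHat n) :
    (toS (alphaAf i) : S n) • (NilHecke.A i • f) = f - NilHecke.ofWaf (sAf i) • f := by
  rw [← NilHecke.ofS_smul, ← mul_smul, ofS_alphaAf_mul_A, sub_smul, one_smul]

theorem sAf_succ_smul {n : ℕ} [NeZero n] (k : Fin n) (f : LamHat n) :
    NilHecke.ofWaf (sAf k.succ) • f = lamAut (sW k) f := ofWaf_inr_smul _ f

theorem sAf_zero_smul {n : ℕ} [NeZero n] (f : LamHat n) :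
    NilHecke.ofWaf (sAf 0 : Waf n) • f = Omega (X 0) * lamAut (sTheta n) f := by
  change NilHecke.ofWaf (transl (eps 0) * SemidirectProduct.inr (sTheta n)) • f = _
  rw [ofWaf_mul, mul_smul, ofWaf_inr_smul, NilHecke.transl_smul]

theorem ofWaf_smul_smul {n : ℕ} [NeZero n] (i : Fin (n + 1)) (p : S n) (f : LamHat n) :
    NilHecke.ofWaf (sAf i) • (p • f) =
      ((sAf i : Waf n).right • p) • (NilHecke.ofWaf (sAf i) • f) := by
  refine Fin.cases ?_ (fun k => ?_) i
  · have h : (sAf 0 : Waf n).right = sTheta n := by simp [sAf, transl]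
    rw [sAf_zero_smul, sAf_zero_smul, lamAut_smul, mul_smul_comm, h]
  · rw [sAf_succ_smul, sAf_succ_smul, lamAut_smul]
    rfl

theorem alphaAf_dvd_sub_smul {n : ℕ} [NeZero n] (i : Fin (n + 1)) :
    ∀ p : S n, toS (alphaAf i) ∣ p - (sAf i : Waf n).right • p := by
  refine Fin.cases ?_ (fun k => ?_) i
  · have h : (sAf 0 : Waf n).right = sTheta n := by simp [sAf, transl]
    intro p
    have h2 : (toS (alphaAf (0 : Fin (n + 1))) : S n) = -toS (theta n) := by simp [alphaAf]
    rw [h, h2, neg_dvd]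
    exact dvd_sub_reflection (sTheta n) (theta n) (eps 0) sTheta_apply p
  · exact dvd_sub_reflection (sW k) (simpleRoot k) (simpleCoroot k)
      (fun v => Module.reflection_apply _ (simpleCoroot_simpleRoot k))

/-- The twisted Leibniz rule: q is the divided difference of p, and r = sᵢ(p). Stability of an
S-span under Aᵢ can therefore be tested on generators. -/
theorem exists_A_smul_smul {n : ℕ} [NeZero n] (i : Fin (n + 1)) (p : S n) :
    ∃ q r : S n, ∀ f : LamHat n, NilHecke.A i • (p • f) = q • f + r • (NilHecke.A i • f) := by
  obtain ⟨q, hq⟩ := alphaAf_dvd_sub_smul i p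
  refine ⟨q, (sAf i : Waf n).right • p, fun f => smul_LamHat_cancel (toS_alphaAf_ne_zero i) ?_⟩
  rw [alphaAf_smul_A, ofWaf_smul_smul, smul_add, smul_smul _ q, ← hq, smul_smul (toS _),
    mul_comm (toS _), mul_smul, alphaAf_smul_A]
  generalize NilHecke.ofWaf (sAf i) • f = g
  module

/-- A subset of `Λ̂_S` that is stable under `S` and the operators `Aᵢ` is stable under `𝔸_af`. -/
theorem NilHecke.smul_mem_of_A {n : ℕ} [NeZero n] (N : Submodule (S n) (LamHat n))
    (hA : ∀ i : Fin (n + 1), ∀ f ∈ N, NilHecke.A i • f ∈ N) (a : NilHecke n) : ∀ f ∈ N, a • f ∈ N := by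
  obtain ⟨a, ha⟩ := a
  induction ha using Subring.closure_induction with
  | mem x hx =>
    intro f hf
    rcases hx with ⟨p, rfl⟩ | ⟨i, rfl⟩
    · have : NilHecke.ofS p • f ∈ N := by rw [NilHecke.ofS_smul]; exact N.smul_mem p hf
      exact this
    · exact hA i f hf
  | zero =>
    intro f _
    have : (0 : NilHecke n) • f ∈ N := by rw [zero_smul]; exact N.zero_mem
    exact this
  | one =>
    intro f hf
    have : (1 : NilHecke n) • f ∈ N := by rw [one_smul]; exact hf
    exact this
  | add x y hx hy h1 h2 =>
    intro f hf
    have : ((⟨x, hx⟩ : NilHecke n) + ⟨y, hy⟩) • f ∈ N := by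
      rw [add_smul]; exact N.add_mem (h1 f hf) (h2 f hf)
    exact this
  | neg x hx h1 =>
    intro f hf
    have : (-(⟨x, hx⟩ : NilHecke n)) • f ∈ N := by rw [neg_smul]; exact N.neg_mem (h1 f hf)
    exact this
  | mul x y hx hy h1 h2 =>
    intro f hf
    have : ((⟨x, hx⟩ : NilHecke n) * ⟨y, hy⟩) • f ∈ N := by
      rw [mul_smul]; exact h1 _ (h2 f hf)
    exact this

theorem sW_mul_self {n : ℕ} (k : Fin n) : sW k * sW k = 1 := by
  apply Subtype.ext
  ext v : 1
  exact Module.involutive_reflection (simpleCoroot_simpleRoot k) v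

theorem lamAut_sW_sW {n : ℕ} (k : Fin n) (f : LamHat n) :
    lamAut (sW k) (lamAut (sW k) f) = f := by
  rw [← lamAut_mul, sW_mul_self, lamAut_one]

theorem simpleRoot_smul_A {n : ℕ} [NeZero n] (k : Fin n) (f : LamHat n) :
    (toS (simpleRoot k) : S n) • (NilHecke.A k.succ • f) = f - lamAut (sW k) f := by
  rw [← sAf_succ_smul]
  exact alphaAf_smul_A k.succ f

theorem toS_simpleRoot_ne_zero {n : ℕ} (k : Fin n) : (toS (simpleRoot k) : S n) ≠ 0 :=
  fun h => simpleRoot_ne_zero k (toS_injective n (h.trans (map_zero _).symm))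

theorem toS_theta (n : ℕ) [NeZero n] : (toS (theta n) : S n) = 2 * X 0 := by
  rw [theta, toS_single]; simp [zsmul_eq_mul]

theorem theta_smul_A_zero {n : ℕ} [NeZero n] (f : LamHat n) :
    (toS (theta n) : S n) • (NilHecke.A (0 : Fin (n + 1)) • f) = Omega (X 0) * lamAut (sTheta n) f - f := by
  have h := alphaAf_smul_A 0 f
  have h2 : (toS (alphaAf (0 : Fin (n + 1))) : S n) = -toS (theta n) := by simp [alphaAf]
  rw [h2, neg_smul, sAf_zero_smul] at h
  rw [← neg_inj, h, neg_sub]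

theorem toS_theta_ne_zero (n : ℕ) [NeZero n] : (toS (theta n) : S n) ≠ 0 := by
  rw [toS_theta]
  exact mul_ne_zero (isUnit_two n).ne_zero (X_ne_zero _)

theorem sW_smul_X {n : ℕ} (k : Fin n) (h : (k : ℕ) + 1 < n) :
    sW k • (X k : S n) = X ⟨k + 1, h⟩ ∧ sW k • (X ⟨k + 1, h⟩ : S n) = X k := by
  have hs : ∀ i : Fin n, simpleReflection k (Pi.single i (1 : ℤ)) =
      Pi.single (Equiv.swap k ⟨k + 1, h⟩ i) 1 := by
    intro i
    rw [simpleReflection_apply_swap k h]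
    ext j
    simp only [Function.comp_apply, Pi.single_apply]
    congr 1
    rw [eq_iff_iff]
    constructor
    · intro e; rw [← e, Equiv.swap_apply_self]
    · intro e; rw [e, Equiv.swap_apply_self]
  constructor
  · rw [toS_one, sW_smul_toS, hs, Equiv.swap_apply_left, ← toS_one]
  · rw [toS_one, sW_smul_toS, hs, Equiv.swap_apply_right, ← toS_one]

/-- The long reflections as elements of `W`. -/
def longW {n : ℕ} (i : Fin n) : W n := ⟨longReflection i, longReflection_mem i⟩

theorem longW_conj {n : ℕ} (k : Fin n) (h : (k : ℕ) + 1 < n) :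
    longW k = sW k * longW ⟨k + 1, h⟩ * sW k := Subtype.ext (simpleReflection_conj k h)

/-- Division of `f - s f` by `2 aᵢ`, where `s` is the reflection in `2 aᵢ`. -/
theorem exists_long_quotient {n : ℕ} [NeZero n] (N : Submodule (S n) (LamHat n))
    (hA : ∀ k : Fin n, ∀ f ∈ N, NilHecke.A k.succ • f ∈ N) (m : ℕ) :
    ∀ i : Fin n, (i : ℕ) + 1 + m = n → ∀ f ∈ N,
      ∃ q ∈ N, (2 * X i : S n) • q = f - lamAut (longW i) f := by
  have hs : ∀ k : Fin n, ∀ f ∈ N, lamAut (sW k) f ∈ N := by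
    intro k f hf
    have := N.sub_mem hf (N.smul_mem (toS (simpleRoot k)) (hA k f hf))
    rwa [simpleRoot_smul_A, sub_sub_cancel] at this
  induction m with
  | zero =>
    intro i hi f hf
    have h : ¬ (i : ℕ) + 1 < n := by omega
    refine ⟨NilHecke.A i.succ • f, hA i f hf, ?_⟩
    have e : longW i = sW i := Subtype.ext (simpleReflection_last i h).symm
    have hal : (toS (simpleRoot i) : S n) = 2 * X i := by
      rw [simpleRoot, dif_neg h, toS_single]; simp [zsmul_eq_mul]
    rw [e, ← hal, simpleRoot_smul_A]
  | succ m ih =>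
    intro i hi f hf
    have h : (i : ℕ) + 1 < n := by omega
    -- The reflection in 2aᵢ is the conjugate by sᵢ of the one in 2aᵢ₊₁, so the quotient for sᵢ(f)
    -- at i + 1 is carried back by sᵢ.
    obtain ⟨q, hq, e⟩ := ih ⟨i + 1, h⟩ (by simp; omega) _ (hs i f hf)
    refine ⟨lamAut (sW i) q, hs i q hq, ?_⟩
    have e2 := congrArg (lamAut (sW i)) e
    have h2 : sW i • (2 * X ⟨i + 1, h⟩ : S n) = 2 * X i := by
      rw [smul_mul', (sW_smul_X i h).2]
      congr 1
      exact map_ofNat (autS (sW i).1) 2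
    rw [lamAut_smul, h2, map_sub, lamAut_sW_sW, ← lamAut_mul, ← lamAut_mul, ← longW_conj] at e2
    exact e2

/-- The elements `(Ω(aᵢ|y) - 1) / (2 aᵢ)`, for varying `i`, are conjugate under `W`. -/
theorem exists_kappa_succ_iff {n : ℕ} (N : Submodule (S n) (LamHat n))
    (hs : ∀ k : Fin n, ∀ f ∈ N, lamAut (sW k) f ∈ N) (k : Fin n) (h : (k : ℕ) + 1 < n) :
    (∃ f ∈ N, (X k : S n) • f = Omega (X k) - 1) ↔
      ∃ f ∈ N, (X ⟨k + 1, h⟩ : S n) • f = Omega (X ⟨k + 1, h⟩) - 1 := by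
  obtain ⟨h1, h2⟩ := sW_smul_X k h
  constructor
  · rintro ⟨f, hf, e⟩
    have e2 := congrArg (lamAut (sW k)) e
    rw [lamAut_smul, h1, map_sub, map_one, lamAut_Omega, h1] at e2
    exact ⟨_, hs k f hf, e2⟩
  · rintro ⟨f, hf, e⟩
    have e2 := congrArg (lamAut (sW k)) e
    rw [lamAut_smul, h2, map_sub, map_one, lamAut_Omega, h2] at e2
    exact ⟨_, hs k f hf, e2⟩

theorem exists_kappa_iff {n : ℕ} (N : Submodule (S n) (LamHat n))
    (hs : ∀ k : Fin n, ∀ f ∈ N, lamAut (sW k) f ∈ N) (i j : Fin n) :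
    (∃ f ∈ N, (X i : S n) • f = Omega (X i) - 1) ↔
      ∃ f ∈ N, (X j : S n) • f = Omega (X j) - 1 := by
  have key : ∀ (m : ℕ) (hm : m < n), (∃ f ∈ N, (X ⟨0, by omega⟩ : S n) • f =
      Omega (X ⟨0, by omega⟩) - 1) ↔ ∃ f ∈ N, (X ⟨m, hm⟩ : S n) • f = Omega (X ⟨m, hm⟩) - 1 := by
    intro m
    induction m with
    | zero => intro _; rfl
    | succ m ih =>
      intro hm
      exact (ih (by omega)).trans (exists_kappa_succ_iff N hs ⟨m, by omega⟩ hm)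
  exact (key i i.2).symm.trans (key j j.2)

/-! ### The submodule `𝔸_af · 1` -/

/-- The submodule `𝔸_af · 1` of `Λ̂_S`. -/
def cyclicSub (n : ℕ) [NeZero n] : Submodule (S n) (LamHat n) where
  carrier := Set.range fun a : NilHecke n => a • (1 : LamHat n)
  add_mem' := by
    rintro _ _ ⟨a, rfl⟩ ⟨b, rfl⟩
    exact ⟨a + b, add_smul a b _⟩
  zero_mem' := ⟨0, zero_smul _ _⟩
  smul_mem' := by
    rintro p _ ⟨a, rfl⟩
    exact ⟨NilHecke.ofS p * a, by simp only [mul_smul, NilHecke.ofS_smul]⟩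

theorem one_mem_cyclicSub (n : ℕ) [NeZero n] : (1 : LamHat n) ∈ cyclicSub n := ⟨1, one_smul _ _⟩

theorem smul_mem_cyclicSub {n : ℕ} [NeZero n] (a : NilHecke n) {f : LamHat n}
    (hf : f ∈ cyclicSub n) : a • f ∈ cyclicSub n := by
  obtain ⟨b, rfl⟩ := hf
  exact ⟨a * b, mul_smul a b _⟩

theorem cyclicSub_le {n : ℕ} [NeZero n] {N : Submodule (S n) (LamHat n)} (h1 : 1 ∈ N)
    (hA : ∀ i : Fin (n + 1), ∀ f ∈ N, NilHecke.A i • f ∈ N) : cyclicSub n ≤ N := by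
  rintro _ ⟨a, rfl⟩
  exact NilHecke.smul_mem_of_A N hA a 1 h1

theorem lamAut_mem_cyclicSub {n : ℕ} [NeZero n] (w : W n) {f : LamHat n} (hf : f ∈ cyclicSub n) :
    lamAut w f ∈ cyclicSub n := by
  rw [← ofWaf_inr_smul]; exact smul_mem_cyclicSub _ hf

theorem sTheta_mul_self (n : ℕ) [NeZero n] : sTheta n * sTheta n = 1 := by
  apply Subtype.ext
  ext v : 1
  exact Module.involutive_reflection (eps_single_two (0 : Fin n)) v

/-- The operator A₀ mixes a translation with s_θ. This supplies the purely finite part, the divided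
difference for θ, using only A₁, …, Aₙ. -/
theorem exists_theta_quotient {n : ℕ} [NeZero n] (N : Submodule (S n) (LamHat n))
    (hA : ∀ k : Fin n, ∀ f ∈ N, NilHecke.A k.succ • f ∈ N) (f : LamHat n) (hf : f ∈ N) :
    ∃ q ∈ N, (toS (theta n) : S n) • q = f - lamAut (sTheta n) f := by
  rw [toS_theta]
  exact exists_long_quotient N hA (n - 1) 0
    (by have := NeZero.pos n; simp only [Fin.val_zero]; omega) f hf

/-- The elements of 𝔸_af · 1 that multiply 𝔸_af · 1 into itself include 1 and are stable under each
Aᵢ by a Leibniz rule, so they are all of it. -/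
theorem mul_mem_cyclicSub {n : ℕ} [NeZero n] {f g : LamHat n} (hf : f ∈ cyclicSub n)
    (hg : g ∈ cyclicSub n) : f * g ∈ cyclicSub n := by
  let N : Submodule (S n) (LamHat n) :=
    { carrier := {f | f ∈ cyclicSub n ∧ ∀ g ∈ cyclicSub n, f * g ∈ cyclicSub n}
      add_mem' := fun {a b} ha hb => ⟨add_mem ha.1 hb.1, fun g hg => by
        rw [add_mul]; exact add_mem (ha.2 g hg) (hb.2 g hg)⟩
      zero_mem' := ⟨zero_mem _, fun g _ => by rw [zero_mul]; exact zero_mem _⟩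
      smul_mem' := fun p f hf => ⟨Submodule.smul_mem _ p hf.1, fun g hg => by
        rw [smul_mul_assoc]; exact Submodule.smul_mem _ p (hf.2 g hg)⟩ }
  have h : cyclicSub n ≤ N := by
    refine cyclicSub_le ⟨one_mem_cyclicSub n, fun g hg => by rwa [one_mul]⟩ fun i => ?_
    refine Fin.cases ?_ (fun k => ?_) i
    · rintro f ⟨hf, hfm⟩
      refine ⟨smul_mem_cyclicSub _ hf, fun g' hg' => ?_⟩
      -- Writing the second factor as s_θ(g) lets the Leibniz rule for A₀ be solved for (A₀ f) g'.
      set g := lamAut (sTheta n) g' with hgdef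
      have hg : g ∈ cyclicSub n := lamAut_mem_cyclicSub _ hg'
      have hgg : g' = lamAut (sTheta n) g := by
        rw [hgdef, ← lamAut_mul, sTheta_mul_self, lamAut_one]
      obtain ⟨q, hq, e⟩ := exists_theta_quotient (cyclicSub n)
        (fun k f hf => smul_mem_cyclicSub _ hf) g hg
      have : (NilHecke.A (0 : Fin (n + 1)) • f) * g' = NilHecke.A (0 : Fin (n + 1)) • (f * g) + f * q := by
        apply smul_LamHat_cancel (toS_theta_ne_zero n)
        rw [← smul_mul_assoc, theta_smul_A_zero, smul_add, theta_smul_A_zero, ← mul_smul_comm, e,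
          map_mul, hgg]
        ring
      rw [this]
      exact add_mem (smul_mem_cyclicSub _ (hfm g hg)) (hfm q hq)
    · rintro f ⟨hf, hfm⟩
      refine ⟨smul_mem_cyclicSub _ hf, fun g' hg' => ?_⟩
      set g := lamAut (sW k) g' with hgdef
      have hg : g ∈ cyclicSub n := lamAut_mem_cyclicSub _ hg'
      have hgg : g' = lamAut (sW k) g := by rw [hgdef, lamAut_sW_sW]
      have : (NilHecke.A k.succ • f) * g' =
          NilHecke.A k.succ • (f * g) - f * (NilHecke.A k.succ • g) := by
        apply smul_LamHat_cancel (toS_simpleRoot_ne_zero k)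
        rw [← smul_mul_assoc, simpleRoot_smul_A, smul_sub, simpleRoot_smul_A, ← mul_smul_comm,
          simpleRoot_smul_A, map_mul, hgg]
        ring
      rw [this]
      exact sub_mem (smul_mem_cyclicSub _ (hfm g hg)) (hfm _ (smul_mem_cyclicSub _ hg))
  exact (h hf).2 g hg

/-- The subalgebra `𝔸_af · 1` of `Λ̂_S`. -/
def cyclicSubalgebra (n : ℕ) [NeZero n] : Subalgebra (S n) (LamHat n) :=
  (cyclicSub n).toSubalgebra (one_mem_cyclicSub n) fun _ _ hf hg => mul_mem_cyclicSub hf hg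

/-! ### Comparison of `𝔸_af · 1` with the image of `ℂ[𝒵]` -/

/-- The matrix `(exp(x f_k) - 1) / x`. -/
def nMat {n : ℕ} {R : Type*} [CommRing R] [Algebra ℂ R] (k : Fin n) (x : R) :
    Matrix (Idx n) (Idx n) R :=
  fMat R k + (algebraMap ℂ R 2⁻¹ * x) • (fMat R k * fMat R k)

theorem uMat_eq {n : ℕ} {R : Type*} [CommRing R] [Algebra ℂ R] (k : Fin n) (x : R) :
    uMat k x = 1 + x • nMat k x := by
  rw [uMat, nMat, smul_add, smul_smul, ← add_assoc]
  congr 2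
  ring

/-- The matrix `(Z - sₖ Z) / αₖ`. -/
def quotMat {n : ℕ} (k : Fin n) : Matrix (Idx n) (Idx n) (CZ n) :=
  nMat k (-alphaCZ k) * zMat n - zMat n * nMat k (alphaCZ k) +
    alphaCZ k • (nMat k (-alphaCZ k) * zMat n * nMat k (alphaCZ k))

theorem alphaCZ_smul_quotMat {n : ℕ} (k : Fin n) : zMat n - reflMat k = alphaCZ k • quotMat k := by
  rw [reflMat, quotMat, uMat_eq, uMat_eq]
  simp only [add_mul, mul_add, one_mul, mul_one, smul_mul_assoc, mul_smul_comm, neg_smul, smul_add,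
    smul_sub, neg_mul, smul_neg]
  abel

theorem z_sub_sigma {n : ℕ} (k : Fin n) (i j : Idx n) :
    z i j - sigma k (z i j) = alphaCZ k * quotMat k i j := by
  rw [sigma_z]
  exact congrFun (congrFun (alphaCZ_smul_quotMat k) i) j

/-- Divisibility by αₖ holds on S and on the z_ij, and fg - σ(f)σ(g) = (f - σ(f)) g + σ(f) (g -
σ(g)) extends it to products. -/
theorem exists_sub_sigma {n : ℕ} (k : Fin n) (f : CZ n) :
    ∃ q, f - sigma k f = alphaCZ k * q := by
  induction f using CZ.induction with
  | halg r =>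
    obtain ⟨q, hq⟩ := dvd_sub_reflection (sW k) (simpleRoot k) (simpleCoroot k)
      (fun v => Module.reflection_apply _ (simpleCoroot_simpleRoot k)) r
    exact ⟨algebraMap (S n) (CZ n) q, by rw [sigma_algebraMap, ← map_sub, hq, map_mul]; rfl⟩
  | hz i j => exact ⟨_, z_sub_sigma k i j⟩
  | hadd f g hf hg =>
    obtain ⟨q, hq⟩ := hf
    obtain ⟨r, hr⟩ := hg
    exact ⟨q + r, by rw [map_add, mul_add, ← hq, ← hr]; ring⟩
  | hmul f g hf hg =>
    obtain ⟨q, hq⟩ := hf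
    obtain ⟨r, hr⟩ := hg
    refine ⟨q * g + sigma k f * r, ?_⟩
    rw [map_mul]
    linear_combination g * hq + sigma k f * hr

/-- Since αₖ can be cancelled in Λ̂_S, any quotient of f - sₖ(f) by αₖ found in ℂ[𝒵] computes Aₖ on
the image. It is applied to the explicit entries of `quotMat`. -/
theorem A_smul_toLam {n : ℕ} [NeZero n] {k : Fin n} {f q : CZ n}
    (h : f - sigma k f = alphaCZ k * q) : NilHecke.A k.succ • toLam n f = toLam n q := by
  apply smul_LamHat_cancel (toS_simpleRoot_ne_zero k)
  rw [simpleRoot_smul_A, ← toLam_sigma, ← map_sub, h, alphaCZ, ← Algebra.smul_def, map_smul]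

theorem nMat_mul {n : ℕ} {R : Type*} [CommRing R] [Algebra ℂ R] (k : Fin n) (x : R)
    (M : Matrix (Idx n) (Idx n) R) (i j : Idx n) : (nMat k x * M) i j = (fMat R k * M) i j +
      algebraMap ℂ R 2⁻¹ * x * (fMat R k * (fMat R k * M)) i j := by
  rw [nMat, add_mul, smul_mul_assoc, mul_assoc]; rfl

theorem mul_nMat {n : ℕ} {R : Type*} [CommRing R] [Algebra ℂ R] (k : Fin n) (x : R)
    (M : Matrix (Idx n) (Idx n) R) (i j : Idx n) : (M * nMat k x) i j = (M * fMat R k) i j +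
      algebraMap ℂ R 2⁻¹ * x * (M * fMat R k * fMat R k) i j := by
  rw [nMat, mul_add, mul_smul_comm, mul_assoc M]; rfl

/-- The first row of fₖ vanishes, so left multiplication by its polynomials without constant term
contributes nothing there. -/
theorem quotMat_zero_row {n : ℕ} (k : Fin n) (j : Idx n) :
    quotMat k 0 j = -(zMat n * nMat k (alphaCZ k)) 0 j := by
  have h : ∀ (M : Matrix (Idx n) (Idx n) (CZ n)) (l : Idx n),
      (nMat k (-alphaCZ k) * M) 0 l = 0 := by
    intro M l
    have hk := k.2
    have h0 : ((0 : Idx n) : ℕ) = 0 := rfl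
    rw [nMat_mul, fMat_mul, fMat_mul, h0, if_neg (by omega), if_neg (by omega), if_neg (by omega),
      if_neg (by omega)]
    ring
  rw [quotMat, Matrix.add_apply, Matrix.sub_apply, Matrix.smul_apply, mul_assoc, h, h]
  simp

/-- Up to sign, Aₖ moves the first row one column to the right. At the last k the square of fₖ would
add a term, whence the restriction. -/
theorem quotMat_zero_left {n : ℕ} (k : Fin n) (h : (k : ℕ) + 1 < n) :
    quotMat k 0 ⟨k, by omega⟩ = -z 0 ⟨k + 1, by omega⟩ := by
  have h1 : ¬ (k : ℕ) = 2 * n - k - 1 := by omega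
  have h2 : ¬ (k : ℕ) + 1 = 2 * n - k - 1 := by omega
  rw [quotMat_zero_row, mul_nMat]
  simp only [mul_fMat, if_true, h1, h2, if_false, Nat.succ_ne_self, add_zero, mul_zero]
  rfl

/-- The same movement in the right half of the first row; here the last k is allowed, the step then
starting at the middle column. -/
theorem quotMat_zero_right {n : ℕ} (k : Fin n) :
    quotMat k 0 ⟨2 * n - k - 1, by omega⟩ = -z 0 ⟨2 * n - k, by omega⟩ := by
  have hk := k.2
  have h1 : ¬ 2 * n - (k : ℕ) - 1 = k := by omega
  have h2 : ¬ 2 * n - (k : ℕ) = k := by omega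
  have h3 : ¬ 2 * n - (k : ℕ) = 2 * n - k - 1 := by omega
  rw [quotMat_zero_row, mul_nMat]
  simp only [mul_fMat, if_true, h1, h2, h3, if_false, add_zero, zero_add, mul_zero]
  rfl

/-- Short fₖ do not touch the middle column from the right, so only the left action remains and
moves that column up by one row. -/
theorem quotMat_mid {n : ℕ} (k : Fin n) (h : (k : ℕ) + 1 < n) :
    quotMat k ⟨k + 1, by omega⟩ (Idx.mid n) = z ⟨k, by omega⟩ (Idx.mid n) := by
  have h0 : ((Idx.mid n : Idx n) : ℕ) = n := rfl
  have h1 : ∀ (M : Matrix (Idx n) (Idx n) (CZ n)) (i : Idx n),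
      (M * nMat k (alphaCZ k)) i (Idx.mid n) = 0 := by
    intro M i
    rw [mul_nMat, mul_fMat, mul_fMat, h0, if_neg (by omega), if_neg (by omega), if_neg (by omega),
      if_neg (by omega)]
    ring
  rw [quotMat, Matrix.add_apply, Matrix.sub_apply, Matrix.smul_apply, h1, h1, nMat_mul]
  have h2 : ¬ (k : ℕ) = k + 1 := by omega
  have h3 : ¬ (k : ℕ) + 1 = 2 * n - k := by omega
  have h4 : ¬ (k : ℕ) = 2 * n - k := by omega
  simp only [fMat_mul, if_true, h2, h3, h4, if_false, add_zero, mul_zero, smul_zero, sub_zero]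
  rfl

theorem range_A_succ {n : ℕ} [NeZero n] (k : Fin n) {f : LamHat n} (hf : f ∈ (toLam n).range) :
    NilHecke.A k.succ • f ∈ (toLam n).range := by
  obtain ⟨g, rfl⟩ := hf
  obtain ⟨q, hq⟩ := exists_sub_sigma k g
  exact ⟨q, (A_smul_toLam hq).symm⟩

theorem exists_last (n : ℕ) [NeZero n] : ∃ k : Fin n, (k : ℕ) + 1 = n :=
  ⟨⟨n - 1, by have := NeZero.pos n; omega⟩, by have := NeZero.pos n; simp only; omega⟩

/-- The relation next to the middle, where b = 0 and the diagonal entry is 1. It exhibits (Ω(aₙ|y) -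
1)/aₙ in the image of ℂ[𝒵]. -/
theorem X_smul_toLam_mid {n : ℕ} (k : Fin n) (hk : (k : ℕ) + 1 = n) :
    (X k : S n) • -toLam n (z (Idx.ofFin k) (Idx.mid n)) = Omega (X k) - 1 := by
  have h := bSeq_sub_smul_z (Idx.ofFin k) (Idx.mid n) (by change (k : ℕ) + 1 < _; omega)
    (by change n ≠ 0; omega)
  have e1 : (⟨(Idx.mid n : ℕ) - 1, by change n - 1 < _; omega⟩ : Idx n) = Idx.ofFin k :=
    Fin.ext (by change n - 1 = k; omega)
  have e2 : (⟨(Idx.ofFin k : ℕ) + 1, by change (k : ℕ) + 1 < _; omega⟩ : Idx n) = Idx.mid n :=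
    Fin.ext hk
  have e3 : bSeq (Idx.mid n) = (0 : S n) := by
    rw [bSeq, dif_neg (by change ¬ n < n; omega), dif_neg (by change ¬ n < n; omega)]
  rw [e1, e2, e3, z_mid, bSeq_ofFin, zero_sub] at h
  have h2 := congrArg (toLam n) h
  rw [map_smul, map_sub, map_one, toLam_z_diag] at h2
  rw [← h2, smul_neg, neg_smul]

/-! ### Stability of the image of ℂ[𝒵] under A₀, …, Aₙ -/

/-- A₀(1) is half of (Ω(a₁|y) - 1)/a₁, which is conjugate under W to the element found in the last
middle-column entry. -/
theorem A_zero_one_mem_range {n : ℕ} [NeZero n] :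
    NilHecke.A (0 : Fin (n + 1)) • (1 : LamHat n) ∈ (toLam n).range := by
  obtain ⟨k, hk⟩ := exists_last n
  have hs : ∀ k : Fin n, ∀ f ∈ Subalgebra.toSubmodule (toLam n).range,
      lamAut (sW k) f ∈ Subalgebra.toSubmodule (toLam n).range := by
    rintro k _ ⟨g, rfl⟩
    exact ⟨sigma k g, toLam_sigma k g⟩
  obtain ⟨f, hf, e⟩ := (exists_kappa_iff (Subalgebra.toSubmodule (toLam n).range) hs k 0).mp
    ⟨_, neg_mem ⟨_, rfl⟩, X_smul_toLam_mid k hk⟩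
  obtain ⟨u, hu⟩ := (isUnit_two n).exists_right_inv
  have : NilHecke.A (0 : Fin (n + 1)) • (1 : LamHat n) = u • f := by
    apply smul_LamHat_cancel (toS_theta_ne_zero n)
    rw [theta_smul_A_zero, map_one, mul_one, ← e, toS_theta, smul_smul, mul_right_comm, hu, one_mul]
  rw [this]
  exact Subalgebra.smul_mem _ hf u

theorem range_A {n : ℕ} [NeZero n] (i : Fin (n + 1)) {f : LamHat n} (hf : f ∈ (toLam n).range) :
    NilHecke.A i • f ∈ (toLam n).range := by
  revert i
  refine Fin.cases ?_ fun k => range_A_succ k hf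
  obtain ⟨q, hq, e⟩ := exists_theta_quotient (Subalgebra.toSubmodule (toLam n).range)
    (fun k f hf => range_A_succ k hf) f hf
  have hq' : q ∈ (toLam n).range := hq
  have hth : lamAut (sTheta n) f ∈ (toLam n).range := by
    have h := Subalgebra.smul_mem _ hq' (toS (theta n) : S n)
    rw [e] at h
    have := sub_mem hf h
    rwa [sub_sub_cancel] at this
  -- Inserting ± s_θ(f) in Ω(a₁) s_θ(f) - f splits A₀ f into A₀(1) s_θ(f) and the divided difference
  -- q for θ.
  have : NilHecke.A (0 : Fin (n + 1)) • f = (NilHecke.A (0 : Fin (n + 1)) • (1 : LamHat n)) * lamAut (sTheta n) f - q := by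
    apply smul_LamHat_cancel (toS_theta_ne_zero n)
    rw [theta_smul_A_zero, smul_sub, ← smul_mul_assoc, theta_smul_A_zero, e, map_one]
    ring
  rw [this]
  exact sub_mem (mul_mem A_zero_one_mem_range hth) hq'

theorem cyclicSub_le_range (n : ℕ) [NeZero n] :
    cyclicSub n ≤ Subalgebra.toSubmodule (toLam n).range :=
  cyclicSub_le (one_mem (toLam n).range) fun i _ hf => range_A i hf

/-! ### The entries of Z as elements of 𝔸_af · 1 -/

/-- The lowest entry above the diagonal in the middle column is W-conjugate, up to sign, to 2 A₀(1).
The operators Aₖ then climb that column. -/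
theorem toLam_z_mid_mem {n : ℕ} [NeZero n] (m : ℕ) :
    ∀ k : Fin n, (k : ℕ) + 1 + m = n → toLam n (z (Idx.ofFin k) (Idx.mid n)) ∈ cyclicSub n := by
  induction m with
  | zero =>
    intro k hk
    obtain ⟨f, hf, e⟩ := (exists_kappa_iff (cyclicSub n)
      (fun k f hf => lamAut_mem_cyclicSub _ hf) k 0).mpr ⟨(2 : S n) • (NilHecke.A (0 : Fin (n + 1)) • 1),
        Submodule.smul_mem _ _ (smul_mem_cyclicSub _ (one_mem_cyclicSub n)), by
          rw [smul_smul, mul_comm, ← toS_theta, theta_smul_A_zero, map_one, mul_one]⟩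
    rw [← X_smul_toLam_mid k hk] at e
    have := smul_LamHat_cancel (X_ne_zero k) e
    rw [this] at hf
    simpa using neg_mem hf
  | succ m ih =>
    intro k hk
    have h : (k : ℕ) + 1 < n := by omega
    have h1 := smul_mem_cyclicSub (NilHecke.A k.succ) (ih ⟨k + 1, h⟩ (by simp; omega))
    rw [A_smul_toLam (z_sub_sigma k _ _)] at h1
    have h2 := quotMat_mid k h
    change quotMat k (Idx.ofFin ⟨k + 1, h⟩) (Idx.mid n) = z (Idx.ofFin k) (Idx.mid n) at h2
    rwa [h2] at h1

/-- The first row starts with z₁₁ = t_(ε₁) · 1 and the Aₖ walk along it to the right. The step into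
the middle column is not available this way and is replaced by `toLam_z_mid_mem`. -/
theorem toLam_z_zero_mem {n : ℕ} [NeZero n] (m : ℕ) (hm : m < 2 * n + 1) :
    toLam n (z 0 ⟨m, hm⟩) ∈ cyclicSub n := by
  have hpos := NeZero.pos n
  induction m with
  | zero =>
    have h := toLam_z_diag (0 : Fin n)
    have e : (Idx.ofFin (0 : Fin n) : Idx n) = 0 := rfl
    have e2 : (⟨0, hm⟩ : Idx n) = 0 := rfl
    rw [e] at h
    rw [e2, h]
    have := smul_mem_cyclicSub (NilHecke.ofWaf (transl (eps (0 : Fin n)))) (one_mem_cyclicSub n)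
    rwa [NilHecke.transl_smul, mul_one] at this
  | succ m ih =>
    have h1 := ih (by omega)
    rcases lt_trichotomy (m + 1) n with h | h | h
    · have h2 := smul_mem_cyclicSub (NilHecke.A (⟨m, by omega⟩ : Fin n).succ) h1
      rw [A_smul_toLam (z_sub_sigma _ _ _)] at h2
      have h3 := quotMat_zero_left (⟨m, by omega⟩ : Fin n) h
      simp only at h3
      rw [h3, map_neg] at h2
      simpa using neg_mem h2
    · have h2 := toLam_z_mid_mem (n - 1) (0 : Fin n) (by simp only [Fin.val_zero]; omega)
      have e : (⟨m + 1, hm⟩ : Idx n) = Idx.mid n := Fin.ext h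
      rw [e]
      exact h2
    -- This k is the one whose right-hand matrix unit links the columns m and m + 1.
    · set k : Fin n := ⟨2 * n - m - 1, by omega⟩ with hk
      have h2 := smul_mem_cyclicSub (NilHecke.A k.succ) h1
      rw [A_smul_toLam (z_sub_sigma _ _ _)] at h2
      have h3 := quotMat_zero_right k
      have e1 : (⟨2 * n - k - 1, by omega⟩ : Idx n) = ⟨m, by omega⟩ :=
        Fin.ext (by simp only [hk]; omega)
      have e2 : (⟨2 * n - k, by omega⟩ : Idx n) = ⟨m + 1, hm⟩ :=
        Fin.ext (by simp only [hk]; omega)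
      rw [e1, e2] at h3
      rw [h3, map_neg] at h2
      simpa using neg_mem h2

/-- The relation Z L₀ = L₀ Z gives row i + 1 as a polynomial combination of row i, without division.
-/
theorem toLam_z_mem {n : ℕ} [NeZero n] (i : ℕ) (hi : i < 2 * n + 1) :
    ∀ j : Idx n, toLam n (z ⟨i, hi⟩ j) ∈ cyclicSub n := by
  induction i with
  | zero => intro j; exact toLam_z_zero_mem j j.2
  | succ i ih =>
    intro j
    have h1 := ih (by omega)
    by_cases hj : (j : ℕ) = 0
    · rw [z_upper (by rw [Fin.lt_def, hj]; simp), map_zero]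
      exact zero_mem _
    · have h := bSeq_sub_smul_z (⟨i, by omega⟩ : Idx n) j hi hj
      rw [eq_sub_iff_add_eq', ← eq_sub_iff_add_eq] at h
      rw [h, map_sub, map_smul]
      exact sub_mem (h1 _) (Submodule.smul_mem _ _ (h1 _))

theorem range_eq_cyclicSubalgebra (n : ℕ) [NeZero n] : (toLam n).range = cyclicSubalgebra n := by
  apply le_antisymm
  · rintro _ ⟨f, rfl⟩
    change toLam n f ∈ cyclicSubalgebra n
    induction f using CZ.induction with
    | halg r => rw [AlgHom.commutes]; exact Subalgebra.algebraMap_mem _ r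
    | hz i j => exact toLam_z_mem i i.2 j
    | hadd f g hf hg => rw [map_add]; exact add_mem hf hg
    | hmul f g hf hg => rw [map_mul]; exact mul_mem hf hg
  · exact cyclicSub_le_range n

/-! ### Braid relations for divided differences -/

section DividedDifferences

variable {R V : Type*} [CommRing R] [AddCommGroup V] [Module R V] {s t : V →+ V} {σ τ : R → R}
  {A B : V → V} {α β : R}

/-- Multiplied by the product of the positive roots, the longest composite of a rank two system
becomes the alternating sum over its Weyl group. That sum is symmetric in s and t once these satisfy
the braid relation. This is the case A₁ × A₁. -/
theorem dividedDifference_two (hs : ∀ (p : R) f, s (p • f) = σ p • s f)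
    (hA : ∀ f, α • A f = f - s f) (hB : ∀ f, β • B f = f - t f) (h1 : σ β = β) (f : V) :
    (α * β) • A (B f) = f - s f - t f + s (t f) := by
  have e1 := hA (B f)
  have e2 := hB f
  have e3 := congrArg s e2
  rw [hs, h1, map_sub] at e3
  linear_combination (norm := module) β • e1 + e2 - e3

/-- Both f - s(f) and α change sign under s, so their quotient is invariant. -/
theorem dividedDifference_invariant
    (hcancel : ∀ (p : R) (f g : V), p ≠ 0 → p • f = p • g → f = g)
    (hs : ∀ (p : R) f, s (p • f) = σ p • s f)
    (hss : ∀ f, s (s f) = f) (hA : ∀ f, α • A f = f - s f) (hα : α ≠ 0) (h1 : σ α = -α) (f : V) :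
    s (A f) = A f := by
  refine hcancel α _ _ hα ?_
  have e := congrArg s (hA f)
  rw [hs, h1, map_sub, hss] at e
  rw [hA]
  linear_combination (norm := module) -e

/-- The case A₂: invariance of A f under s removes the repeated term, and six signed terms remain.
-/
theorem dividedDifference_three
    (hcancel : ∀ (p : R) (f g : V), p ≠ 0 → p • f = p • g → f = g)
    (hs : ∀ (p : R) f, s (p • f) = σ p • s f)
    (ht : ∀ (p : R) f, t (p • f) = τ p • t f)
    (hss : ∀ f, s (s f) = f) (hA : ∀ f, α • A f = f - s f) (hB : ∀ f, β • B f = f - t f)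
    (hα : α ≠ 0) (h1 : σ α = -α) (h2 : σ β = β + α) (h3 : τ α = α + β) (h4 : σ (α + β) = β)
    (f : V) :
    (α * β * (α + β)) • A (B (A f)) =
      f - s f - t f + t (s f) + s (t f) - s (t (s f)) := by
  have e0 := dividedDifference_invariant hcancel hs hss hA hα h1 f
  have e1 := hA (B (A f))
  have e2 := hB (A f)
  have e3 := congrArg s e2
  rw [hs, h2, map_sub, e0] at e3
  have e4 := hA f
  have e5 := congrArg t e4
  rw [ht, h3, map_sub] at e5
  have e6 := congrArg s e5
  rw [hs, h4, map_sub] at e6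
  linear_combination (norm := module) (β * (α + β)) • e1 + (α + β) • e2 - β • e3 + e4 - e5 + e6

/-- The case C₂. The parameters x and y are the negatives of the Cartan integers; only xy = 2 is
used, so the longer root may be either one. -/
theorem dividedDifference_four
    (hcancel : ∀ (p : R) (f g : V), p ≠ 0 → p • f = p • g → f = g)
    {x y : R} (hxy : x * y = 2)
    (hs : ∀ (p : R) f, s (p • f) = σ p • s f) (ht : ∀ (p : R) f, t (p • f) = τ p • t f)
    (hss : ∀ f, s (s f) = f) (htt : ∀ f, t (t f) = f)
    (hA : ∀ f, α • A f = f - s f) (hB : ∀ f, β • B f = f - t f)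
    (hα : α ≠ 0) (hβ : β ≠ 0) (h1 : σ α = -α) (h2 : σ β = β + x * α) (h3 : τ α = α + y * β)
    (h4 : σ (α + y * β) = α + y * β) (h5 : τ (β + x * α) = β + x * α) (h6 : τ (α + y * β) = α)
    (h7 : τ β = -β) (h8 : τ (α * β * (β + x * α)) = -(α + y * β) * β * (β + x * α))
    (h9 : τ (x * α) = x * (α + y * β))
    (f : V) :
    (α * β * (α + y * β) * (β + x * α)) • B (A (B (A f))) =
      f - s f - t f + t (s f) + s (t f) - s (t (s f)) - t (s (t f)) + t (s (t (s f))) := by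
  have e0 := dividedDifference_invariant hcancel hs hss hA hα h1 f
  have e1 := hA (B (A f))
  have e2 := hB (A f)
  have e3 := congrArg s e2
  rw [hs, h2, map_sub, e0] at e3
  have k1 : (α * β * (β + x * α)) • A (B (A f)) =
      (x * α) • A f - (β + x * α) • t (A f) + β • s (t (A f)) := by
    linear_combination (norm := module) (β * (β + x * α)) • e1 + (β + x * α) • e2 - β • e3
  have k2 := congrArg t k1
  rw [ht, h8, map_add, map_sub, ht, ht, ht, h9, h5, h7, htt] at k2
  have e4 := hA f
  have e5 := congrArg t e4
  rw [ht, h3, map_sub] at e5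
  have e6 := congrArg s e5
  rw [hs, h4, map_sub] at e6
  have e7 := congrArg t e6
  rw [ht, h6, map_sub] at e7
  have e8 := hB (A (B (A f)))
  refine hcancel β _ _ hβ ?_
  -- The relation xy = 2 enters here. It makes the surplus coefficient of A f a multiple of β, which
  -- is why an extra factor β is carried and cancelled.
  have hc : x * (α + y * β) - (β + x * α) = β := by linear_combination β * hxy
  have k3 : (β * (α * β * (α + y * β) * (β + x * α))) • B (A (B (A f))) =
      (β * α) • A f - (β * (α + y * β)) • t (A f) + (β * (α + y * β)) • s (t (A f))
        - (β * α) • t (s (t (A f))) := by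
    have hc2 : (α * (x * (α + y * β) - (β + x * α))) • A f = (α * β) • A f := by rw [hc]
    linear_combination (norm := module) (α * β * (α + y * β) * (β + x * α)) • e8 + (α + y * β) • k1
      + α • k2 + hc2
  linear_combination (norm := module) k3 + β • e4 - β • e5 + β • e6 - β • e7

end DividedDifferences

/-! ### Affine simple reflections -/

/-- The level zero projections of the affine simple coroots. -/
def corootAf {n : ℕ} [NeZero n] (i : Fin (n + 1)) : QDual n := Fin.cases (-eps 0) simpleCoroot i

/-- The affine simple root `αᵢ` as an affine function on `Q^∨`. -/
def affineRoot {n : ℕ} [NeZero n] (i : Fin (n + 1)) (x : QDual n) : ℤ :=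
  (if i = 0 then 1 else 0) + x (alphaAf i)

/-- The action of the simple reflection `sᵢ` on `Q^∨`. -/
def affineReflection {n : ℕ} [NeZero n] (i : Fin (n + 1)) (x : QDual n) : QDual n :=
  x - affineRoot i x • corootAf i

theorem corootAf_alphaAf_self {n : ℕ} [NeZero n] (i : Fin (n + 1)) :
    corootAf i (alphaAf i) = 2 := by
  refine Fin.cases ?_ (fun k => ?_) i
  · simp [corootAf, alphaAf, theta, eps]
  · exact simpleCoroot_simpleRoot k

theorem sAf_right_apply {n : ℕ} [NeZero n] (i : Fin (n + 1)) (v : P n) :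
    (sAf i : Waf n).right.1 v = v - corootAf i v • alphaAf i := by
  refine Fin.cases ?_ (fun k => ?_) i
  · have h : (sAf 0 : Waf n).right = sTheta n := by simp [sAf, transl]
    rw [h, sTheta_apply]
    simp [corootAf, alphaAf]
  · exact Module.reflection_apply _ (simpleCoroot_simpleRoot k)

theorem sAf_right_smul_toS {n : ℕ} [NeZero n] (i j : Fin (n + 1)) :
    (sAf i : Waf n).right • (toS (alphaAf j) : S n) =
      toS (alphaAf j) - (corootAf i (alphaAf j) : S n) * toS (alphaAf i) := by
  rw [smul_toS, sAf_right_apply, map_sub, map_zsmul, zsmul_eq_mul]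

theorem affineRoot_sub_smul {n : ℕ} [NeZero n] (i j : Fin (n + 1)) (x : QDual n) (c : ℤ) :
    affineRoot i (x - c • corootAf j) = affineRoot i x - c * corootAf j (alphaAf i) := by
  simp [affineRoot]; ring

theorem affineRoot_reflection {n : ℕ} [NeZero n] (i j : Fin (n + 1)) (x : QDual n) :
    affineRoot i (affineReflection j x) = affineRoot i x - affineRoot j x * corootAf j (alphaAf i) :=
  affineRoot_sub_smul i j x _

theorem affineRoot_reflection_self {n : ℕ} [NeZero n] (i : Fin (n + 1)) (x : QDual n) :
    affineRoot i (affineReflection i x) = -affineRoot i x := by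
  rw [affineRoot_reflection, corootAf_alphaAf_self]; ring

theorem affineReflection_self {n : ℕ} [NeZero n] (i : Fin (n + 1)) (x : QDual n) :
    affineReflection i (affineReflection i x) = x := by
  rw [affineReflection, affineRoot_reflection_self, affineReflection]; module

theorem affineReflection_two {n : ℕ} [NeZero n] {i j : Fin (n + 1)}
    (h1 : corootAf i (alphaAf j) = 0) (h2 : corootAf j (alphaAf i) = 0) (x : QDual n) :
    affineReflection i (affineReflection j x) = affineReflection j (affineReflection i x) := by
  simp only [affineReflection, affineRoot_sub_smul, h1, h2]; module

theorem affineReflection_three {n : ℕ} [NeZero n] {i j : Fin (n + 1)}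
    (h1 : corootAf i (alphaAf j) = -1) (h2 : corootAf j (alphaAf i) = -1) (x : QDual n) :
    affineReflection i (affineReflection j (affineReflection i x)) =
      affineReflection j (affineReflection i (affineReflection j x)) := by
  simp only [affineReflection, affineRoot_sub_smul, h1, h2, corootAf_alphaAf_self]; module

theorem affineReflection_four {n : ℕ} [NeZero n] {i j : Fin (n + 1)}
    (h : corootAf i (alphaAf j) * corootAf j (alphaAf i) = 2) (x : QDual n) :
    affineReflection i (affineReflection j (affineReflection i (affineReflection j x))) =
      affineReflection j (affineReflection i (affineReflection j (affineReflection i x))) := by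
  simp only [affineReflection, affineRoot_sub_smul, corootAf_alphaAf_self]
  generalize affineRoot i x = a
  generalize affineRoot j x = b
  generalize corootAf i (alphaAf j) = c at *
  generalize corootAf j (alphaAf i) = d at *
  match_scalars
  · ring
  · linear_combination -a * c * h
  · linear_combination b * d * h

/-- Left multiplication by `sᵢ` on the translation parts of elements of `W_af`. -/
theorem left_sAf_mul {n : ℕ} [NeZero n] (i : Fin (n + 1)) (x : Waf n) :
    (sAf i * x).left.toAdd = affineReflection i x.left.toAdd := by
  have key : ∀ w : W n, w * w = 1 → ∀ v, w.1.symm v = w.1 v := by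
    intro w hw v
    rw [LinearEquiv.symm_apply_eq, ← LinearEquiv.mul_apply]
    exact (LinearEquiv.congr_fun (congrArg Subtype.val hw) v).symm
  have hr : (sAf i : Waf n).right * (sAf i : Waf n).right = 1 := by
    rw [← SemidirectProduct.mul_right, sAf_mul_self]; rfl
  refine LinearMap.ext fun v => ?_
  have h1 : (sAf i * x).left.toAdd v =
      (sAf i : Waf n).left.toAdd v + x.left.toAdd ((sAf i : Waf n).right.1.symm v) := rfl
  rw [h1, key _ hr, sAf_right_apply, affineReflection, affineRoot]
  have h2 : (sAf i : Waf n).left.toAdd = -((if i = 0 then 1 else 0 : ℤ) • corootAf i) := by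
    refine Fin.cases ?_ (fun k => ?_) i
    · simp [corootAf, sAf, transl]
    · simp [sAf]
  rw [h2]
  simp only [LinearMap.neg_apply, LinearMap.sub_apply, LinearMap.smul_apply, map_sub, map_zsmul,
    smul_eq_mul]
  ring

/-- W_af acts faithfully on Q^∨: z = 1 compares the translation parts and z = t_(ε_l) the linear
parts. Braid relations in W_af are thereby read off from the affine reflections. -/
theorem Waf.ext_of_left {n : ℕ} {x y : Waf n}
    (h : ∀ z : Waf n, (x * z).left.toAdd = (y * z).left.toAdd) : x = y := by
  have h1 : x.left = y.left := by simpa using h 1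
  refine SemidirectProduct.ext h1 (inv_injective ?_)
  apply Subtype.ext
  ext v : 1
  funext l
  have h2 := LinearMap.congr_fun (h (transl (eps l))) v
  have h3 : ∀ w : Waf n, (w * transl (eps l)).left.toAdd v =
    w.left.toAdd v + eps l (w.right.1.symm v) := fun _ => rfl
  rw [h3, h3, h1] at h2
  exact add_left_cancel h2

theorem smul_intCast {n : ℕ} (w : W n) (c : ℤ) : w • (c : S n) = c :=
  map_intCast (MulSemiringAction.toRingHom (W n) (S n) w) c

/-! ### Braid relations -/

section Braid

variable {n : ℕ} [NeZero n] {i j : Fin (n + 1)}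

theorem sAf_braid_two (h1 : corootAf i (alphaAf j) = 0) (h2 : corootAf j (alphaAf i) = 0) :
    (sAf i * sAf j : Waf n) = sAf j * sAf i :=
  Waf.ext_of_left fun z => by simp only [mul_assoc, left_sAf_mul, affineReflection_two h1 h2]

theorem sAf_braid_three (h1 : corootAf i (alphaAf j) = -1) (h2 : corootAf j (alphaAf i) = -1) :
    (sAf i * (sAf j * sAf i) : Waf n) = sAf j * (sAf i * sAf j) :=
  Waf.ext_of_left fun z => by
    simp only [mul_assoc, left_sAf_mul]
    exact affineReflection_three h1 h2 _

theorem sAf_braid_four (h : corootAf i (alphaAf j) * corootAf j (alphaAf i) = 2) :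
    (sAf i * (sAf j * (sAf i * sAf j)) : Waf n) = sAf j * (sAf i * (sAf j * sAf i)) :=
  Waf.ext_of_left fun z => by
    simp only [mul_assoc, left_sAf_mul]
    exact affineReflection_four h _

/-- The action of `sᵢ` on `Λ̂_S`. -/
def actAf (i : Fin (n + 1)) : LamHat n →+ LamHat n :=
  DistribSMul.toAddMonoidHom (LamHat n) (NilHecke.ofWaf (sAf i))

theorem actAf_apply (i : Fin (n + 1)) (f : LamHat n) : actAf i f = NilHecke.ofWaf (sAf i) • f := rfl

theorem actAf_actAf (i : Fin (n + 1)) (f : LamHat n) : actAf i (actAf i f) = f := by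
  rw [actAf_apply, actAf_apply, ← mul_smul, ← ofWaf_mul, sAf_mul_self, ofWaf_one, one_smul]

theorem actAf_smul (i : Fin (n + 1)) (p : S n) (f : LamHat n) :
    actAf i (p • f) = ((sAf i : Waf n).right • p) • actAf i f := ofWaf_smul_smul i p f

theorem alphaAf_smul_A_eq (i : Fin (n + 1)) (f : LamHat n) :
    (toS (alphaAf i) : S n) • (NilHecke.A i • f) = f - actAf i f := alphaAf_smul_A i f

theorem sAf_right_smul_self (i : Fin (n + 1)) :
    (sAf i : Waf n).right • (toS (alphaAf i) : S n) = -toS (alphaAf i) := by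
  rw [sAf_right_smul_toS, corootAf_alphaAf_self]; push_cast; ring

theorem A_smul_A_self (i : Fin (n + 1)) (f : LamHat n) :
    NilHecke.A i • (NilHecke.A i • f) = 0 := by
  refine smul_LamHat_cancel (toS_alphaAf_ne_zero i) ?_
  rw [alphaAf_smul_A_eq, smul_zero, sub_eq_zero]
  exact (dividedDifference_invariant (fun p f g hp => smul_LamHat_cancel hp) (actAf_smul i)
    (actAf_actAf i) (alphaAf_smul_A_eq i) (toS_alphaAf_ne_zero i) (sAf_right_smul_self i) f).symm

/-- As in the two lemmas that follow, both composites become the same alternating sum after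
multiplication by the product of the positive roots, which is cancellable. -/
theorem A_braid_two (h1 : corootAf i (alphaAf j) = 0) (h2 : corootAf j (alphaAf i) = 0)
    (f : LamHat n) :
    NilHecke.A i • NilHecke.A j • f = NilHecke.A j • NilHecke.A i • f := by
  have e1 : (sAf i : Waf n).right • (toS (alphaAf j) : S n) = toS (alphaAf j) := by
    rw [sAf_right_smul_toS, h1]; push_cast; ring
  have e2 : (sAf j : Waf n).right • (toS (alphaAf i) : S n) = toS (alphaAf i) := by
    rw [sAf_right_smul_toS, h2]; push_cast; ring
  have hb : actAf i (actAf j f) = actAf j (actAf i f) := by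
    simp only [actAf_apply, ← mul_smul, ← ofWaf_mul, sAf_braid_two h1 h2]
  refine smul_LamHat_cancel (mul_ne_zero (toS_alphaAf_ne_zero i) (toS_alphaAf_ne_zero j)) ?_
  rw [dividedDifference_two (actAf_smul i) (alphaAf_smul_A_eq i) (alphaAf_smul_A_eq j) e1, mul_comm,
    dividedDifference_two (actAf_smul j) (alphaAf_smul_A_eq j) (alphaAf_smul_A_eq i) e2, hb]
  abel

theorem A_braid_three (h1 : corootAf i (alphaAf j) = -1) (h2 : corootAf j (alphaAf i) = -1)
    (f : LamHat n) :
    NilHecke.A i • NilHecke.A j • NilHecke.A i • f =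
      NilHecke.A j • NilHecke.A i • NilHecke.A j • f := by
  have e1 : (sAf i : Waf n).right • (toS (alphaAf j) : S n) = toS (alphaAf j) + toS (alphaAf i) := by
    rw [sAf_right_smul_toS, h1]; push_cast; ring
  have e2 : (sAf j : Waf n).right • (toS (alphaAf i) : S n) = toS (alphaAf i) + toS (alphaAf j) := by
    rw [sAf_right_smul_toS, h2]; push_cast; ring
  have e3 : (sAf i : Waf n).right • (toS (alphaAf i) + toS (alphaAf j) : S n) = toS (alphaAf j) := by
    rw [smul_add, e1, sAf_right_smul_self]; ring
  have e4 : (sAf j : Waf n).right • (toS (alphaAf j) + toS (alphaAf i) : S n) = toS (alphaAf i) := by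
    rw [smul_add, e2, sAf_right_smul_self]; ring
  have hb : actAf i (actAf j (actAf i f)) = actAf j (actAf i (actAf j f)) := by
    simp only [actAf_apply, ← mul_smul, ← ofWaf_mul, sAf_braid_three h1 h2]
  -- The sum is the image of αⱼ under sᵢ.
  have hne : (toS (alphaAf j) + toS (alphaAf i) : S n) ≠ 0 := by
    rw [← e1]
    exact fun e => toS_alphaAf_ne_zero j ((smul_eq_zero_iff_eq _).mp e)
  refine smul_LamHat_cancel (mul_ne_zero (mul_ne_zero (toS_alphaAf_ne_zero i)
    (toS_alphaAf_ne_zero j)) (add_comm (toS (alphaAf j)) _ ▸ hne)) ?_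
  have c1 := dividedDifference_three (fun p f g hp => smul_LamHat_cancel hp) (actAf_smul i)
    (actAf_smul j) (actAf_actAf i) (alphaAf_smul_A_eq i) (alphaAf_smul_A_eq j)
    (toS_alphaAf_ne_zero i) (sAf_right_smul_self i) e1 e2 e3 f
  have c2 := dividedDifference_three (fun p f g hp => smul_LamHat_cancel hp) (actAf_smul j)
    (actAf_smul i) (actAf_actAf j) (alphaAf_smul_A_eq j) (alphaAf_smul_A_eq i)
    (toS_alphaAf_ne_zero j) (sAf_right_smul_self j) e2 e1 e4 f
  have hc : (toS (alphaAf i) * toS (alphaAf j) * (toS (alphaAf i) + toS (alphaAf j)) : S n) =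
    toS (alphaAf j) * toS (alphaAf i) * (toS (alphaAf j) + toS (alphaAf i)) := by ring
  rw [c1, hc, c2, hb]
  abel

theorem A_braid_four (h : corootAf i (alphaAf j) * corootAf j (alphaAf i) = 2) (f : LamHat n) :
    NilHecke.A i • NilHecke.A j • NilHecke.A i • NilHecke.A j • f =
      NilHecke.A j • NilHecke.A i • NilHecke.A j • NilHecke.A i • f := by
  -- The expansion is proved for an ordered pair and used for both orders; its first half says that
  -- the third and fourth positive roots are nonzero.
  have main : ∀ {i j : Fin (n + 1)}, corootAf i (alphaAf j) * corootAf j (alphaAf i) = 2 →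
      (toS (alphaAf j) - (corootAf i (alphaAf j) : S n) * toS (alphaAf i) : S n) ≠ 0 ∧
      (toS (alphaAf i) * toS (alphaAf j) *
        (toS (alphaAf i) - (corootAf j (alphaAf i) : S n) * toS (alphaAf j)) *
        (toS (alphaAf j) - (corootAf i (alphaAf j) : S n) * toS (alphaAf i))) •
          (NilHecke.A j • NilHecke.A i • NilHecke.A j • NilHecke.A i • f) =
      f - actAf i f - actAf j f + actAf j (actAf i f) + actAf i (actAf j f) -
        actAf i (actAf j (actAf i f)) - actAf j (actAf i (actAf j f)) +
        actAf j (actAf i (actAf j (actAf i f))) := by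
    intro i j h
    have e1 := sAf_right_smul_toS (n := n) i j
    have e2 := sAf_right_smul_toS (n := n) j i
    have hc : (corootAf i (alphaAf j) : S n) * (corootAf j (alphaAf i) : S n) = 2 := by
      exact_mod_cast congrArg (Int.cast : ℤ → S n) h
    refine ⟨?_, ?_⟩
    · rw [← e1]
      exact fun e => toS_alphaAf_ne_zero j ((smul_eq_zero_iff_eq _).mp e)
    have d1 := sAf_right_smul_self (n := n) i
    have d2 := sAf_right_smul_self (n := n) j
    set a : S n := toS (alphaAf i)
    set b : S n := toS (alphaAf j)
    set c : S n := (corootAf i (alphaAf j) : S n) with hc1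
    set d : S n := (corootAf j (alphaAf i) : S n) with hd1
    have c1 : ∀ w : W n, w • c = c := fun w => smul_intCast w _
    have c2 : ∀ w : W n, w • d = d := fun w => smul_intCast w _
    have := dividedDifference_four (x := -c) (y := -d) (fun p f g hp => smul_LamHat_cancel hp)
      (by linear_combination hc) (actAf_smul i)
      (actAf_smul j) (actAf_actAf i) (actAf_actAf j) (alphaAf_smul_A_eq i) (alphaAf_smul_A_eq j)
      (toS_alphaAf_ne_zero i) (toS_alphaAf_ne_zero j) (sAf_right_smul_self i)
      (by rw [e1]; ring) (by rw [e2]; ring)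
      (by rw [smul_add, smul_mul', smul_neg, c2, e1, d1]; linear_combination a * hc)
      (by rw [smul_add, smul_mul', smul_neg, c1, e2, d2]; linear_combination b * hc)
      (by rw [smul_add, smul_mul', smul_neg, c2, e2, d2]; ring) d2
      (by rw [smul_mul', smul_mul', smul_add, smul_mul', smul_neg, c1, e2, d2]
          linear_combination -(a - d * b) * b * b * hc)
      (by rw [smul_mul', smul_neg, c1, e2]; ring) f
    have hco : a * b * (a - d * b) * (b - c * a) = a * b * (a + -d * b) * (b + -c * a) := by ring
    rw [hco]
    exact this
  obtain ⟨n1, m1⟩ := main h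
  obtain ⟨n2, m2⟩ := main (i := j) (j := i) (by rw [mul_comm]; exact h)
  have hb : actAf i (actAf j (actAf i (actAf j f))) = actAf j (actAf i (actAf j (actAf i f))) := by
    simp only [actAf_apply, ← mul_smul, ← ofWaf_mul, sAf_braid_four h]
  refine smul_LamHat_cancel (mul_ne_zero (mul_ne_zero (mul_ne_zero (toS_alphaAf_ne_zero j)
    (toS_alphaAf_ne_zero i)) n1) n2) ?_
  have hcomm : ∀ a b c d : S n, a * b * c * d = b * a * d * c := fun a b c d => by ring
  refine m2.trans (Eq.trans ?_ (m1.symm.trans (congrArg (· • _) (hcomm _ _ _ _))))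
  rw [hb]
  abel

end Braid

/-! ### Rank two subsystems -/

theorem simpleRoot_of_lt {n : ℕ} (k : Fin n) (h : (k : ℕ) + 1 < n) :
    simpleRoot k = (Pi.single k 1 - Pi.single ⟨k + 1, h⟩ 1 : P n) := dif_pos h

theorem simpleRoot_of_not_lt {n : ℕ} (k : Fin n) (h : ¬ (k : ℕ) + 1 < n) :
    simpleRoot k = (Pi.single k 2 : P n) := dif_neg h

theorem simpleCoroot_apply_of_lt {n : ℕ} (k : Fin n) (h : (k : ℕ) + 1 < n) (v : P n) :
    simpleCoroot k v = v k - v ⟨k + 1, h⟩ := by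
  rw [simpleCoroot, dif_pos h]; rfl

theorem simpleCoroot_apply_of_not_lt {n : ℕ} (k : Fin n) (h : ¬ (k : ℕ) + 1 < n) (v : P n) :
    simpleCoroot k v = v k := by
  rw [simpleCoroot, dif_neg h]; rfl

/-- The pairs of Cartan integers `(a, b)` of types `A₁ × A₁`, `A₂` and `C₂`. -/
def IsFiniteCartan (a b : ℤ) : Prop :=
  (a = 0 ∧ b = 0) ∨ (a = -1 ∧ b = -1) ∨ (a * b = 2 ∧ a < 0 ∧ b < 0)

theorem IsFiniteCartan.symm {a b : ℤ} (h : IsFiniteCartan a b) : IsFiniteCartan b a := by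
  rcases h with h | h | h
  · exact Or.inl ⟨h.2, h.1⟩
  · exact Or.inr (Or.inl ⟨h.2, h.1⟩)
  · exact Or.inr (Or.inr ⟨mul_comm a b ▸ h.1, h.2.2, h.2.1⟩)

theorem isFiniteCartan_simple {n : ℕ} {k l : Fin n} (h : k < l) :
    IsFiniteCartan (simpleCoroot k (simpleRoot l)) (simpleCoroot l (simpleRoot k)) := by
  have hk : (k : ℕ) + 1 < n := by have := l.2; have : (k : ℕ) < l := h; omega
  have hkl : (k : ℕ) < l := h
  by_cases hl : (l : ℕ) + 1 < n
  · rw [simpleCoroot_apply_of_lt k hk, simpleCoroot_apply_of_lt l hl, simpleRoot_of_lt k hk,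
      simpleRoot_of_lt l hl]
    simp only [Pi.sub_apply, Pi.single_apply, Fin.ext_iff]
    by_cases e : (l : ℕ) = k + 1
    · right; left
      constructor <;> split_ifs <;> omega
    · left
      constructor <;> split_ifs <;> omega
  · rw [simpleCoroot_apply_of_lt k hk, simpleCoroot_apply_of_not_lt l hl, simpleRoot_of_lt k hk,
      simpleRoot_of_not_lt l hl]
    simp only [Pi.sub_apply, Pi.single_apply, Fin.ext_iff]
    by_cases e : (l : ℕ) = k + 1
    · right; right
      refine ⟨?_, ?_, ?_⟩ <;> split_ifs <;> omega
    · left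
      constructor <;> split_ifs <;> omega

/-- For n = 1 the reflections s₀ and s₁ generate an infinite dihedral group with no braid relation,
so that case is excluded. -/
theorem isFiniteCartan_zero {n : ℕ} [NeZero n] (hn : 1 < n) (k : Fin n) :
    IsFiniteCartan (corootAf (0 : Fin (n + 1)) (alphaAf k.succ))
      (corootAf k.succ (alphaAf (0 : Fin (n + 1)))) := by
  have h1 : corootAf (0 : Fin (n + 1)) (alphaAf k.succ) = -(simpleRoot k 0) := rfl
  have h2 : corootAf k.succ (alphaAf (0 : Fin (n + 1))) = -simpleCoroot k (theta n) := by
    change simpleCoroot k (-theta n) = _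
    rw [map_neg]
  rw [h1, h2, theta]
  by_cases hk : (k : ℕ) + 1 < n
  · rw [simpleRoot_of_lt k hk, simpleCoroot_apply_of_lt k hk]
    simp only [Pi.sub_apply, Pi.single_apply, Fin.ext_iff, Fin.val_zero]
    by_cases e : (k : ℕ) = 0
    · right; right
      simp [e]
    · left
      simp [e, Ne.symm e]
  · rw [simpleRoot_of_not_lt k hk, simpleCoroot_apply_of_not_lt k hk]
    simp only [Pi.single_apply, Fin.ext_iff, Fin.val_zero]
    have e : (k : ℕ) ≠ 0 := by omega
    left
    simp [e, e.symm]

theorem affineRoot_zero_apply {n : ℕ} [NeZero n] (x : QDual n) :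
    affineRoot (0 : Fin (n + 1)) x = 1 - 2 * x (Pi.single 0 1) := by
  have h : (alphaAf (0 : Fin (n + 1)) : P n) = (-2 : ℤ) • Pi.single 0 1 := by
    change -theta n = _
    rw [theta]
    ext l
    by_cases hl : l = 0 <;> simp [hl]
  rw [affineRoot, h, map_zsmul]
  simp
  ring

theorem affineRoot_succ_of_lt {n : ℕ} [NeZero n] (k : Fin n) (h : (k : ℕ) + 1 < n) (x : QDual n) :
    affineRoot k.succ x = x (Pi.single k 1) - x (Pi.single ⟨k + 1, h⟩ 1) := by
  rw [affineRoot, if_neg (Fin.succ_ne_zero k), zero_add, ← map_sub, ← simpleRoot_of_lt k h]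
  rfl

theorem affineRoot_succ_of_not_lt {n : ℕ} [NeZero n] (k : Fin n) (h : ¬ (k : ℕ) + 1 < n)
    (x : QDual n) : affineRoot k.succ x = 2 * x (Pi.single k 1) := by
  have h2 : (Pi.single k 2 : P n) = (2 : ℤ) • Pi.single k 1 := by
    ext l; simp [Pi.single_apply]
  rw [affineRoot, if_neg (Fin.succ_ne_zero k), zero_add]
  change x (simpleRoot k) = _
  rw [simpleRoot_of_not_lt k h, h2, map_zsmul, smul_eq_mul]

/-- For n = 1 the two affine simple roots add up to the constant 1, so they are never both
nonpositive. For n > 1 every pair is of finite type. -/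
theorem isFiniteCartan_of_nonpos {n : ℕ} [NeZero n] {i j : Fin (n + 1)} (hij : i ≠ j) {x : QDual n}
    (hi : affineRoot i x ≤ 0) (hj : affineRoot j x ≤ 0) :
    IsFiniteCartan (corootAf i (alphaAf j)) (corootAf j (alphaAf i)) := by
  have h0 : ∀ k : Fin n, affineRoot (0 : Fin (n + 1)) x ≤ 0 → affineRoot k.succ x ≤ 0 → 1 < n := by
    intro k h1 h2
    by_contra hn
    have hn1 : n = 1 := by have := NeZero.pos n; omega
    have hk : k = 0 := by apply Fin.ext; have := k.2; simp only [Fin.val_zero]; omega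
    rw [affineRoot_zero_apply] at h1
    rw [affineRoot_succ_of_not_lt k (by have := k.2; omega), hk] at h2
    omega
  rcases Fin.eq_zero_or_eq_succ i with rfl | ⟨k, rfl⟩ <;>
    rcases Fin.eq_zero_or_eq_succ j with rfl | ⟨l, rfl⟩
  · exact absurd rfl hij
  · exact isFiniteCartan_zero (h0 l hi hj) l
  · exact (isFiniteCartan_zero (h0 k hj hi) k).symm
  · rcases lt_trichotomy k l with h | h | h
    · exact isFiniteCartan_simple h
    · exact absurd (congrArg Fin.succ h) hij
    · exact (isFiniteCartan_simple h).symm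

/-- An element of `Q^∨` other than `0` lies on the negative side of an affine simple root. -/
theorem exists_affineRoot_neg {n : ℕ} [NeZero n] {x : QDual n} (hx : x ≠ 0) :
    ∃ i : Fin (n + 1), affineRoot i x < 0 := by
  by_contra! h
  apply hx
  -- If no root is negative then 1/2 ≥ x₁ ≥ … ≥ xₙ ≥ 0, and integrality forces x₁ ≤ 0.
  have h0 : x (Pi.single 0 1) ≤ 0 := by
    have := h 0
    rw [affineRoot_zero_apply] at this
    omega
  have hle : ∀ (m : ℕ) (hm : m < n), x (Pi.single ⟨m, hm⟩ 1) ≤ 0 := by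
    intro m
    induction m with
    | zero => intro hm; exact h0
    | succ m ih =>
      intro hm
      have := h (Fin.succ ⟨m, by omega⟩)
      rw [affineRoot_succ_of_lt ⟨m, by omega⟩ hm] at this
      have := ih (by omega)
      simp only [] at *
      omega
  have hge : ∀ (m : ℕ) (k : Fin n), (k : ℕ) + 1 + m = n → 0 ≤ x (Pi.single k 1) := by
    intro m
    induction m with
    | zero =>
      intro k hk
      have := h k.succ
      rw [affineRoot_succ_of_not_lt k (by omega)] at this
      omega
    | succ m ih =>
      intro k hk
      have := h k.succ
      rw [affineRoot_succ_of_lt k (by omega)] at this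
      have := ih ⟨k + 1, by omega⟩ (by simp only []; omega)
      omega
  refine LinearMap.pi_ext' fun k => LinearMap.ext_ring ?_
  exact le_antisymm (hle k k.2) (hge (n - (k + 1)) k (by have := k.2; omega))

/-! ### The height function -/

/-- The contribution to the height of a root with value `d`. -/
def rootHeight (d : ℤ) : ℤ := if 0 < d then d - 1 else -d

/-- Under s₀ the values on a₁ - aⱼ and a₁ + aⱼ are exchanged after d ↦ 1 - d; this symmetry keeps
their total contribution fixed. -/
theorem rootHeight_one_sub (d : ℤ) : rootHeight (1 - d) = rootHeight d := by
  unfold rootHeight; split_ifs <;> omega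

theorem rootHeight_neg {d : ℤ} (h : 0 < d) : rootHeight (-d) = rootHeight d + 1 := by
  unfold rootHeight; split_ifs <;> omega

theorem rootHeight_nonneg (d : ℤ) : 0 ≤ rootHeight d := by
  unfold rootHeight; split_ifs <;> omega

/-- The contribution to the height of the roots `aᵢ ± aⱼ`. -/
def pairHeight (a b : ℤ) : ℤ := rootHeight (a - b) + rootHeight (a + b)

/-- The length of the minimal length representative of the coset `t_v W`. -/
def height {n : ℕ} (v : Fin n → ℤ) : ℤ :=
  ∑ i, rootHeight (2 * v i) + ∑ i, ∑ j, if i < j then pairHeight (v i) (v j) else 0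

theorem height_zero (n : ℕ) : height (0 : Fin n → ℤ) = 0 := by
  simp [height, pairHeight, rootHeight]

theorem height_nonneg {n : ℕ} (v : Fin n → ℤ) : 0 ≤ height v := by
  refine add_nonneg (Finset.sum_nonneg fun i _ => rootHeight_nonneg _)
    (Finset.sum_nonneg fun i _ => Finset.sum_nonneg fun j _ => ?_)
  split_ifs
  · exact add_nonneg (rootHeight_nonneg _) (rootHeight_nonneg _)
  · rfl

theorem sum_rootHeight_update {n : ℕ} (v : Fin n → ℤ) (k : Fin n) (c : ℤ) :
    ∑ i, rootHeight (2 * Function.update v k c i) =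
      ∑ i, rootHeight (2 * v i) + (rootHeight (2 * c) - rootHeight (2 * v k)) := by
  rw [← Finset.add_sum_erase _ _ (Finset.mem_univ k), ← Finset.add_sum_erase _ (fun i =>
    rootHeight (2 * v i)) (Finset.mem_univ k)]
  have : ∑ i ∈ Finset.univ.erase k, rootHeight (2 * Function.update v k c i) =
      ∑ i ∈ Finset.univ.erase k, rootHeight (2 * v i) :=
    Finset.sum_congr rfl fun i hi => by rw [Function.update_of_ne (Finset.ne_of_mem_erase hi)]
  rw [this, Function.update_self]
  ring

/-- The reflection s₀ exchanges the two terms of each pair (1, j), so the only change comes from the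
root 2a₁. -/
theorem height_update_zero {n : ℕ} [NeZero n] (v : Fin n → ℤ) (h : v 0 ≤ 0) :
    height (Function.update v 0 (1 - v 0)) = height v + 1 := by
  have h1 : rootHeight (2 * (1 - v 0)) = rootHeight (2 * v 0) + 1 := by
    unfold rootHeight; split_ifs <;> omega
  have h2 : ∀ i j, (if i < j then pairHeight (Function.update v 0 (1 - v 0) i)
      (Function.update v 0 (1 - v 0) j) else 0) = if i < j then pairHeight (v i) (v j) else 0 := by
    intro i j
    split_ifs with hij
    · have hj : j ≠ 0 := (lt_of_le_of_lt (Fin.zero_le i) hij).ne'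
      rw [Function.update_of_ne hj]
      by_cases hi : i = 0
      · subst hi
        rw [Function.update_self, pairHeight, pairHeight, ← rootHeight_one_sub (v 0 - v j),
          ← rootHeight_one_sub (v 0 + v j), add_comm]
        congr 2 <;> ring
      · rw [Function.update_of_ne hi]
    · rfl
  rw [height, sum_rootHeight_update, h1]
  simp only [h2]
  rw [height]
  ring

/-- A sign change of the last coordinate exchanges the terms of aᵢ - aₙ and aᵢ + aₙ; only 2aₙ
contributes. -/
theorem height_update_last {n : ℕ} (v : Fin n → ℤ) (k : Fin n) (hk : ¬ (k : ℕ) + 1 < n)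
    (h : 0 < v k) : height (Function.update v k (-v k)) = height v + 1 := by
  have h1 : rootHeight (2 * (-v k)) = rootHeight (2 * v k) + 1 := by
    rw [mul_neg, rootHeight_neg (by omega)]
  have h2 : ∀ i j, (if i < j then pairHeight (Function.update v k (-v k) i)
      (Function.update v k (-v k) j) else 0) = if i < j then pairHeight (v i) (v j) else 0 := by
    intro i j
    split_ifs with hij
    · have hij' : (i : ℕ) < j := hij
      have hi : i ≠ k := by
        rintro rfl
        have := j.2
        omega
      rw [Function.update_of_ne hi]
      by_cases hj : j = k
      · subst hj
        rw [Function.update_self, pairHeight, pairHeight, sub_neg_eq_add, add_comm,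
          ← sub_eq_add_neg]
      · rw [Function.update_of_ne hj]
    · rfl
  rw [height, sum_rootHeight_update, h1]
  simp only [h2]
  rw [height]
  ring

/-- An adjacent transposition permutes all pairs of coordinates except that it reverses (k, k+1),
where the value on the simple root changes sign. -/
theorem height_swap {n : ℕ} (v : Fin n → ℤ) (k : Fin n) (hk : (k : ℕ) + 1 < n)
    (h : v ⟨k + 1, hk⟩ < v k) : height (v ∘ Equiv.swap k ⟨k + 1, hk⟩) = height v + 1 := by
  set l : Fin n := ⟨k + 1, hk⟩ with hl
  set e := Equiv.swap k l with he
  have hl' : (l : ℕ) = k + 1 := rfl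
  have hkl : k ≠ l := fun e => by have := congrArg Fin.val e; omega
  have h1 : ∑ i, rootHeight (2 * (v ∘ e) i) = ∑ i, rootHeight (2 * v i) :=
    Equiv.sum_comp e fun i => rootHeight (2 * v i)
  have h2 : (∑ i, ∑ j, if i < j then pairHeight ((v ∘ e) i) ((v ∘ e) j) else 0) =
      ∑ i, ∑ j, if e i < e j then pairHeight (v i) (v j) else 0 := by
    rw [← Equiv.sum_comp e]
    refine Finset.sum_congr rfl fun i _ => ?_
    rw [← Equiv.sum_comp e]
    refine Finset.sum_congr rfl fun j _ => ?_
    simp only [Function.comp_apply, he, Equiv.swap_apply_self]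
  have hval : ∀ i, i ≠ k → i ≠ l → e i = i := fun i => Equiv.swap_apply_of_ne_of_ne
  have hek : e k = l := Equiv.swap_apply_left _ _
  have hel : e l = k := Equiv.swap_apply_right _ _
  -- The order i < j is preserved by the transposition outside the two ordered pairs (k, l) and (l,
  -- k), which give the correction terms.
  have h3 : ∀ i j, (if e i < e j then pairHeight (v i) (v j) else 0) =
      (if i < j then pairHeight (v i) (v j) else 0) +
        (if i = l then if j = k then pairHeight (v i) (v j) else 0 else 0) -
        (if i = k then if j = l then pairHeight (v i) (v j) else 0 else 0) := by
    intro i j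
    have hcase : ∀ a : Fin n, a = k ∨ a = l ∨ (a ≠ k ∧ a ≠ l) := fun a => by tauto
    have hlt : k < l := by rw [Fin.lt_def]; omega
    rcases hcase i with rfl | rfl | ⟨hi1, hi2⟩ <;> rcases hcase j with rfl | rfl | ⟨hj1, hj2⟩
    · simp [hkl]
    · simp [hek, hel, hkl, hlt, hlt.not_gt]
    · have : l < j ↔ i < j := by
        have : (j : ℕ) ≠ l := fun e => hj2 (Fin.ext e)
        rw [Fin.lt_def, Fin.lt_def]; omega
      simp [hek, hval j hj1 hj2, hkl, hj2, this]
    · simp [hek, hel, hkl.symm, hlt, hlt.not_gt]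
    · simp [hkl.symm]
    · have : k < j ↔ l < j := by
        have : (j : ℕ) ≠ l := fun e => hj2 (Fin.ext e)
        rw [Fin.lt_def, Fin.lt_def]; omega
      simp [hel, hval j hj1 hj2, hkl.symm, hj1, this]
    · have : i < l ↔ i < j := by
        have : (i : ℕ) ≠ j := fun e => hi1 (Fin.ext e)
        rw [Fin.lt_def, Fin.lt_def]; omega
      simp [hek, hval i hi1 hi2, hi1, hi2, this]
    · have : i < k ↔ i < l := by
        have : (i : ℕ) ≠ k := fun e => hi1 (Fin.ext e)
        rw [Fin.lt_def, Fin.lt_def]; omega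
      simp [hel, hval i hi1 hi2, hi1, hi2, this]
    · simp [hval i hi1 hi2, hval j hj1 hj2, hi1, hi2]
  rw [height, h1, h2]
  simp only [h3, Finset.sum_add_distrib, Finset.sum_sub_distrib]
  have h4 : ∀ a b : Fin n, (∑ i, ∑ j, if i = a then if j = b then pairHeight (v i) (v j) else 0
      else 0) = pairHeight (v a) (v b) := by
    intro a b
    rw [Finset.sum_eq_single a (fun i _ hi => by simp [hi]) (by simp)]
    simp
  rw [h4, h4, height, pairHeight, pairHeight, add_comm (v l), ← neg_sub (v k),
    rootHeight_neg (by omega)]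
  ring

/-! ### Height and affine reflections -/

/-- The coordinates of an element of `Q^∨` in the basis `ε₁, …, εₙ`. -/
def coords {n : ℕ} (x : QDual n) (l : Fin n) : ℤ := x (Pi.single l 1)

theorem coords_affineReflection {n : ℕ} [NeZero n] (i : Fin (n + 1)) (x : QDual n) (l : Fin n) :
    coords (affineReflection i x) l =
      coords x l - affineRoot i x * corootAf i (Pi.single l 1 : P n) := rfl

theorem coords_affineReflection_zero {n : ℕ} [NeZero n] (x : QDual n) :
    coords (affineReflection (0 : Fin (n + 1)) x) =
      Function.update (coords x) 0 (1 - coords x 0) := by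
  funext l
  have h : corootAf (0 : Fin (n + 1)) (Pi.single l 1 : P n) = -(Pi.single l 1 : P n) 0 := rfl
  rw [coords_affineReflection, affineRoot_zero_apply, h]
  by_cases hl : l = 0
  · subst hl
    simp [coords]
    ring
  · simp [hl, Ne.symm hl]

theorem coords_affineReflection_of_lt {n : ℕ} [NeZero n] (k : Fin n) (hk : (k : ℕ) + 1 < n)
    (x : QDual n) : coords (affineReflection k.succ x) =
      coords x ∘ Equiv.swap k ⟨k + 1, hk⟩ := by
  funext l
  have h : corootAf k.succ (Pi.single l 1 : P n) =
    (Pi.single l 1 : P n) k - (Pi.single l 1 : P n) ⟨k + 1, hk⟩ :=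
    simpleCoroot_apply_of_lt k hk _
  have h1 : k ≠ ⟨k + 1, hk⟩ := fun e => by simpa using congrArg Fin.val e
  rw [coords_affineReflection, affineRoot_succ_of_lt k hk, h]
  by_cases hl : l = k
  · subst hl
    simp [coords, h1.symm]
  · by_cases hl' : l = ⟨k + 1, hk⟩
    · subst hl'
      simp [coords, h1]
    · simp [coords, Equiv.swap_apply_of_ne_of_ne hl hl', Ne.symm hl, Ne.symm hl']

theorem coords_affineReflection_of_not_lt {n : ℕ} [NeZero n] (k : Fin n) (hk : ¬ (k : ℕ) + 1 < n)
    (x : QDual n) : coords (affineReflection k.succ x) =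
      Function.update (coords x) k (-coords x k) := by
  funext l
  have h : corootAf k.succ (Pi.single l 1 : P n) = (Pi.single l 1 : P n) k :=
    simpleCoroot_apply_of_not_lt k hk _
  rw [coords_affineReflection, affineRoot_succ_of_not_lt k hk, h]
  by_cases hl : l = k
  · subst hl
    simp [coords]
    ring
  · simp [hl, Ne.symm hl]

theorem height_affineReflection {n : ℕ} [NeZero n] {i : Fin (n + 1)} {x : QDual n}
    (h : 0 < affineRoot i x) : height (coords (affineReflection i x)) = height (coords x) + 1 := by
  rcases Fin.eq_zero_or_eq_succ i with rfl | ⟨k, rfl⟩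
  · rw [affineRoot_zero_apply] at h
    rw [coords_affineReflection_zero, height_update_zero _ (by rw [coords]; omega)]
  · by_cases hk : (k : ℕ) + 1 < n
    · rw [affineRoot_succ_of_lt k hk] at h
      rw [coords_affineReflection_of_lt k hk, height_swap _ _ _ (by simp only [coords]; omega)]
    · rw [affineRoot_succ_of_not_lt k hk] at h
      rw [coords_affineReflection_of_not_lt k hk,
        height_update_last _ _ hk (by simp only [coords]; omega)]

theorem height_affineReflection_of_neg {n : ℕ} [NeZero n] {i : Fin (n + 1)} {x : QDual n}
    (h : affineRoot i x < 0) : height (coords x) = height (coords (affineReflection i x)) + 1 := by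
  have := height_affineReflection (i := i) (x := affineReflection i x)
    (by rw [affineRoot_reflection_self]; omega)
  rwa [affineReflection_self] at this

theorem height_affineReflection_le {n : ℕ} [NeZero n] (i : Fin (n + 1)) (x : QDual n) :
    height (coords (affineReflection i x)) ≤ height (coords x) + 1 := by
  rcases lt_trichotomy (affineRoot i x) 0 with h | h | h
  · have := height_affineReflection_of_neg h
    omega
  · rw [affineReflection, h, zero_smul, sub_zero]
    omega
  · exact (height_affineReflection h).le

theorem coords_zero (n : ℕ) : coords (0 : QDual n) = 0 := rfl

/-! ### Height as a lower bound for length -/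

theorem height_prod_le {n : ℕ} [NeZero n] (l : List (Fin (n + 1))) :
    height (coords (l.map (sAf (n := n))).prod.left.toAdd) ≤ l.length := by
  induction l with
  | nil =>
    change height (coords (0 : QDual n)) ≤ _
    rw [coords_zero, height_zero]
    simp
  | cons i l ih =>
    rw [List.map_cons, List.prod_cons, left_sAf_mul, List.length_cons]
    have := height_affineReflection_le i (l.map (sAf (n := n))).prod.left.toAdd
    push_cast
    omega

theorem exists_word {n : ℕ} [NeZero n] (x : Waf n) :
    ∃ l : List (Fin (n + 1)), (l.map sAf).prod = x := by
  have hx : x ∈ Subgroup.closure (Set.range (sAf (n := n))) := by rw [closure_sAf]; trivial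
  induction hx using Subgroup.closure_induction with
  | mem y hy =>
    obtain ⟨i, rfl⟩ := hy
    exact ⟨[i], by simp⟩
  | one => exact ⟨[], rfl⟩
  | mul y z _ _ hy hz =>
    obtain ⟨l, rfl⟩ := hy
    obtain ⟨m, rfl⟩ := hz
    exact ⟨l ++ m, by simp⟩
  | inv y _ hy =>
    obtain ⟨l, rfl⟩ := hy
    refine ⟨l.reverse, ?_⟩
    have : (List.map sAf l).map (fun x : Waf n => x⁻¹) = List.map sAf l := by
      rw [List.map_map]
      exact List.map_congr_left fun i _ => inv_eq_of_mul_eq_one_left (sAf_mul_self i)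
    rw [List.prod_inv_reverse, this, List.map_reverse]

/-- Each letter raises the height of the translation part by at most 1. The bound depends only on
the coset xW, hence applies to all its elements at once. -/
theorem height_le_len {n : ℕ} [NeZero n] (x : Waf n) :
    height (coords x.left.toAdd) ≤ len x := by
  obtain ⟨l, hl⟩ := exists_word x
  have hne : {m | ∃ l : List (Fin (n + 1)), l.length = m ∧ (l.map sAf).prod = x}.Nonempty :=
    ⟨l.length, l, rfl, hl⟩
  obtain ⟨l', h1, h2⟩ := Nat.sInf_mem hne
  rw [len, ← h1, ← h2]
  exact height_prod_le l'

theorem len_prod_le {n : ℕ} [NeZero n] (l : List (Fin (n + 1))) :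
    len (l.map (sAf (n := n))).prod ≤ l.length := Nat.sInf_le ⟨l, rfl, rfl⟩

/-! ### Schubert classes -/

/-- `f` is the class `P̂_w` attached to the minimal length representative `w` of `t_x W`, computed
from a reduced word of `w`. -/
inductive IsSchubertClass {n : ℕ} [NeZero n] : QDual n → LamHat n → Prop
  | one : IsSchubertClass 0 1
  | step {x : QDual n} {f : LamHat n} (i : Fin (n + 1)) (h : IsSchubertClass x f)
      (hi : 0 < affineRoot i x) : IsSchubertClass (affineReflection i x) (NilHecke.A i • f)

theorem IsSchubertClass.exists_word {n : ℕ} [NeZero n] {x : QDual n} {f : LamHat n}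
    (h : IsSchubertClass x f) : ∃ l : List (Fin (n + 1)), (l.map (sAf (n := n))).prod.left.toAdd = x ∧
      (l.length : ℤ) = height (coords x) ∧ f = dualSchurP l := by
  induction h with
  | one => exact ⟨[], rfl, by rw [coords_zero, height_zero]; rfl, (one_smul _ _).symm⟩
  | step i h hi ih =>
    obtain ⟨l, h1, h2, rfl⟩ := ih
    refine ⟨i :: l, ?_, ?_, ?_⟩
    · rw [List.map_cons, List.prod_cons, left_sAf_mul, h1]
    · rw [height_affineReflection hi, ← h2]; simp
    · rw [dualSchurP, dualSchurP, List.map_cons, List.prod_cons, mul_smul]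

/-- The word built along the steps has length equal to the height, which bounds from below the
length of every element of the coset. So the word is reduced and its product is minimal in the
coset. -/
theorem IsSchubertClass.mem_GammaHat {n : ℕ} [NeZero n] {x : QDual n} {f : LamHat n}
    (h : IsSchubertClass x f) : f ∈ GammaHat n := by
  obtain ⟨l, h1, h2, rfl⟩ := h.exists_word
  refine Submodule.subset_span ⟨l, ?_, fun v => ?_, rfl⟩
  · have := height_le_len (l.map (sAf (n := n))).prod
    rw [h1, ← h2] at this
    exact le_antisymm (by exact_mod_cast this) (len_prod_le l)
  · refine (len_prod_le l).trans ?_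
    have := height_le_len ((l.map (sAf (n := n))).prod * SemidirectProduct.inr v)
    have hl : ((l.map (sAf (n := n))).prod * SemidirectProduct.inr v).left =
        (l.map (sAf (n := n))).prod.left := by simp
    rw [hl, h1, ← h2] at this
    exact_mod_cast this

/-- Every x ≠ 0 has a negative affine simple root, and that reflection lowers the height. -/
theorem exists_isSchubertClass {n : ℕ} [NeZero n] (x : QDual n) : ∃ f, IsSchubertClass x f := by
  generalize hN : (height (coords x)).toNat = N
  induction N using Nat.strong_induction_on generalizing x with
  | _ N ih =>
    by_cases hx : x = 0
    · exact ⟨1, hx ▸ .one⟩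
    obtain ⟨i, hi⟩ := exists_affineRoot_neg hx
    have h1 := height_affineReflection_of_neg hi
    have h2 := height_nonneg (coords (affineReflection i x))
    obtain ⟨f, hf⟩ := ih _ (by omega) (affineReflection i x) rfl
    have := hf.step i (by rw [affineRoot_reflection_self]; omega)
    rw [affineReflection_self] at this
    exact ⟨_, this⟩

theorem isSchubertClass_cases {n : ℕ} [NeZero n] {x : QDual n} {f : LamHat n}
    (h : IsSchubertClass x f) : (x = 0 ∧ f = 1) ∨ ∃ i g, affineRoot i x < 0 ∧
      IsSchubertClass (affineReflection i x) g ∧ f = NilHecke.A i • g := by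
  cases h with
  | one => exact Or.inl ⟨rfl, rfl⟩
  | step i h hi =>
    refine Or.inr ⟨i, _, ?_, ?_, rfl⟩
    · rw [affineRoot_reflection_self]; omega
    · rwa [affineReflection_self]

theorem affineRoot_zero_nonneg {n : ℕ} [NeZero n] (i : Fin (n + 1)) :
    0 ≤ affineRoot i (0 : QDual n) := by
  rw [affineRoot, LinearMap.zero_apply, add_zero]
  split_ifs <;> omega

theorem A_succ_smul_one {n : ℕ} [NeZero n] (k : Fin n) : NilHecke.A k.succ • (1 : LamHat n) = 0 := by
  refine smul_LamHat_cancel (toS_simpleRoot_ne_zero k) ?_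
  rw [simpleRoot_smul_A, map_one, sub_self, smul_zero]

/-- The properties of Schubert classes that are proved by induction on the height. -/
theorem isSchubertClass_aux {n : ℕ} [NeZero n] (N : ℕ) : ∀ x : QDual n,
    (height (coords x)).toNat = N → (∀ f g, IsSchubertClass x f → IsSchubertClass x g → f = g) ∧
      ∀ i f, IsSchubertClass x f → affineRoot i x ≤ 0 → NilHecke.A i • f = 0 := by
  induction N using Nat.strong_induction_on with
  | _ N ih =>
    intro x hN
    subst hN
    have ih1 : ∀ y : QDual n, height (coords y) < height (coords x) → ∀ {f g : LamHat n},
        IsSchubertClass y f → IsSchubertClass y g → f = g := by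
      intro y hy f g
      have := height_nonneg (coords y)
      exact (ih _ (by omega) y rfl).1 f g
    have ih2 : ∀ y : QDual n, height (coords y) < height (coords x) → ∀ i {f : LamHat n},
        IsSchubertClass y f → affineRoot i y ≤ 0 → NilHecke.A i • f = 0 := by
      intro y hy i f
      have := height_nonneg (coords y)
      exact (ih _ (by omega) y rfl).2 i f
    -- Descending from `y` along the letter `i`.
    have desc : ∀ {y : QDual n} {i : Fin (n + 1)}, affineRoot i y < 0 →
        height (coords (affineReflection i y)) + 1 = height (coords y) := fun h =>
      (height_affineReflection_of_neg h).symm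
    have up : ∀ {y : QDual n} {i : Fin (n + 1)} {g : LamHat n}, affineRoot i y < 0 →
        IsSchubertClass (affineReflection i y) g → IsSchubertClass y (NilHecke.A i • g) := by
      intro y i g h hg
      have := hg.step i (by rw [affineRoot_reflection_self]; omega)
      rwa [affineReflection_self] at this
    constructor
    · intro f g hf hg
      rcases isSchubertClass_cases hf with ⟨h0, rfl⟩ | ⟨i, φ, hi, hφ, rfl⟩
      · rcases isSchubertClass_cases hg with ⟨_, rfl⟩ | ⟨j, γ, hj, hγ, rfl⟩
        · rfl
        · have := affineRoot_zero_nonneg (n := n) j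
          rw [h0] at hj
          omega
      rcases isSchubertClass_cases hg with ⟨h0, rfl⟩ | ⟨j, γ, hj, hγ, rfl⟩
      · have := affineRoot_zero_nonneg (n := n) i
        rw [h0] at hi
        omega
      by_cases hij : i = j
      · subst hij
        rw [ih1 _ (by have := desc hi; omega) hφ hγ]
      have r1 := affineRoot_reflection i j x
      have r2 := affineRoot_reflection j i x
      have di := desc hi
      have dj := desc hj
      -- Two descents i and j span a finite rank two system. Going down the full braid in either
      -- order reaches the same point, with a class χ; by induction both given classes come from χ,
      -- and the braid relation for the A's identifies them.
      rcases isFiniteCartan_of_nonpos hij hi.le hj.le with ⟨c1, c2⟩ | ⟨c1, c2⟩ | ⟨c, c1, c2⟩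
      · rw [c2] at r1
        rw [c1] at r2
        have hi' : affineRoot i (affineReflection j x) < 0 := by omega
        have hj' : affineRoot j (affineReflection i x) < 0 := by omega
        obtain ⟨χ, hχ⟩ := exists_isSchubertClass (affineReflection i (affineReflection j x))
        have e1 := ih1 _ (by omega) hγ (up hi' hχ)
        rw [affineReflection_two c1 c2] at hχ
        have e2 := ih1 _ (by omega) hφ (up hj' hχ)
        rw [e1, e2, A_braid_two c1 c2]
      · have s1 := affineRoot_reflection i j (affineReflection i x)
        have s2 := affineRoot_reflection j i (affineReflection j x)
        rw [affineRoot_reflection_self] at s1 s2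
        rw [c2] at r1 s1
        rw [c1] at r2 s2
        have hi' : affineRoot i (affineReflection j x) < 0 := by omega
        have hj' : affineRoot j (affineReflection i x) < 0 := by omega
        have hi'' : affineRoot i (affineReflection j (affineReflection i x)) < 0 := by omega
        have hj'' : affineRoot j (affineReflection i (affineReflection j x)) < 0 := by omega
        have di' := desc hi'
        have dj' := desc hj'
        obtain ⟨χ, hχ⟩ := exists_isSchubertClass
          (affineReflection i (affineReflection j (affineReflection i x)))
        have e1 := ih1 _ (by omega) hφ (up hj' (up hi'' hχ))
        rw [affineReflection_three c1 c2] at hχ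
        have e2 := ih1 _ (by omega) hγ (up hi' (up hj'' hχ))
        rw [e1, e2, A_braid_three c1 c2]
      · have s1 := affineRoot_reflection i j (affineReflection i x)
        have s2 := affineRoot_reflection j i (affineReflection j x)
        have t1 := affineRoot_reflection i j (affineReflection i (affineReflection j x))
        have t2 := affineRoot_reflection j i (affineReflection j (affineReflection i x))
        rw [affineRoot_reflection_self] at s1 s2 t1 t2
        rw [s1, r2] at t2
        rw [s2, r1] at t1
        rw [r2] at s1
        rw [r1] at s2
        have hi' : affineRoot i (affineReflection j x) < 0 := by rw [r1]; nlinarith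
        have hj' : affineRoot j (affineReflection i x) < 0 := by rw [r2]; nlinarith
        have hi'' : affineRoot i (affineReflection j (affineReflection i x)) < 0 := by
          rw [s1]; nlinarith
        have hj'' : affineRoot j (affineReflection i (affineReflection j x)) < 0 := by
          rw [s2]; nlinarith
        have hi3 : affineRoot i (affineReflection j (affineReflection i (affineReflection j x))) < 0
            := by
          rw [t1]
          -- In type C₂ the element sⱼ sᵢ sⱼ fixes αᵢ, so the value at the end of the chain is again
          -- that of αᵢ at x.
          have : -(affineRoot i x - affineRoot j x * corootAf j (alphaAf i)) -
            (-affineRoot j x - (affineRoot i x - affineRoot j x * corootAf j (alphaAf i)) *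
              corootAf i (alphaAf j)) * corootAf j (alphaAf i) = affineRoot i x := by
            linear_combination (affineRoot i x - affineRoot j x * corootAf j (alphaAf i)) * c
          omega
        have hj3 : affineRoot j (affineReflection i (affineReflection j (affineReflection i x))) < 0
            := by
          rw [t2]
          have : -(affineRoot j x - affineRoot i x * corootAf i (alphaAf j)) -
            (-affineRoot i x - (affineRoot j x - affineRoot i x * corootAf i (alphaAf j)) *
              corootAf j (alphaAf i)) * corootAf i (alphaAf j) = affineRoot j x := by
            linear_combination (affineRoot j x - affineRoot i x * corootAf i (alphaAf j)) * c
          omega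
        have di' := desc hi'
        have dj' := desc hj'
        have di'' := desc hi''
        have dj'' := desc hj''
        obtain ⟨χ, hχ⟩ := exists_isSchubertClass
          (affineReflection i (affineReflection j (affineReflection i (affineReflection j x))))
        have e1 := ih1 _ (by omega) hγ (up hi' (up hj'' (up hi3 hχ)))
        rw [affineReflection_four c] at hχ
        have e2 := ih1 _ (by omega) hφ (up hj' (up hi'' (up hj3 hχ)))
        rw [e1, e2, A_braid_four c]
    · intro i f hf hi
      rcases isSchubertClass_cases hf with ⟨rfl, rfl⟩ | ⟨j, φ, hj, hφ, rfl⟩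
      · rcases Fin.eq_zero_or_eq_succ i with rfl | ⟨k, rfl⟩
        · rw [affineRoot_zero_apply] at hi
          simp at hi
        · exact A_succ_smul_one k
      by_cases hij : i = j
      · rw [hij, A_smul_A_self]
      have r1 := affineRoot_reflection i j x
      have dj := desc hj
      -- With f = Aⱼ φ, the class is pulled down until Aᵢ Aⱼ ⋯ is a full braid word. After the braid
      -- relation the innermost operator meets a lower class on which, by induction, it vanishes.
      rcases isFiniteCartan_of_nonpos hij hi hj.le with ⟨c1, c2⟩ | ⟨c1, c2⟩ | ⟨c, c1, c2⟩
      · rw [c2] at r1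
        rw [A_braid_two c1 c2, ih2 _ (by omega) i hφ (by omega), smul_zero]
      · have s2 := affineRoot_reflection j i (affineReflection j x)
        rw [affineRoot_reflection_self] at s2
        rw [c2] at r1
        rw [c1] at s2
        have hi' : affineRoot i (affineReflection j x) < 0 := by omega
        have di' := desc hi'
        obtain ⟨χ, hχ⟩ := exists_isSchubertClass (affineReflection i (affineReflection j x))
        rw [ih1 _ (by omega) hφ (up hi' hχ), A_braid_three c1 c2,
          ih2 _ (by omega) j hχ (by omega), smul_zero, smul_zero]
      · have s2 := affineRoot_reflection j i (affineReflection j x)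
        have t1 := affineRoot_reflection i j (affineReflection i (affineReflection j x))
        rw [affineRoot_reflection_self] at s2 t1
        rw [s2, r1] at t1
        rw [r1] at s2
        have hi' : affineRoot i (affineReflection j x) < 0 := by rw [r1]; nlinarith
        have hj'' : affineRoot j (affineReflection i (affineReflection j x)) < 0 := by
          rw [s2]; nlinarith
        have hi3 : affineRoot i (affineReflection j (affineReflection i (affineReflection j x))) ≤ 0
            := by
          rw [t1]
          have : -(affineRoot i x - affineRoot j x * corootAf j (alphaAf i)) -
            (-affineRoot j x - (affineRoot i x - affineRoot j x * corootAf j (alphaAf i)) *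
              corootAf i (alphaAf j)) * corootAf j (alphaAf i) = affineRoot i x := by
            linear_combination (affineRoot i x - affineRoot j x * corootAf j (alphaAf i)) * c
          omega
        have di' := desc hi'
        have dj'' := desc hj''
        obtain ⟨χ, hχ⟩ := exists_isSchubertClass
          (affineReflection j (affineReflection i (affineReflection j x)))
        rw [ih1 _ (by omega) hφ (up hi' (up hj'' hχ)), A_braid_four c,
          ih2 _ (by omega) i hχ hi3, smul_zero, smul_zero, smul_zero]

theorem IsSchubertClass.A_smul_eq_zero {n : ℕ} [NeZero n] {x : QDual n} {f : LamHat n}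
    (h : IsSchubertClass x f) {i : Fin (n + 1)} (hi : affineRoot i x ≤ 0) : NilHecke.A i • f = 0 :=
  (isSchubertClass_aux _ x rfl).2 i f h hi

/-- The span of the Schubert classes contains 1, and each Aᵢ sends a class to another class or to 0;
with the Leibniz rule for coefficients the span is stable, hence contains 𝔸_af · 1. -/
theorem GammaHat_eq_cyclicSub (n : ℕ) [NeZero n] : GammaHat n = cyclicSub n := by
  refine le_antisymm (Submodule.span_le.mpr ?_) ?_
  · rintro _ ⟨l, _, _, rfl⟩
    exact ⟨_, rfl⟩
  · set N := Submodule.span (S n) {f : LamHat n | ∃ x : QDual n, IsSchubertClass x f} with hN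
    have hle : N ≤ GammaHat n :=
      Submodule.span_le.mpr (by rintro f ⟨_, hf⟩; exact hf.mem_GammaHat)
    refine (cyclicSub_le (N := N) (Submodule.subset_span ⟨0, .one⟩) fun i f hf => ?_).trans hle
    induction hf using Submodule.span_induction with
    | mem f hf =>
      obtain ⟨x, hx⟩ := hf
      by_cases hi : 0 < affineRoot i x
      · exact Submodule.subset_span ⟨_, hx.step i hi⟩
      · rw [hx.A_smul_eq_zero (by omega)]
        exact Submodule.zero_mem _
    | zero => rw [smul_zero]; exact Submodule.zero_mem _
    | add f g _ _ hf hg => rw [smul_add]; exact Submodule.add_mem _ hf hg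
    | smul p f hf h =>
      obtain ⟨q, r, e⟩ := exists_A_smul_smul i p
      rw [e]
      exact Submodule.add_mem _ (Submodule.smul_mem _ q hf) (Submodule.smul_mem _ r h)

/-! ### The action of `𝔸_af` on `ℂ[𝒵]` -/

theorem smul_mem_range_toLam {n : ℕ} [NeZero n] (a : NilHecke n) {f : LamHat n}
    (hf : f ∈ (toLam n).range) : a • f ∈ (toLam n).range := by
  rw [range_eq_cyclicSubalgebra] at hf ⊢
  exact smul_mem_cyclicSub a hf

/-- The isomorphism of `ℂ[𝒵]` with its image in `Λ̂_S`. -/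
def toLamEquiv (n : ℕ) : CZ n ≃ₐ[S n] (toLam n).range :=
  AlgEquiv.ofInjective (toLam n) (toLam_injective n)

/-- The action of an element of `𝔸_af` on `ℂ[𝒵]` that corresponds to its action on `Λ̂_S`. -/
def standardEnd {n : ℕ} [NeZero n] (a : NilHecke n) : AddMonoid.End (CZ n) where
  toFun f := (toLamEquiv n).symm ⟨a • toLam n f, smul_mem_range_toLam a ⟨f, rfl⟩⟩
  map_zero' := by
    rw [AlgEquiv.symm_apply_eq]
    apply Subtype.ext
    simp
  map_add' f g := by
    rw [← map_add, EmbeddingLike.apply_eq_iff_eq]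
    apply Subtype.ext
    simp

theorem toLam_standardEnd {n : ℕ} [NeZero n] (a : NilHecke n) (f : CZ n) :
    toLam n (standardEnd a f) = a • toLam n f :=
  congrArg Subtype.val ((toLamEquiv n).apply_symm_apply
    ⟨a • toLam n f, smul_mem_range_toLam a ⟨f, rfl⟩⟩)

/-- The action of `𝔸_af` on `ℂ[𝒵]` that corresponds to the action on `Λ̂_S`. -/
def standardAction (n : ℕ) [NeZero n] : NilHecke n →+* AddMonoid.End (CZ n) where
  toFun := standardEnd
  map_one' := DFunLike.ext _ _ fun f => toLam_injective n
    ((toLam_standardEnd 1 f).trans (one_smul _ _))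
  map_mul' a b := DFunLike.ext _ _ fun f => toLam_injective n (by
    have h : (standardEnd a * standardEnd b : AddMonoid.End (CZ n)) f =
      standardEnd a (standardEnd b f) := rfl
    rw [h, toLam_standardEnd, toLam_standardEnd, toLam_standardEnd, mul_smul])
  map_zero' := DFunLike.ext _ _ fun f => toLam_injective n
    ((toLam_standardEnd 0 f).trans ((zero_smul _ _).trans (map_zero (toLam n)).symm))
  map_add' a b := DFunLike.ext _ _ fun f => toLam_injective n (by
    have h : (standardEnd a + standardEnd b : AddMonoid.End (CZ n)) f =
      standardEnd a f + standardEnd b f := rfl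
    rw [h, map_add, toLam_standardEnd, toLam_standardEnd, toLam_standardEnd, add_smul])

theorem toLam_standardAction {n : ℕ} [NeZero n] (a : NilHecke n) (f : CZ n) :
    toLam n (standardAction n a f) = a • toLam n f := toLam_standardEnd a f

theorem isStandardAction_standardAction (n : ℕ) [NeZero n] :
    IsStandardAction (standardAction n) where
  scalar p f := toLam_injective n (by rw [toLam_standardAction, NilHecke.ofS_smul, map_smul])
  refl k f := toLam_injective n (by
    rw [toLam_standardAction, ofWaf_inr_smul, toLam_sigma])
  transl i f := toLam_injective n (by
    rw [toLam_standardAction, NilHecke.transl_smul, map_mul, toLam_z_diag])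

theorem W_induction {n : ℕ} {p : W n → Prop} (h1 : p 1) (hs : ∀ k, p (sW k))
    (hmul : ∀ v w, p v → p w → p (v * w)) (hinv : ∀ v, p v → p v⁻¹) (w : W n) : p w := by
  obtain ⟨w, hw⟩ := w
  induction hw using Subgroup.closure_induction with
  | mem x hx =>
    obtain ⟨k, rfl⟩ := hx
    exact hs k
  | one => exact h1
  | mul x y hx hy h2 h3 => exact hmul _ _ h2 h3
  | inv x hx h2 => exact hinv _ h2

/-- The conditions fix W and the translation in s₀, hence every sᵢ. Then αᵢ Aᵢ = 1 - sᵢ fixes Aᵢ,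
because ℂ[𝒵] is torsion-free over S. -/
theorem IsStandardAction.eq {n : ℕ} [NeZero n] {ρ ρ' : NilHecke n →+* AddMonoid.End (CZ n)}
    (h : IsStandardAction ρ) (h' : IsStandardAction ρ') : ρ' = ρ := by
  have hW : ∀ w : W n, ρ' (NilHecke.ofWaf (SemidirectProduct.inr w)) =
      ρ (NilHecke.ofWaf (SemidirectProduct.inr w)) := by
    intro w
    induction w using W_induction with
    | h1 => rw [map_one, ofWaf_one, map_one, map_one]
    | hs k => exact DFunLike.ext _ _ fun f => (h'.refl k f).trans (h.refl k f).symm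
    | hmul v w hv hw => rw [map_mul, ofWaf_mul, map_mul, map_mul, hv, hw]
    | hinv v hv =>
      refine left_inv_eq_right_inv (a := ρ (NilHecke.ofWaf (SemidirectProduct.inr v))) ?_ ?_
      · rw [← hv, ← map_mul, ← ofWaf_mul, ← map_mul, inv_mul_cancel, map_one, ofWaf_one, map_one]
      · rw [← map_mul, ← ofWaf_mul, ← map_mul, mul_inv_cancel, map_one, ofWaf_one, map_one]
  have hs : ∀ i : Fin (n + 1), ρ' (NilHecke.ofWaf (sAf i)) = ρ (NilHecke.ofWaf (sAf i)) := by
    intro i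
    rcases Fin.eq_zero_or_eq_succ i with rfl | ⟨k, rfl⟩
    · have h0 : sAf (0 : Fin (n + 1)) = (TypeC.transl (eps (0 : Fin n)) : Waf n) *
          SemidirectProduct.inr (sTheta n) := rfl
      have ht : ρ' (NilHecke.ofWaf (TypeC.transl (eps 0))) = ρ (NilHecke.ofWaf (TypeC.transl (eps 0))) :=
        DFunLike.ext _ _ fun f => (h'.transl 0 f).trans (h.transl 0 f).symm
      rw [h0, ofWaf_mul, map_mul, map_mul, hW, ht]
    · exact hW _
  have hA : ∀ i : Fin (n + 1), ρ' (NilHecke.A i) = ρ (NilHecke.A i) := by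
    intro i
    refine DFunLike.ext _ _ fun f => ?_
    have key : ∀ {τ : NilHecke n →+* AddMonoid.End (CZ n)}, IsStandardAction τ →
        (toS (alphaAf i) : S n) • τ (NilHecke.A i) f = f - τ (NilHecke.ofWaf (sAf i)) f := by
      intro τ hτ
      have h1 : τ (NilHecke.ofS (toS (alphaAf i)) * NilHecke.A i) f =
          (1 - τ (NilHecke.ofWaf (sAf i))) f := by rw [ofS_alphaAf_mul_A, map_sub, map_one]
      rw [map_mul] at h1
      exact (hτ.scalar _ _).symm.trans h1
    rw [← sub_eq_zero]
    refine smul_CZ_eq_zero (toS_alphaAf_ne_zero i) ?_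
    rw [smul_sub, key h', key h, hs, sub_self]
  ext1 ⟨a, ha⟩
  induction ha using Subring.closure_induction with
  | mem x hx =>
    rcases hx with ⟨p, rfl⟩ | ⟨i, rfl⟩
    · exact DFunLike.ext _ _ fun f => (h'.scalar p f).trans (h.scalar p f).symm
    · exact hA i
  | zero => exact (map_zero ρ').trans (map_zero ρ).symm
  | one => exact (map_one ρ').trans (map_one ρ).symm
  | add x y hx hy h1 h2 =>
    have : ρ' ((⟨x, hx⟩ : NilHecke n) + ⟨y, hy⟩) = ρ ((⟨x, hx⟩ : NilHecke n) + ⟨y, hy⟩) := by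
      rw [map_add, map_add, h1, h2]
    exact this
  | neg x hx h1 =>
    exact (map_neg ρ' ⟨x, hx⟩).trans ((congrArg Neg.neg h1).trans (map_neg ρ ⟨x, hx⟩).symm)
  | mul x y hx hy h1 h2 =>
    have : ρ' ((⟨x, hx⟩ : NilHecke n) * ⟨y, hy⟩) = ρ ((⟨x, hx⟩ : NilHecke n) * ⟨y, hy⟩) := by
      rw [map_mul, map_mul, h1, h2]
    exact this

end

end TypeC

/-! ### Assembly of the main theorem -/

theorem mainTheorem5 (n : ℕ) [NeZero n] :
    ∃ ρ : TypeC.NilHecke n →+* AddMonoid.End (TypeC.CZ n),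
      TypeC.IsStandardAction ρ ∧
      (∀ ρ' : TypeC.NilHecke n →+* AddMonoid.End (TypeC.CZ n),
        TypeC.IsStandardAction ρ' → ρ' = ρ) ∧
      ∃ Γ : Subalgebra (TypeC.S n) (TypeC.LamHat n),
        Subalgebra.toSubmodule Γ = TypeC.GammaHat n ∧
        (∀ (a : TypeC.NilHecke n), ∀ f ∈ Γ, a • f ∈ Γ) ∧
        ∃ β : TypeC.CZ n ≃ₐ[TypeC.S n] Γ,
          (∀ (a : TypeC.NilHecke n) (f : TypeC.CZ n),
            (β (ρ a f) : TypeC.LamHat n) = a • (β f : TypeC.LamHat n)) ∧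
          (∀ i j : TypeC.Idx n, i ≤ j →
            (β (TypeC.z i j) : TypeC.LamHat n) =
              (-1) ^ ((j : ℕ) - (i : ℕ)) *
                TypeC.qHat ((j : ℕ) - (i : ℕ))
                  (fun l : Finset.Icc i j => TypeC.bSeq (l : TypeC.Idx n))) ∧
          (∀ i : Fin n,
            (β (TypeC.z (TypeC.Idx.ofFin i) (TypeC.Idx.ofFin i)) : TypeC.LamHat n) =
              TypeC.Omega (MvPolynomial.X i)) := by
  have hΓ : Subalgebra.toSubmodule (TypeC.toLam n).range = TypeC.GammaHat n := by
    rw [TypeC.range_eq_cyclicSubalgebra, TypeC.GammaHat_eq_cyclicSub]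
    rfl
  refine ⟨TypeC.standardAction n, TypeC.isStandardAction_standardAction n,
    fun ρ' h => (TypeC.isStandardAction_standardAction n).eq h, (TypeC.toLam n).range, hΓ,
    fun a f hf => TypeC.smul_mem_range_toLam a hf, TypeC.toLamEquiv n,
    TypeC.toLam_standardAction, TypeC.toLam_z_eq_qHat, TypeC.toLam_z_diag⟩
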